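/- Let $k$ be an algebraically closed field of characteristic $2$. Let $\overline X$ be a projective variety over $k$ (reduced and irreducible) of even dimension $n>0$, $\mathcal L$ a line bundle on $\overline X$, and $M\subset H^0(\overline X,\mathcal L)$ a linear subspace of dimension $m+1$ with $m>n$. Let $\mathbf P=\mathbf P_*(M)$ be the projective space of lines in $M$; for $0\neq f\in M$ let $[f]\in\mathbf P$ be the corresponding point. "Point" means closed point. Let $X=\overline X\setminus(\mathrm{Sing}(\overline X)\cup \mathrm{Bs}(|M|))$, let $D_{[f]}\subset X$ be the divisor of zeros of $f$, let $\Psi:X\to\mathbf P^\vee$ be the morphism defined by $|M|$, and let $X^\circ\subset X$ be the set of points $p$ at which $d_p\Psi$ is injective. Assume that $X^\circ$ is dense in $\overline X$. For $p\in X$ and $d\ge 1$ let $$v_p^{[d]}:M\to \mathcal L_p/\mathfrak m_p^{d+1}\mathcal L_p$$ be the evaluation homomorphism. Let $\mathcal D\subset X\times\mathbf P$ be the universal divisor $\{(p,[f]) : p\in D_{[f]}\}$, that is, the zero scheme of the tautological section $\sigma$ of $\widetilde{\mathcal L}=\mathrm{pr}_1^*\mathcal L\otimes\mathrm{pr}_2^*\mathcal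 O(1)$. Let $\mathcal C$ be the critical subscheme of the projection $\mathcal D\to\mathbf P$ (locally defined by the $m\times m$ minors of its differential), and $\mathcal C^\circ=\mathcal C\cap(X^\circ\times\mathbf P)$. The universal Hessian on $\mathcal C^\circ$ is the form on the pull-back of the tangent bundle of $X^\circ$, with values in $\widetilde{\mathcal L}|_{\mathcal C^\circ}$, given by $(\theta,\theta')\mapsto\theta\theta'\sigma$; it is alternating since $\operatorname{char}k=2$. Let $\mathcal R\subset\mathcal C^\circ$ be its degeneracy subscheme, locally defined by the Pfaffian (the square root of the determinant) of a matrix of the form. Let $\mathcal R^{\rm sm}$ be the set of points of $\mathcal R$ at which $\mathcal R$ is smooth of dimension $m-2$. A property holds at a general point of $\mathcal R$ if it holds at all points of a dense open subset of $\mathcal R$. Let $D$ be a divisor of $X$ that is singular at $p\in X$, defined at $p$ by a formal power series $\phi$ in a formal parameter system of $X$ at $p$. Its Hessian at $p$ is the matrix $H=(\partial^2\phi/\partial x_i\partial x_j(p))$. * The singularity is of type A if $\operatorname{rank} H=n-2$ and, for a formal parameter system $(x_1,\dots,x_{n-2},\xi_1,\xi_2)$ in which $H$ is the block-diagonal matrix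 with $(n-2)/2$ blocks $\begin{pmatrix}0&1\\-1&0\end{pmatrix}$ followed by zeros, at least one of the coefficients of $\xi_1^2,\ \xi_2^2,\ \xi_1^3,\ \xi_1^2\xi_2,\ \xi_1\xi_2^2,\ \xi_2^3$ in $\phi$ is nonzero. This does not depend on the choices. * It is of type (C) if $\operatorname{rank}H=n-2$ and $\dim_k k[[x_1,\dots,x_n]]/(\phi,\partial\phi/\partial x_1,\dots,\partial\phi/\partial x_n)\le 4$. * It is of type (R) if $\operatorname{rank}H=n-2$ and $\dim_k k[[x_1,\dots,x_n]]/(\phi,\partial\phi/\partial x_1,\dots,\partial\phi/\partial x_n,\rho)\le 4$, where $\rho=\sqrt{\det(\partial^2\phi/\partial x_i\partial x_j)}$ is the Pfaffian. Then the following hold. 1. If $v_p^{[2]}$ is surjective at every point $p$ of $X^\circ$, then $\mathcal R$ is irreducible. 2. If $v_p^{[3]}$ is surjective at every point $p$ of $X^\circ$, then $\mathcal R^{\rm sm}$ is dense in $\mathcal R$. Moreover, if $P=(p,[f])$ is a general point of $\mathcal R$, then the singularity of $D_{[f]}$ at $p$ is of type A and of type (C). 3. If $v_p^{[4]}$ is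 surjective at every point $p$ of $X^\circ$, and $P=(p,[f])$ is a general point of $\mathcal R$, then the singularity of $D_{[f]}$ at $p$ is of type (R). -/

import Mathlib

open CategoryTheory AlgebraicGeometry IsLocalRing

universe u

noncomputable section

namespace DiscriminantVariety

/-! ## Pfaffians and alternating matrices -/

/-- The square-root polynomial of the determinant of an alternating `n × n` matrix, `n` even: the
signed sum of the products `A i₁ j₁ * ⋯ * A iᵣ jᵣ`, `r = n / 2`, over all ways of writing
`{1, …, n} = {i₁, j₁, …, iᵣ, jᵣ}` with `i_ν < j_ν` and `i₁ < i₂ < ⋯ < iᵣ`.  The list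
`i₁, j₁, …, iᵣ, jᵣ` is recorded as a permutation `w`. -/
def pfaffian {R : Type*} [CommRing R] (n : ℕ) (A : Matrix (Fin n) (Fin n) R) : R :=
  open Classical in
  ∑ w ∈ (Finset.univ : Finset (Equiv.Perm (Fin n))).filter (fun w =>
      (∀ ν : Fin (n / 2), w ⟨2 * ν, by omega⟩ < w ⟨2 * ν + 1, by omega⟩) ∧
      (∀ ν μ : Fin (n / 2), ν < μ → w ⟨2 * ν, by omega⟩ < w ⟨2 * μ, by omega⟩)),
    ((Equiv.Perm.sign w : ℤ) : R) *
      ∏ ν : Fin (n / 2), A (w ⟨2 * ν, by omega⟩) (w ⟨2 * ν + 1, by omega⟩)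

/-- The `n × n` matrix with `r` diagonal blocks `[0, 1; -1, 0]` followed by zeros. -/
def stdAlternating (R : Type*) [CommRing R] (n r : ℕ) : Matrix (Fin n) (Fin n) R :=
  Matrix.of fun i j =>
    if (i : ℕ) < 2 * r ∧ Even (i : ℕ) ∧ (j : ℕ) = i + 1 then 1
    else if (j : ℕ) < 2 * r ∧ Even (j : ℕ) ∧ (i : ℕ) = j + 1 then -1
    else 0

/-! ## Hypersurface singularities given by a formal power series -/

section PowerSeries

variable {k : Type u} [Field k] {n : ℕ}

/-- The matrix `(∂²F / ∂xᵢ∂xⱼ)` of power series. -/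
def hessianSeries (F : MvPowerSeries (Fin n) k) :
    Matrix (Fin n) (Fin n) (MvPowerSeries (Fin n) k) :=
  Matrix.of fun i j => MvPowerSeries.pderiv k i (MvPowerSeries.pderiv k j F)

/-- The Hessian matrix at the origin. -/
def hessian (F : MvPowerSeries (Fin n) k) : Matrix (Fin n) (Fin n) k :=
  (hessianSeries F).map MvPowerSeries.constantCoeff

/-- The ideal `(F, ∂F/∂x₁, …, ∂F/∂xₙ)`, defining the scheme `C(D, p)`. -/
def idealC (F : MvPowerSeries (Fin n) k) : Ideal (MvPowerSeries (Fin n) k) :=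
  Ideal.span ({F} ∪ Set.range fun i => MvPowerSeries.pderiv k i F)

/-- The ideal `(F, ∂F/∂x₁, …, ∂F/∂xₙ, ρ)`, `ρ` the square root of `det (∂²F / ∂xᵢ∂xⱼ)`, defining
the scheme `R(D, p)`. -/
def idealR (F : MvPowerSeries (Fin n) k) : Ideal (MvPowerSeries (Fin n) k) :=
  idealC F ⊔ Ideal.span {pfaffian n (hessianSeries F)}

/-- The power series `F` and the given coordinates `(x₁, …, x_{n-2}, ξ₁, ξ₂)` are such that the
Hessian matrix is the standard alternating matrix of rank `n - 2` (the coordinates are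
admissible), and one of the coefficients of
`ξ₁², ξ₂², ξ₁³, ξ₁²ξ₂, ξ₁ξ₂², ξ₂³` in `F` does not vanish. -/
def HasFormA (F : MvPowerSeries (Fin n) k) : Prop :=
  hessian F = stdAlternating k n ((n - 2) / 2) ∧
  ∃ ξ₁ ξ₂ : Fin n, (ξ₁ : ℕ) + 2 = n ∧ (ξ₂ : ℕ) + 1 = n ∧
    ∃ ab ∈ ({(2, 0), (0, 2), (3, 0), (2, 1), (1, 2), (0, 3)} : Set (ℕ × ℕ)),
      MvPowerSeries.coeff (Finsupp.single ξ₁ ab.1 + Finsupp.single ξ₂ ab.2) F ≠ 0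

/-- Type (C): the Hessian has rank `n - 2` and `dim_k k[[x]] / (F, ∂ᵢF) ≤ 4`. -/
def HasFormC (F : MvPowerSeries (Fin n) k) : Prop :=
  (hessian F).rank = n - 2 ∧ Module.rank k (MvPowerSeries (Fin n) k ⧸ idealC F) ≤ 4

/-- Type (R): the Hessian has rank `n - 2` and `dim_k k[[x]] / (F, ∂ᵢF, ρ) ≤ 4`. -/
def HasFormR (F : MvPowerSeries (Fin n) k) : Prop :=
  (hessian F).rank = n - 2 ∧ Module.rank k (MvPowerSeries (Fin n) k ⧸ idealR F) ≤ 4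

end PowerSeries

/-! ## Projective varieties with a line bundle -/

attribute [local instance] MvPolynomial.gradedAlgebra

/-- Projective `N`-space `Proj k[T₀, …, T_N]`. -/
def projectiveSpace (k : Type u) [Field k] (N : ℕ) : Scheme.{u} :=
  Proj (MvPolynomial.homogeneousSubmodule (Fin (N + 1)) k)

/-- The structure morphism of projective `N`-space over `k`. -/
def projectiveSpaceToSpec (k : Type u) [Field k] (N : ℕ) :
    projectiveSpace k N ⟶ Spec (CommRingCat.of k) :=
  Proj.toSpecZero (MvPolynomial.homogeneousSubmodule (Fin (N + 1)) k) ≫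
    Spec.map (CommRingCat.ofHom
      (algebraMap k (MvPolynomial.homogeneousSubmodule (Fin (N + 1)) k 0)))

/-- An `𝒪_X`-module is a line bundle if it is locally isomorphic to `𝒪_X`. -/
def IsLineBundle {X : Scheme.{u}} (L : X.Modules) : Prop :=
  ∀ x : X, ∃ U : X.Opens, x ∈ U ∧
    Nonempty ((L.restrict U.ι : (U : Scheme.{u}).Modules) ≅
      (SheafOfModules.unit (U : Scheme.{u}).ringCatSheaf : (U : Scheme.{u}).Modules))

/-- A projective variety over `k` together with a line bundle on it. -/
structure PolarizedVariety (k : Type u) [Field k] where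
  /-- the variety -/
  X : Scheme.{u}
  /-- its structure morphism -/
  toSpec : X ⟶ Spec (CommRingCat.of k)
  /-- reduced and irreducible -/
  isIntegral : IsIntegral X
  /-- a closed subscheme of a projective space over `k` -/
  projective : ∃ (N : ℕ) (i : X ⟶ projectiveSpace k N),
    IsClosedImmersion i ∧ i ≫ projectiveSpaceToSpec k N = toSpec
  /-- the line bundle -/
  L : X.Modules
  /-- it is a line bundle -/
  isLineBundle : IsLineBundle L

namespace PolarizedVariety

variable {k : Type u} [Field k] (V : PolarizedVariety k)

/-- The constant functions `k → H⁰(X, 𝒪_X)`. -/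
def const : k →+* Γ(V.X, ⊤) :=
  ((Scheme.ΓSpecIso (CommRingCat.of k)).inv ≫ V.toSpec.appTop).hom

/-- The `k`-vector space `H⁰(X, L)`. -/
def Sections : Type u := Γ(V.L, (⊤ : V.X.Opens))

instance : AddCommGroup V.Sections := inferInstanceAs (AddCommGroup Γ(V.L, (⊤ : V.X.Opens)))

instance : Module Γ(V.X, ⊤) V.Sections :=
  inferInstanceAs (Module Γ(V.X, ⊤) Γ(V.L, (⊤ : V.X.Opens)))

instance : Module k V.Sections := Module.compHom V.Sections V.const

/-- The local ring `𝒪_{X,p}`. -/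
def O (p : V.X) : Type u := V.X.presheaf.stalk p

instance (p : V.X) : CommRing (V.O p) := inferInstanceAs (CommRing (V.X.presheaf.stalk p))

instance (p : V.X) : IsLocalRing (V.O p) := inferInstanceAs (IsLocalRing (V.X.presheaf.stalk p))

/-- The germ at `p` of a regular function. -/
def germ (U : V.X.Opens) (p : V.X) (hp : p ∈ U) : Γ(V.X, U) →+* V.O p :=
  (V.X.presheaf.germ U p hp).hom

instance (p : V.X) : Algebra k (V.O p) := ((V.germ ⊤ p trivial).comp V.const).toAlgebra

/-- The stalk `L_p`, a module over `𝒪_{X,p}`. -/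
def LStalk (p : V.X) : Type u := V.L.presheaf.stalk p

instance (p : V.X) : AddCommGroup (V.LStalk p) :=
  inferInstanceAs (AddCommGroup (V.L.presheaf.stalk p))

/-- `L` as a presheaf of modules over the presheaf of rings `𝒪_X`. -/
def presheafL : PresheafOfModules.{u} (V.X.presheaf ⋙ forget₂ CommRingCat.{u} RingCat.{u}) :=
  V.L.val

instance (p : V.X) : Module (V.O p) (V.LStalk p) :=
  inferInstanceAs (Module (V.X.presheaf.stalk p)
    (TopCat.Presheaf.stalk (C := Ab.{u}) V.presheafL.presheaf p))

/-- The germ at `p` of a global section of `L`. -/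
def sectionGerm (p : V.X) : V.Sections →+ V.LStalk p :=
  (V.L.presheaf.germ ⊤ p trivial).hom

theorem sectionGerm_smul (p : V.X) (r : Γ(V.X, ⊤)) (s : V.Sections) :
    V.sectionGerm p (r • s) = V.germ ⊤ p trivial r • V.sectionGerm p s :=
  PresheafOfModules.germ_smul V.presheafL p ⊤ trivial r s

theorem sectionGerm_smul_const (p : V.X) (c : k) (s : V.Sections) :
    V.sectionGerm p (c • s) = algebraMap k (V.O p) c • V.sectionGerm p s :=
  V.sectionGerm_smul p (V.const c) s

/-- `e` is a free generator of the line bundle at `p`. -/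
def IsGenerator (p : V.X) (e : V.LStalk p) : Prop :=
  Function.Bijective fun a : V.O p => a • e

/-- `φ` is a local equation at `p` of the divisor `D` of zeros of `s`. -/
def IsLocalEquation (s : V.Sections) (p : V.X) (φ : V.O p) : Prop :=
  ∃ e, V.IsGenerator p e ∧ V.sectionGerm p s = φ • e

/-- `p` is a nonsingular point of the `n`-dimensional variety `X`. -/
def IsNonsingularAt (n : ℕ) (p : V.X) : Prop :=
  ∃ U : V.X.Opens, p ∈ U ∧ SmoothOfRelativeDimension n (U.ι ≫ V.toSpec)

variable (M : Submodule k V.Sections)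

/-- The base locus of the linear system `|M|`. -/
def baseLocus : Set V.X :=
  {p | ∀ s ∈ M, V.sectionGerm p s ∈ maximalIdeal (V.O p) • (⊤ : Submodule (V.O p) (V.LStalk p))}

/-- The evaluation map `v_p^{[d]} : M → L_p / 𝔪_p^{d+1} L_p`. -/
def evalMap (p : V.X) (d : ℕ) (s : M) :
    V.LStalk p ⧸ (maximalIdeal (V.O p) ^ (d + 1) • (⊤ : Submodule (V.O p) (V.LStalk p))) :=
  Submodule.Quotient.mk (V.sectionGerm p s)

/-- The closed points of `X = X̄ \ (Sing X̄ ∪ Bs |M|)`. -/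
def regularPart (n : ℕ) : Set V.X :=
  {p | IsClosed ({p} : Set V.X) ∧ V.IsNonsingularAt n p ∧ p ∉ V.baseLocus M}

/-- The closed points `p` of `X` at which the differential of the morphism `Ψ` from `X` to the
dual projective space of `P(M)` is injective.  Tangent vectors at `p` are the `k`-derivations
`v : 𝒪_{X,p} → κ(p)`; the functions `h` below, the quotients `s / t` with `s, t ∈ M` and
`t(p) ≠ 0`, are the pull-backs under `Ψ` of the affine coordinate functions around `Ψ(p)`, so that
`v` is killed by `d_pΨ` if and only if it kills all of them. -/
def immersedPart (n : ℕ) : Set V.X :=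
  {p | p ∈ V.regularPart M n ∧
    ∀ v : Derivation k (V.O p) (ResidueField (V.O p)),
      (∀ s ∈ M, ∀ t ∈ M, ∀ h : V.O p, V.IsGenerator p (V.sectionGerm p t) →
        V.sectionGerm p s = h • V.sectionGerm p t → v h = 0) → v = 0}

/-! ### Closed points of `X̄ × P(M)` and their Zariski topology -/

/-- The closed points `(p, [f])` of `X̄ × P(M)`. -/
structure ProdPoint where
  /-- the closed point of `X̄` -/
  pt : V.X
  /-- it is closed -/
  isClosed : IsClosed ({pt} : Set V.X)
  /-- the point `[f]` of `P(M)` -/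
  hyp : Projectivization k M

variable {V M}

/-- A nonzero vector `f ∈ M` with `P = (p, [f])`. -/
def ProdPoint.f (P : V.ProdPoint M) : M := P.hyp.rep

/-- The Zariski topology: it is generated by the nonvanishing loci of the homogeneous
polynomials on `M` (written in linear coordinates) whose coefficients are regular functions on
an open subset of `X̄`. -/
instance : TopologicalSpace (V.ProdPoint M) :=
  TopologicalSpace.generateFrom
    {W | ∃ (U : V.X.Opens) (b : Module.Basis (Fin (Module.finrank k M)) k M) (d : ℕ)
      (F : MvPolynomial (Fin (Module.finrank k M)) Γ(V.X, U)), F.IsHomogeneous d ∧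
      W = {P | ∃ hp : P.pt ∈ U, IsUnit (MvPolynomial.eval₂ (V.germ U P.pt hp)
        (fun i => algebraMap k (V.O P.pt) (b.repr P.f i)) F)}}

/-! ### The local ring of `X̄ × P(M)` at a closed point, and the subschemes `D`, `C`, `R` -/

variable (V M) in
/-- Coordinates at `(p, [f])`: a generator of `L` at `p`, a basis `b₀ = f, b₁, …, b_m` of `M`, and
the local expressions of the `bᵢ`. -/
structure Frame (m : ℕ) (P : V.ProdPoint M) where
  /-- a generator of `L` at `p` -/
  e : V.LStalk P.pt
  /-- it is a generator -/
  isGenerator : V.IsGenerator P.pt e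
  /-- a basis of `M` -/
  b : Module.Basis (Fin (m + 1)) k M
  /-- it starts with `f` -/
  b_zero : b 0 = P.f
  /-- the regular functions `bᵢ / e` -/
  φ : Fin (m + 1) → V.O P.pt
  /-- they are the `bᵢ / e` -/
  φ_spec : ∀ i, V.sectionGerm P.pt (b i) = φ i • e

namespace Frame

variable {m : ℕ} {P : V.ProdPoint M} (𝔣 : Frame V M m P)

/-- The affine chart `𝒪_{X,p}[y₁, …, y_m]`, where `yᵢ = Yᵢ / Y₀` for the coordinates `Y₀, …, Y_m` of
`M` with respect to the basis `b`; the point `[f]` is the origin. -/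
abbrev Chart (_ : Frame V M m P) : Type u := MvPolynomial (Fin m) (V.O P.pt)

/-- The prime ideal of the point `P`: the polynomials that vanish at `(p, 0)`. -/
def pointIdeal : Ideal 𝔣.Chart :=
  (maximalIdeal (V.O P.pt)).comap (MvPolynomial.constantCoeff (R := V.O P.pt) (σ := Fin m))

instance : 𝔣.pointIdeal.IsPrime := Ideal.comap_isPrime _ _

/-- The local ring of `X̄ × P(M)` at `P`. -/
abbrev LocalRing : Type u := Localization.AtPrime 𝔣.pointIdeal

/-- The function `a₀ + a₁ y₁ + ⋯ + a_m y_m`. -/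
def affineForm (a : Fin (m + 1) → V.O P.pt) : 𝔣.LocalRing :=
  algebraMap 𝔣.Chart 𝔣.LocalRing
    (MvPolynomial.C (a 0) + ∑ i : Fin m, MvPolynomial.C (a i.succ) * MvPolynomial.X i)

/-- The local equation `Φ = φ₀ + φ₁ y₁ + ⋯ + φ_m y_m` of the universal divisor `D`, i.e. the
universal section `∑ bᵢ ⊗ Yᵢ` of `L ⊠ 𝒪(1)` divided by `e ⊗ Y₀`. -/
def Phi : 𝔣.LocalRing := 𝔣.affineForm 𝔣.φ

/-- The local ring of `D` at `P` (the zero ring if `P ∉ D`). -/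
abbrev LocalRingD : Type u := 𝔣.LocalRing ⧸ Ideal.span {𝔣.Phi}

/-- The affine coordinate `y_j` of `P(M)`, pulled back to `D`. -/
def y (j : Fin m) : 𝔣.LocalRingD :=
  Ideal.Quotient.mk _ (algebraMap 𝔣.Chart 𝔣.LocalRing (MvPolynomial.X j))

/-- The ideal in `𝒪_{D,P}` of the critical subscheme `C` of the projection `D → P(M)`: it is
generated by the maximal minors (of size `m = dim P(M) ≤ dim D`) of the homomorphism from the
tangent bundle of `D` to the pull-back of the tangent bundle of `P(M)`. -/
def criticalIdeal : Ideal 𝔣.LocalRingD :=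
  Ideal.span {δ | ∃ θ : Fin m → Derivation k 𝔣.LocalRingD 𝔣.LocalRingD,
    δ = (Matrix.of fun i j => θ i (𝔣.y j)).det}

/-- The ideal of `C` in the local ring of `X̄ × P(M)` at `P`. -/
def idealC : Ideal 𝔣.LocalRing := 𝔣.criticalIdeal.comap (Ideal.Quotient.mk _)

/-- The matrix, in the tangent vector fields `θ₁, …, θₙ` of `X` at `p`, of the universal Hessian,
before it is restricted to `C`: its entries are `θᵢ(θⱼ Φ)`, where vector fields of `X` act on
functions of `X × P(M)` through the first factor. -/
def hessianMatrix {n : ℕ} (θ : Fin n → Derivation k (V.O P.pt) (V.O P.pt)) :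
    Matrix (Fin n) (Fin n) 𝔣.LocalRing :=
  Matrix.of fun i j => 𝔣.affineForm fun l => θ i (θ j (𝔣.φ l))

/-- The ideal of the degeneracy subscheme `R` of the universal Hessian, an alternating form on
the restriction to `C` of the tangent bundle of `X`.  Replacing the vector fields `θ` by linear
combinations multiplies the Pfaffian (modulo the ideal of `C`) by the determinant, so a basis of
vector fields generates the same ideal as all `n`-tuples. -/
def idealR (n : ℕ) : Ideal 𝔣.LocalRing :=
  𝔣.idealC ⊔ Ideal.span {δ | ∃ θ : Fin n → Derivation k (V.O P.pt) (V.O P.pt),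
    δ = pfaffian n (𝔣.hessianMatrix θ)}

end Frame

variable (V M)

/-- The scheme `R`, as the set of its closed points. -/
def R (n m : ℕ) : Set (V.ProdPoint M) :=
  {P | P.pt ∈ V.immersedPart M n ∧ ∃ 𝔣 : Frame V M m P, 𝔣.idealR n ≠ ⊤}

/-- The points at which `R` is smooth of dimension `m - 2`, that is, the local ring of `R` is
regular of dimension `m - 2`. -/
def RSmooth (n m : ℕ) : Set (V.ProdPoint M) :=
  {P | P ∈ V.R M n m ∧ ∃ 𝔣 : Frame V M m P,
    IsRegularLocalRing (𝔣.LocalRing ⧸ 𝔣.idealR n) ∧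
    ringKrullDim (𝔣.LocalRing ⧸ 𝔣.idealR n) = ((m - 2 : ℕ) : WithBot ℕ∞)}

/-- A property holds at a general point of `R` if it holds on a dense open subset of `R`. -/
def HoldsAtGeneralPoint (n m : ℕ) (Q : V.ProdPoint M → Prop) : Prop :=
  ∃ U : Set (V.ProdPoint M), IsOpen U ∧ V.R M n m ⊆ closure (U ∩ V.R M n m) ∧
    ∀ P ∈ U ∩ V.R M n m, Q P

variable {V M}

/-! ### Types of singularities of divisors on `X̄` -/

/-- A formal parameter system at `p`, given as the isomorphism of `k[[x₁, …, xₙ]]` with the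
completed local ring which it defines. -/
abbrev FormalParameters (V : PolarizedVariety k) (n : ℕ) (p : V.X) : Type u :=
  MvPowerSeries (Fin n) k ≃ₐ[k] AdicCompletion (maximalIdeal (V.O p)) (V.O p)

variable (V) in
/-- The divisor of `s` is singular at `p`, and in a suitable formal parameter system one of its
defining power series `F` at `p` has the property `T`. -/
def SingularOfForm {n : ℕ} (T : MvPowerSeries (Fin n) k → Prop) (s : V.Sections) (p : V.X) : Prop :=
  ∃ φ : V.O p, V.IsLocalEquation s p φ ∧ φ ∈ maximalIdeal (V.O p) ^ 2 ∧
    ∃ x : FormalParameters V n p,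
      T (x.symm (algebraMap (V.O p) (AdicCompletion (maximalIdeal (V.O p)) (V.O p)) φ))

/-- The singularity of `D_{[f]}` at `p` is of type A. -/
def IsTypeA (n : ℕ) (P : V.ProdPoint M) : Prop :=
  V.SingularOfForm (n := n) HasFormA P.f P.pt

/-- The singularity of `D_{[f]}` at `p` is of type (C). -/
def IsTypeC (n : ℕ) (P : V.ProdPoint M) : Prop :=
  V.SingularOfForm (n := n) HasFormC P.f P.pt

/-- The singularity of `D_{[f]}` at `p` is of type (R). -/
def IsTypeR (n : ℕ) (P : V.ProdPoint M) : Prop :=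
  V.SingularOfForm (n := n) HasFormR P.f P.pt

end PolarizedVariety

end DiscriminantVariety

end

noncomputable section

namespace DiscriminantVariety

/-! ## The Pfaffian in characteristic two -/

section Pfaffian

variable {R : Type*} [CommRing R] {n : ℕ}

/-! Whether a pair (p, [f]) with p in X° lies in R depends only on the 2-jet of f at p: f must
vanish to order two and its Hessian must be degenerate (`mem_R_iff`). If M maps onto all 2-jets, the
fibre of R over p is cut out by the preimage in M of the cone of quadratic forms with degenerate
polar form. This cone is the image of an affine space: a degenerate alternating matrix is G K Gᵀ
with K alternating and G having a zero column (`exists_degenerate_factor`), and the coefficients of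
the squares are free, because in characteristic two the Hessian does not see them. Two points of a
fibre are therefore joined by a polynomial curve inside the fibre, so nonempty open subsets of a
fibre meet (`exists_mem_inter_of_fibre`). Moreover every point of R extends to a local section of R
over X (`exists_open_spread`). Given two nonempty open subsets of R, both are thus nonempty over a
common open subset of X, and irreducibility of X reduces the question to one fibre
(`isIrreducible_R`).

Because R is irreducible, the statements about general points need only one nonempty open subset of
R with the required properties (`exists_open_good`). It is defined by the nonvanishing of three
polynomial functions of the point and the section: the determinant of the upper left block of the
Hessian of size n - 2, the value of the quadratic part on a kernel vector of the Hessian (type A,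
`exists_hasFormA`), and a determinant certifying that the Jacobian algebra has dimension at most
four (type (C), `exists_open_rank_le_four`). A section with 3-jet x₁x₂ + ⋯ + ξ₁² + ξ₁³ + ξ₂³ makes
all three nonzero; as 2 = 0 and 3 = 1, its partial derivatives are, up to order three, the xᵢ and
ξ₁², ξ₂², which leaves 1, ξ₁, ξ₂, ξ₁ξ₂ (`span_sup_partialIdeal`). Type (R) follows from type (C),
since adjoining the Pfaffian only shrinks the quotient.

For smoothness, the ideal of R at P is generated by the n + 2 functions Φ, ∂ᵢΦ and the Pfaffian of
the universal Hessian (`idealC_eq`, `idealR_eq`) in a local ring of dimension at least n + m, so R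
has dimension at least m - 2. If M maps onto 2-jets and the upper left block of the Hessian is
invertible, f can be completed to a basis of M containing sections with 2-jets 1, xᵢ and ξ₁ξ₂.
Modulo the other coordinates the equations then force the n + 2 coordinates of these sections to
vanish; for the last one this is the Schur complement computation of Pf(H + yE). So m - 2 elements
generate the maximal ideal of the local ring of R, which is regular (`mem_RSmooth`).

All local computations use étale coordinates. Formal étaleness provides the Taylor expansion f(x) ↦
f(x + t) as a ring homomorphism (`exists_taylorCoords`); its specializations at closed points
recover the partial derivatives, the powers of the maximal ideal and the completed local ring.
Pfaffian identities over domains are checked after squaring, where they are identities of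
determinants. -/

/-- Even and odd positions in `Fin n`, `n` even. -/
def evenOddEquiv (hn : Even n) : Fin (n / 2) ⊕ Fin (n / 2) ≃ Fin n :=
  Equiv.ofBijective
    (Sum.elim (fun ν => ⟨2 * ν, by omega⟩) (fun ν => ⟨2 * ν + 1, by omega⟩)) <| by
    constructor
    · rintro (a | a) (b | b) h <;> simp only [Sum.elim_inl, Sum.elim_inr, Fin.mk.injEq] at h
      · exact congrArg _ (Fin.ext (by omega))
      · omega
      · omega
      · exact congrArg _ (Fin.ext (by omega))
    · intro i
      have hi := i.2
      obtain ⟨r, hr⟩ := hn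
      rcases Nat.even_or_odd' (i : ℕ) with ⟨c, h | h⟩
      · exact ⟨Sum.inl ⟨c, by omega⟩, Fin.ext (by simp [h])⟩
      · exact ⟨Sum.inr ⟨c, by omega⟩, Fin.ext (by simp [h])⟩

@[simp] lemma evenOddEquiv_inl (hn : Even n) (ν : Fin (n / 2)) :
    evenOddEquiv hn (Sum.inl ν) = ⟨2 * ν, by omega⟩ := rfl

@[simp] lemma evenOddEquiv_inr (hn : Even n) (ν : Fin (n / 2)) :
    evenOddEquiv hn (Sum.inr ν) = ⟨2 * ν + 1, by omega⟩ := rfl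

@[simp] lemma evenOddEquiv_symm_even (hn : Even n) (ν : Fin (n / 2)) :
    (evenOddEquiv hn).symm ⟨2 * ν, by omega⟩ = Sum.inl ν := by
  rw [Equiv.symm_apply_eq, evenOddEquiv_inl]

@[simp] lemma evenOddEquiv_symm_odd (hn : Even n) (ν : Fin (n / 2)) :
    (evenOddEquiv hn).symm ⟨2 * ν + 1, by omega⟩ = Sum.inr ν := by
  rw [Equiv.symm_apply_eq, evenOddEquiv_inr]

lemma prod_even_odd {M : Type*} [CommMonoid M] (hn : Even n) (f : Fin n → M) :
    ∏ i, f i = ∏ ν : Fin (n / 2), (f ⟨2 * ν, by omega⟩ * f ⟨2 * ν + 1, by omega⟩) := by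
  rw [← (evenOddEquiv hn).prod_comp, Fintype.prod_sum_type, Finset.prod_mul_distrib]
  rfl

/-- The permutations that list a perfect matching in normal form. -/
def IsMatchingList (w : Equiv.Perm (Fin n)) : Prop :=
  (∀ ν : Fin (n / 2), w ⟨2 * ν, by omega⟩ < w ⟨2 * ν + 1, by omega⟩) ∧
  (∀ ν μ : Fin (n / 2), ν < μ → w ⟨2 * ν, by omega⟩ < w ⟨2 * μ, by omega⟩)

/-- The permutation which exchanges the positions `2ν` and `2ν + 1`. -/
def pairSwap (hn : Even n) : Equiv.Perm (Fin n) :=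
  (evenOddEquiv hn).symm.trans ((Equiv.sumComm _ _).trans (evenOddEquiv hn))

@[simp] lemma pairSwap_even (hn : Even n) (ν : Fin (n / 2)) :
    pairSwap hn ⟨2 * ν, by omega⟩ = ⟨2 * ν + 1, by omega⟩ := by
  simp [pairSwap]

@[simp] lemma pairSwap_odd (hn : Even n) (ν : Fin (n / 2)) :
    pairSwap hn ⟨2 * ν + 1, by omega⟩ = ⟨2 * ν, by omega⟩ := by
  simp [pairSwap]

/-- Every position is even or odd. -/
lemma exists_even_or_odd (hn : Even n) (i : Fin n) :
    ∃ ν : Fin (n / 2), i = ⟨2 * ν, by omega⟩ ∨ i = ⟨2 * ν + 1, by omega⟩ := by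
  obtain ⟨(ν | ν), rfl⟩ := (evenOddEquiv hn).surjective i
  · exact ⟨ν, Or.inl rfl⟩
  · exact ⟨ν, Or.inr rfl⟩

/-- The fixed-point-free involution of a perfect matching. -/
def matchingInvolution (hn : Even n) (w : Equiv.Perm (Fin n)) : Equiv.Perm (Fin n) :=
  (w.symm.trans (pairSwap hn)).trans w

lemma matchingInvolution_even (hn : Even n) (w : Equiv.Perm (Fin n)) (ν : Fin (n / 2)) :
    matchingInvolution hn w (w ⟨2 * ν, by omega⟩) = w ⟨2 * ν + 1, by omega⟩ := by
  simp [matchingInvolution]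

lemma matchingInvolution_odd (hn : Even n) (w : Equiv.Perm (Fin n)) (ν : Fin (n / 2)) :
    matchingInvolution hn w (w ⟨2 * ν + 1, by omega⟩) = w ⟨2 * ν, by omega⟩ := by
  simp [matchingInvolution]

/-- Fixed-point-free involutions. -/
def IsFreeInvolution (σ : Equiv.Perm (Fin n)) : Prop := (∀ i, σ i ≠ i) ∧ ∀ i, σ (σ i) = i

lemma isFreeInvolution_matching (hn : Even n) (w : Equiv.Perm (Fin n)) :
    IsFreeInvolution (matchingInvolution hn w) := by
  constructor <;> intro i <;> obtain ⟨j, rfl⟩ := w.surjective i <;>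
    obtain ⟨ν, rfl | rfl⟩ := exists_even_or_odd hn j
  · simp [matchingInvolution_even]
  · simp [matchingInvolution_odd]
  · simp [matchingInvolution_even, matchingInvolution_odd]
  · simp [matchingInvolution_even, matchingInvolution_odd]

/-- The smaller members of the pairs can be read off from the involution alone. Since a normal form
lists them in increasing order, the involution determines the list. -/
lemma IsMatchingList.range_even (hn : Even n) {w : Equiv.Perm (Fin n)} (hw : IsMatchingList w) :
    Set.range (fun ν : Fin (n / 2) => w ⟨2 * ν, by omega⟩) =
      {i | i < matchingInvolution hn w i} := by
  ext i
  constructor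
  · rintro ⟨ν, rfl⟩
    simpa [matchingInvolution_even] using hw.1 ν
  · intro hi
    obtain ⟨j, rfl⟩ := w.surjective i
    obtain ⟨ν, rfl | rfl⟩ := exists_even_or_odd hn j
    · exact ⟨ν, rfl⟩
    · simp only [Set.mem_ofPred_eq, matchingInvolution_odd] at hi
      exact absurd (hw.1 ν) hi.asymm

lemma matchingInvolution_injOn (hn : Even n) :
    Set.InjOn (matchingInvolution hn) {w | IsMatchingList w} := by
  intro w hw w' hw' h
  have hw : IsMatchingList w := hw
  have hw' : IsMatchingList w' := hw'
  have h1 : (fun ν : Fin (n / 2) => w ⟨2 * ν, by omega⟩) =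
      fun ν : Fin (n / 2) => w' ⟨2 * ν, by omega⟩ := by
    have hm : StrictMono (fun ν : Fin (n / 2) => w ⟨2 * ν, by omega⟩) := fun a b hab => hw.2 a b hab
    have hm' : StrictMono (fun ν : Fin (n / 2) => w' ⟨2 * ν, by omega⟩) :=
      fun a b hab => hw'.2 a b hab
    refine (StrictMono.range_inj hm hm').1 ?_
    rw [hw.range_even hn, hw'.range_even hn, h]
  ext1 i
  obtain ⟨ν, rfl | rfl⟩ := exists_even_or_odd hn i
  · exact congrFun h1 ν
  · rw [← matchingInvolution_even hn, ← matchingInvolution_even hn, h, congrFun h1 ν]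

/-- List in increasing order the i with i < σ i, each followed by σ i. There are n / 2 of them
because σ exchanges this set with its complement. -/
lemma exists_matchingList (hn : Even n) {σ : Equiv.Perm (Fin n)} (hσ : IsFreeInvolution σ) :
    ∃ w, IsMatchingList w ∧ matchingInvolution hn w = σ := by
  classical
  let S : Finset (Fin n) := Finset.univ.filter fun i => i < σ i
  have hc : S.card = n / 2 := by
    have h1 : Sᶜ = S.map σ.toEmbedding := by
      ext i
      simp only [Finset.mem_compl, Finset.mem_map_equiv, S, Finset.mem_filter, Finset.mem_univ,
        true_and]
      have : σ.symm i = σ i := by rw [Equiv.symm_apply_eq, hσ.2]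
      rw [this, hσ.2, not_lt]
      exact ⟨fun h => lt_of_le_of_ne h (hσ.1 i), le_of_lt⟩
    have h2 := Finset.card_add_card_compl S
    rw [h1, Finset.card_map, Fintype.card_fin] at h2
    omega
  let a : Fin (n / 2) ↪o Fin n := S.orderEmbOfFin hc
  have ha : ∀ ν, a ν < σ (a ν) := fun ν => by
    exact (Finset.mem_filter.1 (S.orderEmbOfFin_mem hc ν)).2
  let g : Fin (n / 2) ⊕ Fin (n / 2) → Fin n := Sum.elim a (fun ν => σ (a ν))
  have hg : Function.Injective g := by
    rintro (x | x) (y | y) hxy <;> simp only [g, Sum.elim_inl, Sum.elim_inr] at hxy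
    · rw [a.injective hxy]
    · have h1 := ha x
      rw [hxy, hσ.2] at h1
      exact absurd (ha y) h1.asymm
    · have h1 := ha y
      rw [← hxy, hσ.2] at h1
      exact absurd (ha x) h1.asymm
    · rw [a.injective (σ.injective hxy)]
  have hgb : Function.Bijective g := by
    rw [Fintype.bijective_iff_injective_and_card]
    exact ⟨hg, Fintype.card_congr (evenOddEquiv hn)⟩
  let w : Equiv.Perm (Fin n) := (evenOddEquiv hn).symm.trans (Equiv.ofBijective g hgb)
  have hw0 : ∀ ν : Fin (n / 2), w ⟨2 * ν, by omega⟩ = a ν := fun ν => by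
    simp [w, g]
  have hw1 : ∀ ν : Fin (n / 2), w ⟨2 * ν + 1, by omega⟩ = σ (a ν) := fun ν => by
    simp [w, g]
  refine ⟨w, ⟨fun ν => by rw [hw0, hw1]; exact ha ν,
    fun ν μ h => by rw [hw0, hw0]; exact a.strictMono h⟩, ?_⟩
  ext1 i
  obtain ⟨j, rfl⟩ := w.surjective i
  obtain ⟨ν, rfl | rfl⟩ := exists_even_or_odd hn j
  · rw [matchingInvolution_even, hw0, hw1]
  · rw [matchingInvolution_odd, hw0, hw1, hσ.2]

/-- The matrix of an alternating form over a ring of characteristic two. -/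
def IsAlt {ι : Type*} (A : Matrix ι ι R) : Prop := (∀ i j, A i j = A j i) ∧ ∀ i, A i i = 0

/-- The determinant of an alternating matrix in characteristic two as a sum over matchings. -/
lemma det_eq_sum_freeInvolution [CharP R 2] {A : Matrix (Fin n) (Fin n) R} (hA : IsAlt A) :
    A.det = open Classical in
      ∑ σ ∈ (Finset.univ : Finset (Equiv.Perm (Fin n))).filter IsFreeInvolution,
        ∏ i, A (σ i) i := by
  classical
  have hsign : ∀ σ : Equiv.Perm (Fin n), ((Equiv.Perm.sign σ : ℤ) : R) = 1 := fun σ => by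
    rcases Int.units_eq_one_or (Equiv.Perm.sign σ) with h | h <;>
      simp [h, CharTwo.neg_eq]
  rw [Matrix.det_apply', ← Finset.sum_filter_add_sum_filter_not _ IsFreeInvolution]
  simp only [hsign, one_mul]
  convert! add_zero _
  -- By symmetry of the matrix, σ and σ⁻¹ contribute equal terms, which cancel in characteristic
  -- two. A nonzero term with σ = σ⁻¹ has no fixed point because the diagonal is zero, so it belongs
  -- to a free involution.
  refine Finset.sum_involution (fun σ _ => σ⁻¹) ?_ ?_ ?_ ?_
  · intro σ _
    have : ∏ i, A (σ⁻¹ i) i = ∏ i, A (σ i) i := by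
      rw [← Equiv.prod_comp σ]
      exact Finset.prod_congr rfl fun i _ => by simp [hA.1]
    rw [this, CharTwo.add_self_eq_zero]
  · intro σ hσ h0 h1
    simp only [Finset.mem_filter, Finset.mem_univ, true_and] at hσ
    refine hσ ⟨fun i hi => h0 (Finset.prod_eq_zero (Finset.mem_univ i) (by rw [hi, hA.2])),
      fun i => ?_⟩
    nth_rw 1 [← h1]
    exact σ.symm_apply_apply i
  · intro σ hσ
    simp only [Finset.mem_filter, Finset.mem_univ, true_and] at hσ ⊢
    refine fun h => hσ ⟨fun i hi => h.1 i ?_, fun i => ?_⟩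
    · rw [Equiv.Perm.inv_eq_iff_eq, hi]
    · have := h.2 (σ (σ i))
      simpa using this.symm
  · simp

/-- In characteristic two, the determinant is the square of the Pfaffian. -/
theorem pfaffian_sq [CharP R 2] (hn : Even n) {A : Matrix (Fin n) (Fin n) R} (hA : IsAlt A) :
    pfaffian n A ^ 2 = A.det := by
  classical
  have hsign : ∀ σ : Equiv.Perm (Fin n), ((Equiv.Perm.sign σ : ℤ) : R) = 1 := fun σ => by
    rcases Int.units_eq_one_or (Equiv.Perm.sign σ) with h | h <;>
      simp [h, CharTwo.neg_eq]
  rw [det_eq_sum_freeInvolution hA, pfaffian]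
  simp only [hsign, one_mul]
  -- Frobenius is additive, so the square of the Pfaffian is the sum of the squared matching
  -- products. Each of these is the determinant term of the involution of the matching.
  rw [sum_pow_char]
  refine Finset.sum_bij (fun w _ => matchingInvolution hn w) ?_ ?_ ?_ ?_
  · intro w _
    simpa using isFreeInvolution_matching hn w
  · intro w hw w' hw' h
    simp only [Finset.mem_filter, Finset.mem_univ, true_and] at hw hw'
    exact matchingInvolution_injOn hn hw hw' h
  · intro σ hσ
    simp only [Finset.mem_filter, Finset.mem_univ, true_and] at hσ
    obtain ⟨w, hw, rfl⟩ := exists_matchingList hn hσ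
    exact ⟨w, Finset.mem_filter.2 ⟨Finset.mem_univ _, hw⟩, rfl⟩
  · intro w _
    rw [← Equiv.prod_comp w, prod_even_odd hn, ← Finset.prod_pow]
    refine Finset.prod_congr rfl fun ν _ => ?_
    rw [matchingInvolution_even, matchingInvolution_odd, sq, hA.1 (w ⟨2 * ν + 1, _⟩)]

end Pfaffian

end DiscriminantVariety

end

noncomputable section

namespace DiscriminantVariety

/-! ## Alternating matrices in characteristic two -/

section Alternating

variable {R : Type*} [CommRing R]

lemma IsAlt.map {ι S : Type*} [CommRing S] {A : Matrix ι ι R} (hA : IsAlt A) (f : R →+* S) :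
    IsAlt (A.map f) :=
  ⟨fun i j => by simp [hA.1 i j], fun i => by simp [hA.2 i]⟩

lemma IsAlt.transpose_eq {ι : Type*} {A : Matrix ι ι R} (hA : IsAlt A) : A.transpose = A :=
  Matrix.ext fun i j => hA.1 j i

lemma IsAlt.submatrix {ι κ : Type*} {A : Matrix ι ι R} (hA : IsAlt A) (e : κ → ι) :
    IsAlt (A.submatrix e e) := ⟨fun _ _ => hA.1 _ _, fun _ => hA.2 _⟩

lemma IsAlt.sub {ι : Type*} {A A' : Matrix ι ι R} (hA : IsAlt A) (hA' : IsAlt A') :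
    IsAlt (A - A') :=
  ⟨fun i j => by simp [hA.1 i j, hA'.1 i j], fun i => by simp [hA.2 i, hA'.2 i]⟩

/-- Alternating matrices have vanishing quadratic form. -/
lemma IsAlt.sum_mul_mul_self [CharP R 2] {ι : Type*} [Fintype ι] {A : Matrix ι ι R}
    (hA : IsAlt A) (v : ι → R) : ∑ i, ∑ j, v i * A i j * v j = 0 := by
  classical
  rw [← Finset.sum_product' (f := fun i j => v i * A i j * v j)]
  refine Finset.sum_involution (fun p _ => (p.2, p.1)) ?_ ?_ ?_ ?_
  · intro p _
    have : v p.2 * A p.2 p.1 * v p.1 = v p.1 * A p.1 p.2 * v p.2 := by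
      rw [hA.1 p.2 p.1]; ring
    rw [this, CharTwo.add_self_eq_zero]
  · rintro ⟨i, j⟩ _ h0 h1
    simp only [Prod.mk.injEq] at h1
    obtain ⟨rfl, -⟩ := h1
    exact h0 (by simp [hA.2])
  · simp
  · simp

/-- The diagonal entries are the values of the quadratic form of `A` at the rows of `G`, hence zero.
-/
lemma IsAlt.conj [CharP R 2] {ι κ : Type*} [Fintype ι] {A : Matrix ι ι R} (hA : IsAlt A)
    (G : Matrix κ ι R) : IsAlt (G * A * G.transpose) := by
  constructor
  · intro i j
    have : (G * A * G.transpose).transpose = G * A * G.transpose := by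
      simp [Matrix.transpose_mul, hA.transpose_eq, Matrix.mul_assoc]
    exact (congrFun (congrFun this j) i)
  · intro i
    rw [← hA.sum_mul_mul_self (G i), Finset.sum_comm]
    simp [Matrix.mul_apply, Finset.sum_mul]

lemma IsAlt.inv [CharP R 2] {ι : Type*} [Fintype ι] [DecidableEq ι] {A : Matrix ι ι R}
    (hA : IsAlt A) (hd : IsUnit A.det) : IsAlt A⁻¹ := by
  have h : A⁻¹ * A * (A⁻¹).transpose = A⁻¹ := by
    rw [Matrix.nonsing_inv_mul _ hd, one_mul, Matrix.transpose_nonsing_inv, hA.transpose_eq]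
  rw [← h]
  exact hA.conj _

variable {n : ℕ}

lemma pfaffian_map {S : Type*} [CommRing S] (f : R →+* S) (A : Matrix (Fin n) (Fin n) R) :
    pfaffian n (A.map f) = f (pfaffian n A) := by
  simp [pfaffian, map_sum, map_prod]

lemma pfaffian_eq_zero_iff [CharP R 2] [IsDomain R] (hn : Even n)
    {A : Matrix (Fin n) (Fin n) R} (hA : IsAlt A) : pfaffian n A = 0 ↔ A.det = 0 := by
  rw [← pfaffian_sq hn hA]; simp

/-- Square roots are unique in a domain of characteristic two. Identities between Pfaffians can
therefore be verified on determinants. -/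
lemma eq_of_sq_eq_sq [CharP R 2] [IsDomain R] {a b : R} (h : a ^ 2 = b ^ 2) : a = b := by
  have := CharTwo.add_sq a b
  rw [h, CharTwo.add_self_eq_zero] at this
  have := pow_eq_zero_iff (two_ne_zero) |>.1 this
  rwa [CharTwo.add_eq_zero] at this

lemma pfaffian_conj [CharP R 2] [IsDomain R] (hn : Even n)
    {A : Matrix (Fin n) (Fin n) R} (hA : IsAlt A) (G : Matrix (Fin n) (Fin n) R) :
    pfaffian n (G * A * G.transpose) = G.det * pfaffian n A := by
  apply eq_of_sq_eq_sq
  rw [mul_pow, pfaffian_sq hn (hA.conj G), pfaffian_sq hn hA]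
  simp only [Matrix.det_mul, Matrix.det_transpose]; ring

/-! ### The Schur complement of the upper left block -/

section Schur

variable {r : ℕ}

/-- The upper left `r × r` block. -/
def blockB (A : Matrix (Fin (r + 2)) (Fin (r + 2)) R) : Matrix (Fin r) (Fin r) R :=
  A.submatrix (Fin.castAdd 2) (Fin.castAdd 2)

/-- The upper right `r × 2` block. -/
def blockC (A : Matrix (Fin (r + 2)) (Fin (r + 2)) R) : Matrix (Fin r) (Fin 2) R :=
  A.submatrix (Fin.castAdd 2) (Fin.natAdd r)

/-- The lower right `2 × 2` block. -/
def blockD (A : Matrix (Fin (r + 2)) (Fin (r + 2)) R) : Matrix (Fin 2) (Fin 2) R :=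
  A.submatrix (Fin.natAdd r) (Fin.natAdd r)

/-- The Schur complement. -/
def schur (A : Matrix (Fin (r + 2)) (Fin (r + 2)) R) : Matrix (Fin 2) (Fin 2) R :=
  blockD A - (blockC A).transpose * (blockB A)⁻¹ * blockC A

lemma IsAlt.schur [CharP R 2] {A : Matrix (Fin (r + 2)) (Fin (r + 2)) R} (hA : IsAlt A)
    (hB : IsUnit (blockB A).det) : IsAlt (schur A) := by
  refine (hA.submatrix _).sub ?_
  have := (IsAlt.inv (hA.submatrix _ : IsAlt (blockB A)) hB).conj (blockC A).transpose
  rwa [Matrix.transpose_transpose] at this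

lemma submatrix_finSum (A : Matrix (Fin (r + 2)) (Fin (r + 2)) R) (hA : IsAlt A) :
    A.submatrix finSumFinEquiv finSumFinEquiv =
      Matrix.fromBlocks (blockB A) (blockC A) (blockC A).transpose (blockD A) := by
  ext (i | i) (j | j) <;> simp [blockB, blockC, blockD, hA.1]

lemma IsAlt.det_fin_two [CharP R 2] {A : Matrix (Fin 2) (Fin 2) R} (hA : IsAlt A) :
    A.det = A 0 1 ^ 2 := by
  rw [Matrix.det_fin_two, hA.2, hA.1 1 0, zero_mul, CharTwo.sub_eq_add, zero_add, sq]

lemma det_eq_schur [CharP R 2] {A : Matrix (Fin (r + 2)) (Fin (r + 2)) R} (hA : IsAlt A)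
    (hB : IsUnit (blockB A).det) : A.det = (blockB A).det * schur A 0 1 ^ 2 := by
  rw [← (hA.schur hB).det_fin_two, ← Matrix.det_submatrix_equiv_self finSumFinEquiv A,
    submatrix_finSum A hA]
  let := Matrix.invertibleOfIsUnitDet _ hB
  rw [Matrix.det_fromBlocks₁₁, Matrix.invOf_eq_nonsing_inv]
  rfl

lemma pfaffian_eq_schur [CharP R 2] [IsDomain R] (hr : Even r)
    {A : Matrix (Fin (r + 2)) (Fin (r + 2)) R} (hA : IsAlt A)
    (hB : IsUnit (blockB A).det) :
    pfaffian (r + 2) A = pfaffian r (blockB A) * schur A 0 1 := by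
  apply eq_of_sq_eq_sq
  have hB' : IsAlt (blockB A) := hA.submatrix _
  rw [mul_pow, pfaffian_sq (hr.add even_two) hA, pfaffian_sq hr hB', det_eq_schur hA hB]

end Schur

/-! ### Normal form -/

section NormalForm

variable {k : Type*} [Field k] [CharP k 2]

/-- Symplectic Gram–Schmidt, one hyperbolic pair at a time. As long as the pairs found do not span,
a vector outside their span has nonzero projection to the orthogonal complement, and nondegeneracy
supplies a partner. -/
lemma exists_symplectic_pairs {V : Type*} [AddCommGroup V] [Module k V] [FiniteDimensional k V]
    (β : V →ₗ[k] V →ₗ[k] k) (halt : ∀ x, β x x = 0) (hnd : ∀ x, (∀ y, β x y = 0) → x = 0)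
    (s : ℕ) (hs : 2 * s ≤ Module.finrank k V) :
    ∃ a b : Fin s → V, (∀ i j, β (a i) (a j) = 0) ∧ (∀ i j, β (b i) (b j) = 0) ∧
      ∀ i j, β (a i) (b j) = if i = j then 1 else 0 := by
  have hsymm : ∀ x y, β x y = β y x := fun x y => by
    have := halt (x + y)
    simp only [map_add, LinearMap.add_apply, halt, zero_add, add_zero] at this
    rw [CharTwo.add_eq_zero] at this
    exact this.symm
  induction s with
  | zero => exact ⟨Fin.elim0, Fin.elim0, fun i => i.elim0, fun i => i.elim0, fun i => i.elim0⟩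
  | succ s ih =>
    obtain ⟨a, b, haa, hbb, hab⟩ := ih (by omega)
    -- The projection to the orthogonal complement of the pairs already found; the usual minus signs
    -- disappear in characteristic two.
    let pr : V → V := fun x => x + ∑ i, (β x (b i)) • a i + ∑ i, (β x (a i)) • b i
    have hpa : ∀ x j, β (pr x) (a j) = 0 := fun x j => by
      simp only [pr, map_add, map_sum, map_smul, LinearMap.add_apply, LinearMap.sum_apply,
        LinearMap.smul_apply, haa, hsymm (b _) (a _), hab, smul_eq_mul, mul_zero,
        Finset.sum_const_zero, add_zero, mul_ite, mul_one, Finset.sum_ite_eq, Finset.mem_univ,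
        if_true, CharTwo.add_self_eq_zero]
    have hpb : ∀ x j, β (pr x) (b j) = 0 := fun x j => by
      simp only [pr, map_add, map_sum, map_smul, LinearMap.add_apply, LinearMap.sum_apply,
        LinearMap.smul_apply, hbb, hab, smul_eq_mul, mul_zero,
        Finset.sum_const_zero, add_zero, mul_ite, mul_one, Finset.sum_ite_eq', Finset.mem_univ,
        if_true, CharTwo.add_self_eq_zero]
    let W := Submodule.span k (Set.range (Sum.elim a b))
    have hW : W ≠ ⊤ := by
      intro h
      have h1 := finrank_range_le_card (R := k) (Sum.elim a b)
      rw [Set.finrank, show Submodule.span k (Set.range (Sum.elim a b)) = ⊤ from h,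
        finrank_top] at h1
      simp at h1
      omega
    obtain ⟨x, -, hx⟩ := SetLike.exists_of_lt (lt_top_iff_ne_top.2 hW)
    have ha : ∀ i, a i ∈ W := fun i => Submodule.subset_span ⟨Sum.inl i, rfl⟩
    have hb : ∀ i, b i ∈ W := fun i => Submodule.subset_span ⟨Sum.inr i, rfl⟩
    have hpx : pr x ≠ 0 := by
      intro h
      apply hx
      have h2 : ∑ i, (β x (b i)) • a i + ∑ i, (β x (a i)) • b i ∈ W :=
        W.add_mem (W.sum_mem fun i _ => W.smul_mem _ (ha i))
          (W.sum_mem fun i _ => W.smul_mem _ (hb i))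
      have h3 : x = -(∑ i, (β x (b i)) • a i + ∑ i, (β x (a i)) • b i) := by
        rw [eq_neg_iff_add_eq_zero, ← add_assoc]; exact h
      rw [h3]
      exact W.neg_mem h2
    obtain ⟨y, hy⟩ : ∃ y, β (pr x) y ≠ 0 := by
      by_contra! h
      exact hpx (hnd _ h)
    have hxy : β (pr x) (pr y) = β (pr x) y := by
      generalize hz : pr x = z
      have e1 : ∀ i, β z (a i) = 0 := hz ▸ hpa x
      have e2 : ∀ i, β z (b i) = 0 := hz ▸ hpb x
      simp only [pr, map_add, map_sum, map_smul, e1, e2, smul_zero, Finset.sum_const_zero,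
        add_zero]
    let y' := (β (pr x) y)⁻¹ • pr y
    have hy1 : β (pr x) y' = 1 := by simp [y', hxy, hy]
    have hya : ∀ j, β y' (a j) = 0 := fun j => by simp [y', hpa]
    have hyb : ∀ j, β y' (b j) = 0 := fun j => by simp [y', hpb]
    refine ⟨Fin.cons (pr x) a, Fin.cons y' b, ?_, ?_, ?_⟩
    · intro i j
      refine Fin.cases ?_ (fun i => ?_) i <;> refine Fin.cases ?_ (fun j => ?_) j <;>
        simp [halt, hpa, haa, hsymm (a _) (pr x)]
    · intro i j
      refine Fin.cases ?_ (fun i => ?_) i <;> refine Fin.cases ?_ (fun j => ?_) j <;>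
        simp [halt, hyb, hbb, hsymm (b _) y']
    · intro i j
      refine Fin.cases ?_ (fun i => ?_) i <;> refine Fin.cases ?_ (fun j => ?_) j
      · simp [hy1]
      · simp [hpb, (Fin.succ_ne_zero j).symm]
      · simp [hsymm (a _) y', hya, Fin.succ_ne_zero]
      · simp [hab]

lemma stdAlternating_even_even {n r : ℕ} (ν μ : ℕ) (hν : 2 * ν < n) (hμ : 2 * μ < n) :
    stdAlternating k n r ⟨2 * ν, hν⟩ ⟨2 * μ, hμ⟩ = 0 := by
  simp only [stdAlternating, Matrix.of_apply]
  rw [if_neg (by omega), if_neg (by omega)]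

lemma stdAlternating_even_odd {r : ℕ} (ν μ : Fin (r / 2)) :
    stdAlternating k r (r / 2) ⟨2 * ν, by omega⟩ ⟨2 * μ + 1, by omega⟩ =
      if ν = μ then 1 else 0 := by
  simp only [stdAlternating, Matrix.of_apply, Fin.ext_iff]
  by_cases h : (ν : ℕ) = μ
  · rw [if_pos h, if_pos ⟨by omega, by simp, by omega⟩]
  · rw [if_neg h, if_neg (by omega), if_neg (fun h' => absurd h'.2.1 (by simp))]

lemma stdAlternating_odd_even {r : ℕ} (ν μ : Fin (r / 2)) :
    stdAlternating k r (r / 2) ⟨2 * ν + 1, by omega⟩ ⟨2 * μ, by omega⟩ =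
      if ν = μ then -1 else 0 := by
  simp only [stdAlternating, Matrix.of_apply, Fin.ext_iff]
  by_cases h : (ν : ℕ) = μ
  · rw [if_pos h, if_neg (by omega), if_pos ⟨by omega, by simp, by omega⟩]
  · rw [if_neg h, if_neg (fun h' => absurd h'.2.1 (by simp)), if_neg (by omega)]

lemma stdAlternating_odd_odd {n r : ℕ} (ν μ : ℕ) (hν : 2 * ν + 1 < n) (hμ : 2 * μ + 1 < n) :
    stdAlternating k n r ⟨2 * ν + 1, hν⟩ ⟨2 * μ + 1, hμ⟩ = 0 := by
  have h1 : ¬ Even (2 * ν + 1) := by simp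
  have h2 : ¬ Even (2 * μ + 1) := by simp
  simp only [stdAlternating, Matrix.of_apply]
  rw [if_neg (by tauto), if_neg (by tauto)]

/-- A nondegenerate alternating matrix is congruent to the standard one. -/
lemma exists_conj_eq_std {r : ℕ} (hr : Even r) {B : Matrix (Fin r) (Fin r) k} (hB : IsAlt B)
    (hd : B.det ≠ 0) :
    ∃ G : Matrix (Fin r) (Fin r) k, G * B * G.transpose = stdAlternating k r (r / 2) := by
  let β : (Fin r → k) →ₗ[k] (Fin r → k) →ₗ[k] k := Matrix.toLinearMap₂' k B
  have hβ : ∀ x y, β x y = ∑ i, ∑ j, x i * B i j * y j := fun x y => by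
    rw [Matrix.toLinearMap₂'_apply]
    simp [mul_comm, mul_left_comm]
  have hnd : ∀ x, (∀ y, β x y = 0) → x = 0 := by
    intro x hx
    have h1 : Matrix.vecMul x B = 0 := by
      ext j
      have := hx (Pi.single j 1)
      rw [hβ] at this
      simpa [Matrix.vecMul, dotProduct, Pi.single_apply] using this
    by_contra h0
    exact hd (Matrix.exists_vecMul_eq_zero_iff.1 ⟨x, h0, h1⟩)
  obtain ⟨a, b, haa, hbb, hab⟩ := exists_symplectic_pairs β
    (fun x => by rw [hβ]; exact hB.sum_mul_mul_self x) hnd (r / 2) (by simp; omega)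
  have hba : ∀ i j, β (b i) (a j) = if i = j then 1 else 0 := fun i j => by
    have : β (b i) (a j) = β (a j) (b i) := by
      rw [hβ, hβ, Finset.sum_comm]
      exact Finset.sum_congr rfl fun x _ => Finset.sum_congr rfl fun y _ => by rw [hB.1 y x]; ring
    rw [this, hab]; simp [eq_comm]
  let e := evenOddEquiv hr
  let g : Fin r → Fin r → k := fun i => Sum.elim a b (e.symm i)
  refine ⟨Matrix.of g, ?_⟩
  have hG : ∀ i j, (Matrix.of g * B * (Matrix.of g).transpose) i j = β (g i) (g j) := fun i j => by
    rw [hβ, Finset.sum_comm]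
    simp [Matrix.mul_apply, Finset.sum_mul]
  ext i j
  rw [hG]
  obtain ⟨ν, rfl | rfl⟩ := exists_even_or_odd hr i <;>
    obtain ⟨μ, rfl | rfl⟩ := exists_even_or_odd hr j
  · simp [g, e, haa, stdAlternating_even_even]
  · simp [g, e, hab, stdAlternating_even_odd]
  · simp [g, e, hba, stdAlternating_odd_even, CharTwo.neg_eq]
  · simp [g, e, hbb, stdAlternating_odd_odd]

lemma det_stdAlternating_ne_zero {r : ℕ} (hr : Even r) :
    (stdAlternating k r (r / 2)).det ≠ 0 := by
  have h : stdAlternating k r (r / 2) * stdAlternating k r (r / 2) = 1 := by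
    ext i j
    rw [Matrix.mul_apply, ← (evenOddEquiv hr).sum_comp, Fintype.sum_sum_type,
      ← Finset.sum_add_distrib]
    obtain ⟨ν, rfl | rfl⟩ := exists_even_or_odd hr i <;>
      obtain ⟨μ, rfl | rfl⟩ := exists_even_or_odd hr j <;>
      simp [stdAlternating_even_even, stdAlternating_even_odd, stdAlternating_odd_even,
        stdAlternating_odd_odd, CharTwo.neg_eq, Matrix.one_apply] <;>
      first | omega | simp [Fin.ext_iff]
  intro h0
  have := congrArg Matrix.det h
  simp [h0] at this

/-- An alternating 2 × 2 matrix has a single independent entry, and det H is det B times the square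
of that entry of the Schur complement. -/
lemma schur_eq_zero {r : ℕ} {H : Matrix (Fin (r + 2)) (Fin (r + 2)) k} (hH : IsAlt H)
    (hB : (blockB H).det ≠ 0) (hd : H.det = 0) : schur H = 0 := by
  have hB' : IsUnit (blockB H).det := isUnit_iff_ne_zero.2 hB
  have h1 := hH.schur hB'
  have h2 : schur H 0 1 = 0 := by
    have := det_eq_schur hH hB'
    rw [hd] at this
    simpa [hB] using this.symm
  ext i j
  fin_cases i <;> fin_cases j
  · exact h1.2 0
  · exact h2
  · exact (h1.1 1 0).trans h2
  · exact h1.2 1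

lemma submatrix_stdAlternating {r : ℕ} (hr : Even r) :
    (stdAlternating k (r + 2) (r / 2)).submatrix finSumFinEquiv finSumFinEquiv =
      Matrix.fromBlocks (stdAlternating k r (r / 2)) 0 0 (0 : Matrix (Fin 2) (Fin 2) k) := by
  obtain ⟨s, rfl⟩ := hr
  ext (i | i) (j | j)
  · simp [stdAlternating]
  all_goals
    simp only [stdAlternating, Matrix.submatrix_apply, finSumFinEquiv_apply_left,
      finSumFinEquiv_apply_right, Matrix.of_apply, Fin.val_castAdd, Fin.val_natAdd,
      Matrix.fromBlocks_apply₁₂, Matrix.fromBlocks_apply₂₁, Matrix.fromBlocks_apply₂₂,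
      Matrix.zero_apply]
    rw [if_neg (by rintro ⟨_, ⟨c, hc⟩, h⟩; omega), if_neg (by rintro ⟨_, ⟨c, hc⟩, h⟩; omega)]

/-- A degenerate alternating matrix whose upper left block is invertible can be brought to normal
form by a matrix whose last two columns are the standard basis of its kernel. -/
lemma exists_normalizing {r : ℕ} (hr : Even r) {H : Matrix (Fin (r + 2)) (Fin (r + 2)) k}
    (hH : IsAlt H) (hB : (blockB H).det ≠ 0) (hd : H.det = 0) :
    ∃ G : Matrix (Fin (r + 2)) (Fin (r + 2)) k, IsUnit G.det ∧
      G.transpose * H * G = stdAlternating k (r + 2) (r / 2) ∧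
      (∀ i a, G (Fin.castAdd 2 i) (Fin.natAdd r a) = -((blockB H)⁻¹ * blockC H) i a) ∧
      ∀ b a, G (Fin.natAdd r b) (Fin.natAdd r a) = if b = a then 1 else 0 := by
  have hB' : IsUnit (blockB H).det := isUnit_iff_ne_zero.2 hB
  have hBa : IsAlt (blockB H) := hH.submatrix _
  obtain ⟨G₀, hG₀⟩ := exists_conj_eq_std hr hBa hB
  have hG₀d : G₀.det ≠ 0 := by
    intro h0
    have := congrArg Matrix.det hG₀
    rw [Matrix.det_mul, Matrix.det_mul, h0, zero_mul, zero_mul] at this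
    exact det_stdAlternating_ne_zero hr this.symm
  have hs : blockD H - (blockC H).transpose * (blockB H)⁻¹ * blockC H = 0 :=
    schur_eq_zero hH hB hd
  -- The first block puts B into standard form. The columns (-B⁻¹C, 1) span the kernel of H, because
  -- the Schur complement vanishes.
  let G' : Matrix (Fin r ⊕ Fin 2) (Fin r ⊕ Fin 2) k :=
    Matrix.fromBlocks G₀.transpose (-((blockB H)⁻¹ * blockC H)) 0 1
  let G := G'.submatrix finSumFinEquiv.symm finSumFinEquiv.symm
  have hGs : G.submatrix finSumFinEquiv finSumFinEquiv = G' := by simp [G]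
  refine ⟨G, ?_, ?_, ?_, ?_⟩
  · rw [Matrix.det_submatrix_equiv_self, Matrix.det_fromBlocks_zero₂₁]
    simp [hG₀d]
  · have key : (G.transpose * H * G).submatrix finSumFinEquiv finSumFinEquiv =
        (stdAlternating k (r + 2) (r / 2)).submatrix finSumFinEquiv finSumFinEquiv := by
      rw [← Matrix.submatrix_mul_equiv _ _ _ finSumFinEquiv,
        ← Matrix.submatrix_mul_equiv _ _ _ finSumFinEquiv, ← Matrix.transpose_submatrix, hGs,
        submatrix_finSum H hH, submatrix_stdAlternating hr]
      have hBt : (blockB H).transpose = blockB H := hBa.transpose_eq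
      have e1 : (blockB H)⁻¹.transpose = (blockB H)⁻¹ := by
        rw [Matrix.transpose_nonsing_inv, hBt]
      simp only [G', Matrix.fromBlocks_transpose, Matrix.fromBlocks_multiply,
        Matrix.transpose_transpose, Matrix.transpose_zero, Matrix.transpose_one,
        Matrix.transpose_neg, Matrix.transpose_mul, e1, Matrix.zero_mul, Matrix.mul_zero,
        add_zero, Matrix.one_mul, Matrix.mul_one]
      have e2 : -((blockC H).transpose * (blockB H)⁻¹) * blockB H + (blockC H).transpose = 0 := by
        rw [Matrix.neg_mul, Matrix.mul_assoc, Matrix.nonsing_inv_mul _ hB', Matrix.mul_one,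
          neg_add_cancel]
      have e3 : G₀ * blockB H * -((blockB H)⁻¹ * blockC H) + G₀ * blockC H = 0 := by
        rw [Matrix.mul_neg, Matrix.mul_assoc, ← Matrix.mul_assoc (blockB H),
          Matrix.mul_nonsing_inv _ hB', Matrix.one_mul, neg_add_cancel]
      have e4 : -((blockC H).transpose * (blockB H)⁻¹) * blockC H + blockD H = 0 := by
        rw [Matrix.neg_mul, neg_add_eq_sub, hs]
      rw [e2, e3, e4, hG₀]
      simp
    exact Matrix.ext fun i j => by
      simpa using congrFun (congrFun key (finSumFinEquiv.symm i)) (finSumFinEquiv.symm j)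
  · intro i a
    simp [G, G']
  · intro b a
    simp [G, G', Matrix.one_apply]

/-- When the Schur complement vanishes, H is the product of the column (1, CᵀB⁻¹) and the row (B,
C), so it factors through a space of dimension r. The invertible block B gives the opposite bound.
-/
lemma rank_eq_of_block {r : ℕ} {H : Matrix (Fin (r + 2)) (Fin (r + 2)) k}
    (hH : IsAlt H) (hB : (blockB H).det ≠ 0) (hd : H.det = 0) : H.rank = r := by
  have hB' : IsUnit (blockB H).det := isUnit_iff_ne_zero.2 hB
  have hs : blockD H - (blockC H).transpose * (blockB H)⁻¹ * blockC H = 0 :=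
    schur_eq_zero hH hB hd
  rw [← Matrix.rank_submatrix H finSumFinEquiv finSumFinEquiv, submatrix_finSum H hH]
  apply le_antisymm
  · have : Matrix.fromBlocks (blockB H) (blockC H) (blockC H).transpose (blockD H) =
        Matrix.fromRows (1 : Matrix (Fin r) (Fin r) k) ((blockC H).transpose * (blockB H)⁻¹) *
          Matrix.fromCols (blockB H) (blockC H) := by
      rw [Matrix.fromRows_mul_fromCols, Matrix.one_mul, Matrix.one_mul,
        Matrix.mul_assoc _ _ (blockB H), Matrix.nonsing_inv_mul _ hB', Matrix.mul_one,
        ← sub_eq_zero.1 hs]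
    rw [this]
    refine (Matrix.rank_mul_le_left _ _).trans ?_
    simpa using Matrix.rank_le_card_width (Matrix.fromRows (1 : Matrix (Fin r) (Fin r) k)
      ((blockC H).transpose * (blockB H)⁻¹))
  · have h1 : (blockB H).rank = r := by
      rw [Matrix.rank_of_isUnit _ ((Matrix.isUnit_iff_isUnit_det _).2 hB')]; simp
    have h2 : blockB H = Matrix.fromCols (1 : Matrix (Fin r) (Fin r) k) (0 : Matrix (Fin r) (Fin 2) k) *
        (Matrix.fromBlocks (blockB H) (blockC H) (blockC H).transpose (blockD H) *
          Matrix.fromRows (1 : Matrix (Fin r) (Fin r) k) (0 : Matrix (Fin 2) (Fin r) k)) := by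
      rw [← Matrix.fromRows_fromCols_eq_fromBlocks, Matrix.fromRows_mul]
      simp [Matrix.fromCols_mul_fromRows]
    conv_lhs => rw [← h1, h2]
    exact (Matrix.rank_mul_le_right _ _).trans (Matrix.rank_mul_le_left _ _)

end NormalForm

end Alternating

end DiscriminantVariety

end

/-! ### Power series: the order filtration and a bound for dimensions of quotients -/

noncomputable section

namespace DiscriminantVariety

section Filtration

open MvPowerSeries

variable {R : Type*} [CommRing R] {n : ℕ}

/-- The ideal generated by the variables of a power series ring. -/
def varIdeal (R : Type*) [CommRing R] (n : ℕ) : Ideal (MvPowerSeries (Fin n) R) :=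
  Ideal.span (Set.range X)

lemma X_mem_varIdeal (i : Fin n) : (X i : MvPowerSeries (Fin n) R) ∈ varIdeal R n :=
  Ideal.subset_span ⟨i, rfl⟩

lemma exists_eq_sum_X_mul {d : ℕ} {F : MvPowerSeries (Fin n) R}
    (hF : ∀ α, Finsupp.degree α < d + 1 → coeff α F = 0) :
    ∃ G : Fin n → MvPowerSeries (Fin n) R, F = ∑ i, X i * G i ∧
      ∀ i α, Finsupp.degree α < d → coeff α (G i) = 0 := by
  classical
  -- Every monomial other than 1 is assigned to the smallest variable that divides it, so it is
  -- counted exactly once.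
  let G : Fin n → MvPowerSeries (Fin n) R := fun i α =>
    if ∀ j < i, α j = 0 then coeff (α + Finsupp.single i 1) F else 0
  have hG : ∀ i α, coeff α (G i) =
      if ∀ j < i, α j = 0 then coeff (α + Finsupp.single i 1) F else 0 := fun i α => rfl
  refine ⟨G, ?_, fun i α hα => ?_⟩
  · ext β
    rw [map_sum]
    have h1 : ∀ i, coeff β (X i * G i) =
        if β i ≠ 0 ∧ ∀ j < i, β j = 0 then coeff β F else 0 := fun i => by
      rw [X, coeff_monomial_mul, one_mul]
      by_cases hi : β i = 0
      · rw [if_neg, if_neg (by tauto)]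
        intro h
        have := h i
        simp [hi] at this
      · have hle : Finsupp.single i 1 ≤ β := by
          rw [Finsupp.single_le_iff]; omega
        rw [if_pos hle, hG, tsub_add_cancel_of_le hle]
        have : (∀ j < i, (β - Finsupp.single i 1 : Fin n →₀ ℕ) j = 0) ↔ ∀ j < i, β j = 0 := by
          refine forall₂_congr fun j hj => ?_
          simp [Finsupp.single_apply, hj.ne']
        rw [if_congr this rfl rfl]
        simp [hi]
    simp only [h1]
    by_cases hβ : β = 0
    · subst hβ
      rw [hF 0 (by simp)]
      simp
    · have hs : β.support.Nonempty := Finsupp.support_nonempty_iff.2 hβ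
      have hu : ∀ i, (β i ≠ 0 ∧ ∀ j < i, β j = 0) ↔ i = β.support.min' hs := fun i => by
        constructor
        · rintro ⟨h1, h2⟩
          apply le_antisymm
          · by_contra! h
            exact (Finsupp.mem_support_iff.1 (β.support.min'_mem hs)) (h2 _ h)
          · exact β.support.min'_le i (Finsupp.mem_support_iff.2 h1)
        · rintro rfl
          refine ⟨Finsupp.mem_support_iff.1 (β.support.min'_mem hs), fun j hj => ?_⟩
          by_contra h
          exact absurd (β.support.min'_le j (Finsupp.mem_support_iff.2 h)) (not_le.2 hj)
      simp [hu]
  · rw [hG]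
    split_ifs
    · exact hF _ (by simp; omega)
    · rfl

lemma mem_varIdeal_pow {d : ℕ} {F : MvPowerSeries (Fin n) R} :
    F ∈ varIdeal R n ^ d ↔ ∀ α, Finsupp.degree α < d → coeff α F = 0 := by
  constructor
  · intro hF
    suffices h : ∀ G ∈ varIdeal R n ^ d, (d : ℕ∞) ≤ G.order by
      intro α hα
      exact coeff_of_lt_order (lt_of_lt_of_le (by exact_mod_cast hα) (h F hF))
    clear hF F
    induction d with
    | zero => simp
    | succ d ih =>
      intro G hG
      rw [pow_succ] at hG
      refine Submodule.mul_induction_on hG (fun a ha b hb => ?_) (fun a b ha hb => ?_)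
      · have hb1 : (1 : ℕ∞) ≤ b.order := by
          rw [one_le_order_iff_constCoeff_eq_zero]
          have : varIdeal R n ≤ RingHom.ker (constantCoeff (σ := Fin n) (R := R)) := by
            rw [varIdeal, Ideal.span_le]
            rintro _ ⟨i, rfl⟩
            simp [RingHom.mem_ker]
          exact this hb
        refine le_trans ?_ le_order_mul
        push_cast
        exact add_le_add (ih a ha) hb1
      · exact le_trans (le_min ha hb) min_order_le_add
  · induction d generalizing F with
    | zero => simp
    | succ d ih =>
      intro hF
      obtain ⟨G, rfl, hG⟩ := exists_eq_sum_X_mul hF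
      refine Ideal.sum_mem _ fun i _ => ?_
      rw [pow_succ']
      exact Ideal.mul_mem_mul (X_mem_varIdeal i) (ih (hG i))

lemma mem_varIdeal {F : MvPowerSeries (Fin n) R} : F ∈ varIdeal R n ↔ constantCoeff F = 0 := by
  rw [← pow_one (varIdeal R n), mem_varIdeal_pow]
  constructor
  · intro h
    exact h 0 (by simp)
  · intro h α hα
    have : α = 0 := by
      rw [← Finsupp.degree_eq_zero_iff]; omega
    rw [this]; exact h

lemma exists_eq_const_add_sum (F : MvPowerSeries (Fin n) R) :
    ∃ G : Fin n → MvPowerSeries (Fin n) R, F = C (constantCoeff F) + ∑ i, X i * G i := by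
  obtain ⟨G, hG, -⟩ := exists_eq_sum_X_mul (d := 0) (F := F - C (constantCoeff F)) (by
    intro α hα
    have : α = 0 := by
      rw [← Finsupp.degree_eq_zero_iff]; omega
    subst this
    simp)
  exact ⟨G, by rw [← hG]; ring⟩

lemma iInf_varIdeal_pow : ⨅ i, varIdeal R n ^ i = ⊥ := by
  rw [eq_bot_iff]
  intro F hF
  rw [Ideal.mem_iInf] at hF
  rw [Ideal.mem_bot]
  ext α
  exact mem_varIdeal_pow.1 (hF (Finsupp.degree α + 1)) α (by omega)

lemma pderiv_mem_varIdeal_pow {d : ℕ} {F : MvPowerSeries (Fin n) R}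
    (hF : F ∈ varIdeal R n ^ (d + 1)) (i : Fin n) :
    MvPowerSeries.pderiv R i F ∈ varIdeal R n ^ d := by
  rw [mem_varIdeal_pow] at hF ⊢
  intro α hα
  rw [coeff_pderiv, hF _ (by simp; omega), zero_mul]

lemma pderiv_map {S : Type*} [CommRing S] (f : R →+* S) (F : MvPowerSeries (Fin n) R)
    (i : Fin n) : MvPowerSeries.pderiv S i (MvPowerSeries.map f F) =
      MvPowerSeries.map f (MvPowerSeries.pderiv R i F) := by
  ext α
  simp [coeff_pderiv]

section Field

variable {k : Type*} [Field k]

lemma varIdeal_eq_maximalIdeal :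
    varIdeal k n = maximalIdeal (MvPowerSeries (Fin n) k) := by
  ext F
  rw [mem_varIdeal, mem_maximalIdeal, mem_nonunits_iff, isUnit_iff_constantCoeff]
  simp

/-- Nakayama's lemma for the finitely generated ideal `varIdeal k n ^ j`. -/
lemma pow_le_of_pow_le_sup {I : Ideal (MvPowerSeries (Fin n) k)} {j : ℕ}
    (h : varIdeal k n ^ j ≤ I ⊔ varIdeal k n ^ (j + 1)) : varIdeal k n ^ j ≤ I := by
  refine Submodule.le_of_le_smul_of_le_jacobson_bot (I := varIdeal k n)
    (IsNoetherian.noetherian _) ?_ ?_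
  · rw [varIdeal_eq_maximalIdeal]
    exact IsLocalRing.maximalIdeal_le_jacobson _
  · rwa [smul_eq_mul, ← pow_succ']

/-- A quotient of the power series ring is spanned by four elements as soon as it is so modulo
the fifth power of the maximal ideal. -/
lemma rank_quotient_le_four {I : Ideal (MvPowerSeries (Fin n) k)}
    (g : Fin 4 → MvPowerSeries (Fin n) k)
    (h : Submodule.span k (Set.range g) ⊔ (I ⊔ varIdeal k n ^ 5).restrictScalars k = ⊤) :
    Module.rank k (MvPowerSeries (Fin n) k ⧸ I) ≤ 4 := by
  have key : ∀ J : Ideal (MvPowerSeries (Fin n) k),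
      Submodule.span k (Set.range g) ⊔ J.restrictScalars k = ⊤ →
      Submodule.span k (Set.range fun i => Ideal.Quotient.mk J (g i)) = ⊤ := by
    intro J hJ
    let q : MvPowerSeries (Fin n) k →ₗ[k] MvPowerSeries (Fin n) k ⧸ J :=
      (Ideal.Quotient.mkₐ k J).toLinearMap
    have hq : Function.Surjective q := Ideal.Quotient.mk_surjective
    have := congrArg (Submodule.map q) hJ
    rw [Submodule.map_sup, Submodule.map_top, LinearMap.range_eq_top.2 hq, Submodule.map_span,
      ← Set.range_comp] at this
    rw [← this, eq_comm]
    refine sup_eq_left.2 ?_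
    rintro _ ⟨y, hy, rfl⟩
    have : q y = 0 := Ideal.Quotient.eq_zero_iff_mem.2 hy
    rw [this]
    exact Submodule.zero_mem _
  have hle : ∀ J : Ideal (MvPowerSeries (Fin n) k),
      Submodule.span k (Set.range g) ⊔ J.restrictScalars k = ⊤ →
      Module.rank k (MvPowerSeries (Fin n) k ⧸ J) ≤ 4 := by
    intro J hJ
    rw [← rank_top, ← key J hJ]
    classical
    have h1 := rank_span_finset_le (R := k)
      (Finset.univ.image fun i => Ideal.Quotient.mk J (g i))
    rw [Finset.coe_image, Finset.coe_univ, Set.image_univ] at h1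
    refine h1.trans ?_
    exact_mod_cast Finset.card_image_le
  suffices h5 : varIdeal k n ^ 5 ≤ I by
    rw [sup_eq_left.2 h5] at h
    exact hle I h
  -- If 𝔪⁵ is not contained in I, then by Nakayama each of the five steps of the filtration of the
  -- quotient by I + 𝔪⁵ by the images of 𝔪⁰, …, 𝔪⁵ is strict. There is no room for this in dimension
  -- at most four.
  by_contra h5
  have hstep : ∀ j < 5, ¬ varIdeal k n ^ j ≤ I ⊔ varIdeal k n ^ (j + 1) := fun j hj hj' =>
    h5 ((Ideal.pow_le_pow_right hj.le).trans (pow_le_of_pow_le_sup hj'))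
  let Q := MvPowerSeries (Fin n) k ⧸ (I ⊔ varIdeal k n ^ 5)
  have hQ4 : Module.rank k Q ≤ 4 := hle _ h
  have : FiniteDimensional k Q := by
    rw [FiniteDimensional, ← Module.rank_lt_aleph0_iff]
    exact hQ4.trans_lt (by exact_mod_cast Cardinal.nat_lt_aleph0 4)
  have hf : Module.finrank k Q ≤ 4 := by
    have := hQ4
    rw [← Module.finrank_eq_rank] at this
    exact_mod_cast this
  let W : ℕ → Submodule k Q := fun j =>
    (Ideal.map (Ideal.Quotient.mk (I ⊔ varIdeal k n ^ 5)) (varIdeal k n ^ j)).restrictScalars k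
  have hW : ∀ j ≤ 5, Module.finrank k (W j) + j ≤ 4 := by
    intro j
    induction j with
    | zero =>
      intro _
      exact (Submodule.finrank_le _).trans hf
    | succ j ih =>
      intro hj
      have h1 := ih (by omega)
      have h2 : W (j + 1) < W j := by
        refine lt_of_le_of_ne (fun x hx => Ideal.map_mono (Ideal.pow_le_pow_right (by omega)) hx)
          fun he => hstep j (by omega) ?_
        intro y hy
        have hy1 : Ideal.Quotient.mk (I ⊔ varIdeal k n ^ 5) y ∈ W j := Ideal.mem_map_of_mem _ hy
        rw [← he] at hy1
        have hy2 := (Ideal.mem_map_iff_of_surjective _ Ideal.Quotient.mk_surjective).1 hy1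
        obtain ⟨z, hz, hzy⟩ := hy2
        have := Ideal.Quotient.eq.1 hzy
        have h3 : z - y ∈ I ⊔ varIdeal k n ^ (j + 1) :=
          sup_le_sup_left (Ideal.pow_le_pow_right (by omega)) I this
        have h4 : z ∈ I ⊔ varIdeal k n ^ (j + 1) := Ideal.mem_sup_right hz
        have := Ideal.sub_mem _ h4 h3
        simpa using this
      have h3 := Submodule.finrank_lt_finrank_of_lt h2
      omega
  have := hW 5 le_rfl
  omega

end Field

end Filtration

end DiscriminantVariety

end

/-! ### Openness of the bound on the Jacobian algebra -/

noncomputable section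

namespace DiscriminantVariety

section OpenCondition

open MvPowerSeries

variable {k : Type*} [Field k] {n : ℕ}

lemma pderiv_X_eq {n : ℕ} (i j : Fin n) :
    MvPowerSeries.pderiv k i (X j : MvPowerSeries (Fin n) k) = if i = j then 1 else 0 := by
  classical
  rw [MvPowerSeries.pderiv_X]
  simp [Pi.single_apply, eq_comm]

/-- The ideal of the partial derivatives. -/
def partialIdeal (F : MvPowerSeries (Fin n) k) : Ideal (MvPowerSeries (Fin n) k) :=
  Ideal.span (Set.range fun i => MvPowerSeries.pderiv k i F)

/-- The exponents of degree at most four. -/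
abbrev Exp (n : ℕ) : Type := {α : Fin n →₀ ℕ // Finsupp.degree α < 5}

instance : Fintype (Exp n) := (Finsupp.finite_of_degree_lt (σ := Fin n) 5).fintype

instance : DecidableEq (Exp n) := Classical.decEq _

lemma sub_sum_monomial_mem {R : Type*} [CommRing R] (p : MvPowerSeries (Fin n) R) :
    p - ∑ β : Exp n, monomial β.1 (coeff β.1 p) ∈ varIdeal R n ^ 5 := by
  classical
  rw [mem_varIdeal_pow]
  intro α hα
  rw [map_sub, map_sum]
  have : ∀ β : Exp n, coeff α (monomial β.1 (coeff β.1 p)) =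
      if β = ⟨α, hα⟩ then coeff α p else 0 := fun β => by
    rw [coeff_monomial]
    by_cases h : α = β.1
    · subst h; simp
    · rw [if_neg h, if_neg (fun h' => h (by rw [h']))]
  simp [this]

/-- The families `g` and `X^α ∂ᵢF`. -/
def spanFamily {R : Type*} [CommRing R] (g : Fin 4 → MvPowerSeries (Fin n) R)
    (F : MvPowerSeries (Fin n) R) : Fin 4 ⊕ (Exp n × Fin n) → MvPowerSeries (Fin n) R :=
  Sum.elim g fun αi => monomial αi.1.1 1 * MvPowerSeries.pderiv R αi.2 F

lemma spanFamily_map {R S : Type*} [CommRing R] [CommRing S] (f : R →+* S)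
    (g : Fin 4 → MvPowerSeries (Fin n) R) (F : MvPowerSeries (Fin n) R)
    (c : Fin 4 ⊕ (Exp n × Fin n)) :
    MvPowerSeries.map f (spanFamily g F c) =
      spanFamily (fun a => MvPowerSeries.map f (g a)) (MvPowerSeries.map f F) c := by
  rcases c with a | ⟨α, i⟩
  · rfl
  · simp [spanFamily, pderiv_map]

/-- Every element is modulo `𝔪⁵` a linear combination of the family. -/
lemma exists_combination (g : Fin 4 → MvPowerSeries (Fin n) k) (F : MvPowerSeries (Fin n) k)
    (h : Submodule.span k (Set.range g) ⊔ (partialIdeal F).restrictScalars k = ⊤)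
    (p : MvPowerSeries (Fin n) k) :
    ∃ c : Fin 4 ⊕ (Exp n × Fin n) → k, p - ∑ j, c j • spanFamily g F j ∈ varIdeal k n ^ 5 := by
  have hp : p ∈ Submodule.span k (Set.range g) ⊔ (partialIdeal F).restrictScalars k := by
    rw [h]; trivial
  obtain ⟨y, hy, z, hz, rfl⟩ := Submodule.mem_sup.1 hp
  obtain ⟨a, rfl⟩ := (Submodule.mem_span_range_iff_exists_fun k).1 hy
  have hz' : z ∈ Ideal.span (Set.range fun i => MvPowerSeries.pderiv k i F) := hz
  obtain ⟨b, rfl⟩ := (Submodule.mem_span_range_iff_exists_fun _).1 hz'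
  refine ⟨Sum.elim a fun αi => coeff αi.1.1 (b αi.2), ?_⟩
  rw [Fintype.sum_sum_type, Fintype.sum_prod_type_right]
  simp only [Sum.elim_inl, Sum.elim_inr, spanFamily]
  rw [add_sub_add_left_eq_sub, ← Finset.sum_sub_distrib]
  refine Ideal.sum_mem _ fun i _ => ?_
  have : b i • MvPowerSeries.pderiv k i F -
      ∑ α : Exp n, coeff α.1 (b i) • (monomial α.1 (1 : k) * MvPowerSeries.pderiv k i F) =
      (b i - ∑ α : Exp n, monomial α.1 (coeff α.1 (b i))) * MvPowerSeries.pderiv k i F := by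
    rw [sub_mul, Finset.sum_mul, smul_eq_mul]
    congr 1
    refine Finset.sum_congr rfl fun α _ => ?_
    rw [← smul_mul_assoc]
    congr 1
    rw [← map_smul, smul_eq_mul, mul_one]
  rw [this]
  exact Ideal.mul_mem_right _ _ (sub_sum_monomial_mem _)

/-- If the space of dimension four spanned by `g` is a complement of the ideal of partial
derivatives for one specialization of a family of power series, then the quotients by the ideals
`(F, ∂ᵢF)` have dimension at most four on an open set of specializations. -/
theorem exists_open_rank_le_four {A : Type*} [CommRing A] [Algebra k A]
    (F : MvPowerSeries (Fin n) A) (ev₀ : A →ₐ[k] k) (g : Fin 4 → MvPowerSeries (Fin n) k)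
    (h : Submodule.span k (Set.range g) ⊔
      (partialIdeal (MvPowerSeries.map (ev₀ : A →+* k) F)).restrictScalars k = ⊤) :
    ∃ Δ : A, ev₀ Δ ≠ 0 ∧ ∀ ev : A →ₐ[k] k, ev Δ ≠ 0 →
      Module.rank k (MvPowerSeries (Fin n) k ⧸
        idealC (MvPowerSeries.map (ev : A →+* k) F)) ≤ 4 := by
  have hm := fun j : Exp n => exists_combination g _ h (monomial j.1 (1 : k))
  choose G hG using hm
  let gA : Fin 4 → MvPowerSeries (Fin n) A := fun a => MvPowerSeries.map (algebraMap k A) (g a)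
  have hgA : ∀ (ev : A →ₐ[k] k) a, MvPowerSeries.map (ev : A →+* k) (gA a) = g a := fun ev a => by
    ext α; simp [gA]
  -- At the given specialization every monomial of degree at most four is, modulo 𝔪⁵, a combination
  -- of the family with constant coefficients `G`. With these coefficients frozen, the same
  -- combinations are formed over `A`. Their matrix specializes to the identity under `ev₀`, and
  -- wherever its determinant stays nonzero the combinations still span modulo 𝔪⁵.
  let Mx : Matrix (Exp n) (Exp n) A := Matrix.of fun i j =>
    ∑ c, coeff i.1 (spanFamily gA F c) * algebraMap k A (G j c)
  have hMx : ∀ (ev : A →ₐ[k] k) i j, ev (Mx i j) =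
      coeff i.1 (∑ c, G j c • spanFamily g (MvPowerSeries.map (ev : A →+* k) F) c) := by
    intro ev i j
    simp only [Mx, Matrix.of_apply, map_sum, map_mul, AlgHom.commutes, map_smul, smul_eq_mul]
    refine Finset.sum_congr rfl fun c _ => ?_
    have h1 := spanFamily_map (ev : A →+* k) gA F c
    simp only [hgA] at h1
    rw [show (fun a => g a) = g from rfl] at h1
    rw [← h1, coeff_map, mul_comm]
    rfl
  have hdet : ∀ ev : A →ₐ[k] k, ev Mx.det = (Mx.map ev).det := fun ev => by
    rw [AlgHom.map_det]; rfl
  refine ⟨Mx.det, ?_, fun ev hev => ?_⟩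
  · have : Mx.map ev₀ = 1 := by
      ext i j
      rw [Matrix.map_apply, hMx]
      have h1 := mem_varIdeal_pow.1 (hG j) i.1 i.2
      rw [map_sub, sub_eq_zero, coeff_monomial] at h1
      rw [← h1, Matrix.one_apply]
      simp [Subtype.ext_iff]
    rw [hdet, this]
    simp
  · refine rank_quotient_le_four g (eq_top_iff.2 fun p _ => ?_)
    have hu : IsUnit (Mx.map ev).det := by
      rw [← hdet]; exact isUnit_iff_ne_zero.2 hev
    let y : Exp n → k := Matrix.mulVec (Mx.map ev)⁻¹ fun i => coeff i.1 p
    have hy : Matrix.mulVec (Mx.map ev) y = fun i => coeff i.1 p := by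
      rw [Matrix.mulVec_mulVec, Matrix.mul_nonsing_inv _ hu, Matrix.one_mulVec]
    let s := ∑ j, y j • ∑ c, G j c • spanFamily g (MvPowerSeries.map (ev : A →+* k) F) c
    have h5 : p - s ∈ varIdeal k n ^ 5 := by
      rw [mem_varIdeal_pow]
      intro α hα
      have := congrFun hy ⟨α, hα⟩
      simp only [Matrix.mulVec, dotProduct, Matrix.map_apply, hMx] at this
      rw [map_sub, ← this, map_sum, sub_eq_zero]
      exact Finset.sum_congr rfl fun j _ => by rw [map_smul, smul_eq_mul, mul_comm]
    have hs : s ∈ Submodule.span k (Set.range g) ⊔ (idealC (MvPowerSeries.map (ev : A →+* k) F) ⊔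
        varIdeal k n ^ 5).restrictScalars k := by
      refine Submodule.sum_mem _ fun j _ => Submodule.smul_mem _ _
        (Submodule.sum_mem _ fun c _ => Submodule.smul_mem _ _ ?_)
      rcases c with a | ⟨α, i⟩
      · exact Submodule.mem_sup_left (Submodule.subset_span ⟨a, rfl⟩)
      · refine Submodule.mem_sup_right ?_
        rw [Submodule.restrictScalars_mem]
        exact Ideal.mem_sup_left (Ideal.mul_mem_left _ _
          (Ideal.subset_span (Or.inr ⟨i, rfl⟩)))
    have : p = s + (p - s) := by ring
    rw [this]
    refine Submodule.add_mem _ hs (Submodule.mem_sup_right ?_)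
    rw [Submodule.restrictScalars_mem]
    exact Ideal.mem_sup_right h5

end OpenCondition

/-! ### The model singularity x₁x₂ + ⋯ + ξ₁² + ξ₁³ + ξ₂³ and its Jacobian algebra -/

section StandardForm

open MvPowerSeries

variable {k : Type*} [Field k] [CharP k 2] {r : ℕ}

/-- The first and the second of the last two variables. -/
abbrev ξ₁ (k : Type*) [Field k] (r : ℕ) : MvPowerSeries (Fin (r + 2)) k := X (Fin.natAdd r 0)

abbrev ξ₂ (k : Type*) [Field k] (r : ℕ) : MvPowerSeries (Fin (r + 2)) k := X (Fin.natAdd r 1)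

/-- The power series `x₁x₂ + ⋯ + x_{r-1}x_r + ξ₁² + ξ₁³ + ξ₂³`. -/
def standardForm (k : Type*) [Field k] (r : ℕ) : MvPowerSeries (Fin (r + 2)) k :=
  ∑ ν : Fin (r / 2), X ⟨2 * ν, by omega⟩ * X ⟨2 * ν + 1, by omega⟩ + ξ₁ k r ^ 2 + ξ₁ k r ^ 3 +
    ξ₂ k r ^ 3

lemma pderiv_standardForm (i : Fin (r + 2)) :
    MvPowerSeries.pderiv k i (standardForm k r) =
      ∑ ν : Fin (r / 2), (X ⟨2 * ν, by omega⟩ * (if i = ⟨2 * ν + 1, by omega⟩ then 1 else 0) +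
        X ⟨2 * ν + 1, by omega⟩ * (if i = ⟨2 * ν, by omega⟩ then 1 else 0)) +
      2 * ξ₁ k r * (if i = Fin.natAdd r 0 then 1 else 0) +
      3 * ξ₁ k r ^ 2 * (if i = Fin.natAdd r 0 then 1 else 0) +
      3 * ξ₂ k r ^ 2 * (if i = Fin.natAdd r 1 then 1 else 0) := by
  simp only [standardForm, map_add, map_sum, Derivation.leibniz, Derivation.leibniz_pow,
    pderiv_X_eq, smul_eq_mul, nsmul_eq_mul]
  norm_num

lemma two_eq_zero : (2 : MvPowerSeries (Fin (r + 2)) k) = 0 := by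
  have : (2 : MvPowerSeries (Fin (r + 2)) k) = C (2 : k) := (map_ofNat C 2).symm
  rw [this, CharTwo.two_eq_zero (R := k), map_zero]

lemma three_eq_one : (3 : MvPowerSeries (Fin (r + 2)) k) = 1 := by
  have : (3 : MvPowerSeries (Fin (r + 2)) k) = 2 + 1 := by norm_num
  rw [this, two_eq_zero, zero_add]

lemma X_mem_of_pderiv_standardForm (hr : Even r) {K : Ideal (MvPowerSeries (Fin (r + 2)) k)}
    (hK : ∀ i, MvPowerSeries.pderiv k i (standardForm k r) ∈ K) (i : Fin r) :
    X (Fin.castAdd 2 i) ∈ K := by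
  obtain ⟨ν, rfl | rfl⟩ := exists_even_or_odd hr i
  · have := hK ⟨2 * ν + 1, by omega⟩
    rw [pderiv_standardForm] at this
    convert! this using 1
    rw [Finset.sum_eq_single ν]
    · have h1 : (2 * (ν : ℕ) + 1) ≠ r := by omega
      have h2 : (2 * (ν : ℕ)) ≠ r := by omega
      have h3 : (2 * (ν : ℕ) + 1) ≠ 2 * ν := by omega
      simp [Fin.ext_iff, h1, h2, h3]
    · intro μ _ hμ
      have h1 : (ν : ℕ) ≠ μ := fun h => hμ (Fin.ext h.symm)
      have h3 : (2 * (ν : ℕ) + 1) ≠ 2 * μ := by omega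
      simp [Fin.ext_iff, h1, h3]
    · simp
  · have := hK ⟨2 * ν, by omega⟩
    rw [pderiv_standardForm] at this
    convert! this using 1
    rw [Finset.sum_eq_single ν]
    · have h1 : (2 * (ν : ℕ)) ≠ r := by omega
      have h2 : (2 * (ν : ℕ)) ≠ r + 1 := by omega
      have h3 : (2 * (ν : ℕ)) ≠ 2 * ν + 1 := by omega
      simp [Fin.ext_iff, h1, h2, h3]
    · intro μ _ hμ
      have h1 : (ν : ℕ) ≠ μ := fun h => hμ (Fin.ext h.symm)
      have h3 : (2 * (ν : ℕ)) ≠ 2 * μ + 1 := by omega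
      simp [Fin.ext_iff, h1, h3]
    · simp

/-- In characteristic two ξ₁² has zero derivative, and the derivative of ξ³ is 3ξ² = ξ². The cubic
terms of the model are there for this reason. -/
lemma ξ_sq_mem_of_pderiv_standardForm {K : Ideal (MvPowerSeries (Fin (r + 2)) k)}
    (hK : ∀ i, MvPowerSeries.pderiv k i (standardForm k r) ∈ K) (a : Fin 2) :
    X (Fin.natAdd r a) ^ 2 ∈ K := by
  have := hK (Fin.natAdd r a)
  rw [pderiv_standardForm, two_eq_zero, three_eq_one, Finset.sum_eq_zero] at this
  · fin_cases a <;> simpa [Fin.ext_iff] using this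
  · intro μ _
    have h1 : r + (a : ℕ) ≠ 2 * μ + 1 := by omega
    have h2 : r + (a : ℕ) ≠ 2 * μ := by omega
    simp [Fin.ext_iff, h1, h2]

/-- A power series which agrees up to order three with the standard form has a Jacobian algebra
spanned by `1`, `ξ₁`, `ξ₂` and `ξ₁ξ₂`. -/
theorem span_sup_partialIdeal (hr : Even r) {F : MvPowerSeries (Fin (r + 2)) k}
    (hF : F - standardForm k r ∈ varIdeal k (r + 2) ^ 4) :
    Submodule.span k (Set.range ![1, ξ₁ k r, ξ₂ k r, ξ₁ k r * ξ₂ k r]) ⊔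
      (partialIdeal F).restrictScalars k = ⊤ := by
  set I := partialIdeal F with hI
  set 𝔪 := varIdeal k (r + 2) with h𝔪
  -- The error of order four loses one order under differentiation, so the derivatives of the model
  -- lie in the ideal up to 𝔪³.
  have hK : ∀ i, MvPowerSeries.pderiv k i (standardForm k r) ∈ I ⊔ 𝔪 ^ 3 := fun i => by
    have h1 := pderiv_mem_varIdeal_pow hF i
    rw [map_sub] at h1
    have h2 : MvPowerSeries.pderiv k i F ∈ I := Ideal.subset_span ⟨i, rfl⟩
    have := Ideal.sub_mem _ (Ideal.mem_sup_left h2) (Ideal.mem_sup_right (S := I) h1)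
    simpa using this
  have hx := X_mem_of_pderiv_standardForm hr hK
  have hξ := ξ_sq_mem_of_pderiv_standardForm hK
  have hup : ∀ {y z : MvPowerSeries (Fin (r + 2)) k}, y ∈ I ⊔ 𝔪 ^ 3 → z ∈ 𝔪 →
      y * z ∈ I ⊔ 𝔪 ^ 4 := by
    intro y z hy hz
    obtain ⟨a, ha, b, hb, rfl⟩ := Submodule.mem_sup.1 hy
    rw [add_mul]
    refine Ideal.add_mem _ (Ideal.mem_sup_left (Ideal.mul_mem_right _ _ ha))
      (Ideal.mem_sup_right ?_)
    rw [pow_succ]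
    exact Ideal.mul_mem_mul hb hz
  have h34 : I ⊔ 𝔪 ^ 4 ≤ I ⊔ 𝔪 ^ 3 := sup_le_sup_left (Ideal.pow_le_pow_right (by omega)) _
  -- A cubic monomial contains some xᵢ, or else, by the pigeonhole principle, the square of some ξ.
  -- Both lie in I + 𝔪³, and the remaining factor lies in 𝔪.
  have hXXX : ∀ a b c : Fin (r + 2), X a * X b * X c ∈ I ⊔ 𝔪 ^ 4 := by
    intro a b c
    have hl : ∀ (i : Fin r) (b c : Fin (r + 2)), X (Fin.castAdd 2 i) * X b * X c ∈ I ⊔ 𝔪 ^ 4 :=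
      fun i b c => by
        rw [mul_assoc]
        exact hup (hx i) (Ideal.mul_mem_right _ _ (X_mem_varIdeal b))
    have hs : ∀ (i : Fin 2) (b : Fin (r + 2)),
        X (Fin.natAdd r i) * X (Fin.natAdd r i) * X b ∈ I ⊔ 𝔪 ^ 4 := fun i b => by
      rw [← sq]
      exact hup (hξ i) (X_mem_varIdeal b)
    induction a using Fin.addCases with
    | left i => exact hl i b c
    | right a =>
      induction b using Fin.addCases with
      | left i => rw [mul_comm (X (Fin.natAdd r a))]; exact hl i _ c
      | right b =>
        induction c using Fin.addCases with
        | left i => rw [mul_comm, ← mul_assoc]; exact hl i _ _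
        | right c =>
          have : a = b ∨ a = c ∨ b = c := by omega
          rcases this with rfl | rfl | rfl
          · exact hs _ _
          · rw [mul_right_comm]; exact hs _ _
          · rw [mul_assoc, mul_comm]; exact hs _ _
  have hmul : ∀ (J K : Ideal (MvPowerSeries (Fin (r + 2)) k)),
      (∀ i, ∀ y ∈ J, X i * y ∈ K) → 𝔪 * J ≤ K := by
    intro J K h
    rw [Ideal.mul_le]
    intro s hs y hy
    refine Submodule.span_induction (p := fun s _ => s * y ∈ K) ?_ ?_ ?_ ?_ hs
    · rintro _ ⟨i, rfl⟩; exact h i y hy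
    · simp
    · intro a b _ _ ha hb; rw [add_mul]; exact K.add_mem ha hb
    · intro a b _ hb; rw [smul_eq_mul, mul_assoc]; exact K.mul_mem_left _ hb
  have h3 : 𝔪 ^ 3 ≤ I := by
    refine pow_le_of_pow_le_sup ?_
    rw [pow_succ', pow_succ']
    refine hmul _ _ fun a y hy => ?_
    refine Submodule.mul_induction_on hy (fun s hs t ht => ?_) (fun s t hs ht => ?_)
    · rw [pow_one] at ht
      refine Submodule.span_induction (p := fun s _ => X a * (s * t) ∈ _) ?_ ?_ ?_ ?_ hs
      · rintro _ ⟨b, rfl⟩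
        refine Submodule.span_induction (p := fun t _ => X a * (X b * t) ∈ _) ?_ ?_ ?_ ?_ ht
        · rintro _ ⟨c, rfl⟩; rw [← mul_assoc]; exact hXXX a b c
        · simp
        · intro s t _ _ hs ht; rw [mul_add, mul_add]; exact Ideal.add_mem _ hs ht
        · intro s t _ ht
          rw [smul_eq_mul, show X a * (X b * (s * t)) = s * (X a * (X b * t)) by ring]
          exact Ideal.mul_mem_left _ _ ht
      · simp
      · intro u v _ _ hu hv; rw [add_mul, mul_add]; exact Ideal.add_mem _ hu hv
      · intro u v _ hv
        rw [smul_eq_mul, show X a * (u * v * t) = u * (X a * (v * t)) by ring]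
        exact Ideal.mul_mem_left _ _ hv
    · rw [mul_add]; exact Ideal.add_mem _ hs ht
  rw [sup_eq_left.2 h3] at hx hξ
  set W := Submodule.span k (Set.range ![1, ξ₁ k r, ξ₂ k r, ξ₁ k r * ξ₂ k r]) ⊔
    I.restrictScalars k with hW
  have hIW : ∀ y ∈ I, y ∈ W := fun y hy => Submodule.mem_sup_right hy
  have hCW : ∀ (c : k) (j : Fin 4), C c * (![1, ξ₁ k r, ξ₂ k r, ξ₁ k r * ξ₂ k r] j) ∈ W :=
    fun c j => by
      rw [← smul_eq_C_mul]
      exact Submodule.mem_sup_left (Submodule.smul_mem _ _ (Submodule.subset_span ⟨j, rfl⟩))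
  have hX3 : ∀ (a b c : Fin (r + 2)) y, X a * (X b * (X c * y)) ∈ I := fun a b c y => by
    apply h3
    rw [pow_succ', pow_two]
    exact Ideal.mul_mem_mul (X_mem_varIdeal a) (Ideal.mul_mem_mul (X_mem_varIdeal b)
      (Ideal.mul_mem_right _ _ (X_mem_varIdeal c)))
  have h12 : ∀ y, ξ₁ k r * (ξ₂ k r * y) ∈ W := fun y => by
    obtain ⟨G, hG⟩ := exists_eq_const_add_sum y
    rw [hG, mul_add, mul_add, Finset.mul_sum, Finset.mul_sum]
    refine W.add_mem ?_ (W.sum_mem fun i _ => hIW _ (hX3 _ _ _ _))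
    have := hCW (constantCoeff y) 3
    convert! this using 1
    simp only [Matrix.cons_val]
    ring
  have h1 : ∀ (a : Fin 2) y, X (Fin.natAdd r a) * y ∈ W := fun a y => by
    obtain ⟨G, hG⟩ := exists_eq_const_add_sum y
    rw [hG, mul_add, Finset.mul_sum]
    refine W.add_mem ?_ (W.sum_mem fun i _ => ?_)
    · rw [mul_comm]
      fin_cases a
      · exact hCW (constantCoeff y) 1
      · exact hCW (constantCoeff y) 2
    · induction i using Fin.addCases with
      | left i =>
        refine hIW _ ?_
        rw [mul_left_comm]
        exact Ideal.mul_mem_right _ _ (hx i)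
      | right b =>
        by_cases hab : a = b
        · subst hab
          refine hIW _ ?_
          rw [← mul_assoc, ← sq]
          exact Ideal.mul_mem_right _ _ (hξ a)
        · have : (a = 0 ∧ b = 1) ∨ (a = 1 ∧ b = 0) := by omega
          rcases this with ⟨rfl, rfl⟩ | ⟨rfl, rfl⟩
          · exact h12 _
          · rw [mul_left_comm]; exact h12 _
  rw [eq_top_iff]
  intro y _
  obtain ⟨G, hG⟩ := exists_eq_const_add_sum y
  rw [hG]
  refine W.add_mem ?_ (W.sum_mem fun i _ => ?_)
  · have := hCW (constantCoeff y) 0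
    simpa using this
  · induction i using Fin.addCases with
    | left i => exact hIW _ (Ideal.mul_mem_right _ _ (hx i))
    | right b => exact h1 b _

end StandardForm

end DiscriminantVariety

end

noncomputable section
namespace DiscriminantVariety

/-! ## Coordinates and Taylor expansions -/

section Taylor

open MvPowerSeries

/-- Coordinates `x₁, …, xₙ` on a `k`-algebra `S`, étale over affine space, together with the Taylor
expansion `f(x) ↦ f(x + t)`. -/
structure TaylorCoords (k S : Type u) [Field k] [CommRing S] [Algebra k S] (n : ℕ) where
  /-- the coordinates -/
  x : Fin n → S
  /-- the Taylor expansion -/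
  T : S →ₐ[k] MvPowerSeries (Fin n) S
  T_x : ∀ i, T (x i) = C (x i) + X i
  const_T : ∀ a, constantCoeff (T a) = a
  der_ext : ∀ (N : Type u) [AddCommGroup N] [Module S N] [Module k N] [IsScalarTower k S N]
    (d : Derivation k S N), (∀ i, d (x i) = 0) → d = 0

/-- Infinitesimal lifting along an adically complete ideal, with the algebra structure on the target
stated as a ring homomorphism. -/
lemma exists_lift_of_formallySmooth {P S B : Type*} [CommRing P] [CommRing S] [CommRing B]
    [Algebra P S] [Algebra.FormallySmooth P S] (I : Ideal B) [IsAdicComplete I B] (h : P →+* B)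
    (f : S →+* B ⧸ I) (hc : f.comp (algebraMap P S) = (Ideal.Quotient.mk I).comp h) :
    ∃ g : S →+* B, g.comp (algebraMap P S) = h ∧ (Ideal.Quotient.mk I).comp g = f := by
  letI := h.toAlgebra
  let f' : S →ₐ[P] B ⧸ I := { f with commutes' := fun r => RingHom.congr_fun hc r }
  obtain ⟨g, hg⟩ := Algebra.FormallySmooth.exists_mkₐ_comp_eq_of_isAdicComplete f'
  refine ⟨g, g.comp_algebraMap, ?_⟩
  ext a
  exact AlgHom.congr_fun hg a

variable {k S : Type u} [Field k] [CommRing S] [Algebra k S] {n : ℕ}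

/-- The substitution x ↦ x + t is defined on polynomials and reduces to the identity modulo t.
Formal smoothness lifts it to `S`, as the power series ring is t-adically complete; the other half
of formal étaleness, Ω = 0, makes derivations determined by their values on the coordinates. -/
theorem exists_taylorCoords (g : MvPolynomial (Fin n) k →ₐ[k] S)
    (hg : g.toRingHom.FormallyEtale) : Nonempty (TaylorCoords k S n) := by
  letI : Algebra (MvPolynomial (Fin n) k) S := g.toRingHom.toAlgebra
  have hgE : Algebra.FormallyEtale (MvPolynomial (Fin n) k) S := hg
  have halg : ∀ a, algebraMap (MvPolynomial (Fin n) k) S a = g a := fun a => rfl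
  let h : MvPolynomial (Fin n) k →ₐ[k] MvPowerSeries (Fin n) S :=
    MvPolynomial.aeval fun i => C (g (MvPolynomial.X i)) + X i
  have hI : IsAdicComplete (varIdeal S n) (MvPowerSeries (Fin n) S) := by
    unfold varIdeal; infer_instance
  obtain ⟨T, hT1, hT2⟩ := exists_lift_of_formallySmooth (P := MvPolynomial (Fin n) k)
    (varIdeal S n) h.toRingHom
    ((Ideal.Quotient.mk (varIdeal S n)).comp (C (σ := Fin n) (R := S))) (by
      apply MvPolynomial.ringHom_ext
      · intro c
        have : algebraMap (MvPolynomial (Fin n) k) S (MvPolynomial.C c) = algebraMap k S c := by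
          rw [halg]; exact g.commutes c
        simp only [RingHom.comp_apply, this]
        congr 1
        exact ((h.commutes c).trans MvPowerSeries.algebraMap_apply).symm
      · intro i
        simp only [RingHom.comp_apply, halg]
        rw [Ideal.Quotient.mk_eq_mk_iff_sub_mem]
        have : h.toRingHom (MvPolynomial.X i) = C (g (MvPolynomial.X i)) + X i :=
          MvPolynomial.aeval_X _ _
        rw [this, sub_add_cancel_left]
        exact neg_mem (X_mem_varIdeal i))
  have hT1' : ∀ a, T (g a) = h a := fun a => RingHom.congr_fun hT1 a
  refine ⟨⟨fun i => g (MvPolynomial.X i), { T with commutes' := fun c => ?_ }, fun i => ?_,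
    fun a => ?_, ?_⟩⟩
  · change T (algebraMap k S c) = _
    rw [← g.commutes c, hT1', h.commutes]
  · change T (g _) = _
    rw [hT1']
    exact MvPolynomial.aeval_X _ _
  · change constantCoeff (T a) = a
    have := RingHom.congr_fun hT2 a
    simp only [RingHom.comp_apply] at this
    rw [Ideal.Quotient.mk_eq_mk_iff_sub_mem, mem_varIdeal, map_sub, sub_eq_zero] at this
    simpa using this
  · intro N _ _ _ _ d hd
    letI : Module (MvPolynomial (Fin n) k) N := Module.compHom N g.toRingHom
    have hsm : ∀ (a : MvPolynomial (Fin n) k) (v : N), a • v = g a • v := fun _ _ => rfl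
    haveI : IsScalarTower (MvPolynomial (Fin n) k) S N :=
      ⟨fun a s v => by
        rw [hsm, Algebra.smul_def, halg, mul_smul]⟩
    haveI : IsScalarTower k (MvPolynomial (Fin n) k) S :=
      IsScalarTower.of_algebraMap_eq fun c => (g.commutes c).symm
    haveI : IsScalarTower k (MvPolynomial (Fin n) k) N :=
      ⟨fun a s v => by rw [hsm, hsm, map_smul, smul_assoc]⟩
    have h0 : d.compAlgebraMap (MvPolynomial (Fin n) k) = 0 := by
      apply MvPolynomial.derivation_ext
      intro i
      exact hd i
    have h0' : ∀ a, d (g a) = 0 := fun a => DFunLike.congr_fun h0 a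
    -- A derivation that kills the coordinates is linear over the polynomial ring, so it factors
    -- through the vanishing relative differentials.
    let d' : Derivation (MvPolynomial (Fin n) k) S N :=
      { toFun := d
        map_add' := map_add d
        map_smul' := fun a s => by
          simp only [Algebra.smul_def, halg, Derivation.leibniz, h0', smul_zero, add_zero,
            RingHom.id_apply, hsm]
        map_one_eq_zero' := d.map_one_eq_zero
        leibniz' := d.leibniz }
    ext s
    have := Subsingleton.elim (KaehlerDifferential.D (MvPolynomial (Fin n) k) S s) 0
    have h2 := d'.liftKaehlerDifferential_comp_D s
    rw [this, map_zero] at h2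
    exact h2.symm

/-- Coordinates on a localization. -/
theorem exists_localize (c : TaylorCoords k S n) (M : Submonoid S) (O : Type u) [CommRing O]
    [Algebra k O] [Algebra S O] [IsScalarTower k S O] [IsLocalization M O] :
    ∃ c' : TaylorCoords k O n, (∀ i, c'.x i = algebraMap S O (c.x i)) ∧
      ∀ a, c'.T (algebraMap S O a) = map (algebraMap S O) (c.T a) := by
  let T₀ : S →+* MvPowerSeries (Fin n) O := (map (algebraMap S O)).comp c.T.toRingHom
  have hT₀ : ∀ a, constantCoeff (T₀ a) = algebraMap S O a := fun a => by
    change constantCoeff (map _ (c.T a)) = _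
    rw [constantCoeff_map, c.const_T]
  -- The Taylor series of a denominator has that denominator as constant term, so it is invertible.
  have hu : ∀ y : M, IsUnit (T₀ y) := fun y => by
    rw [isUnit_iff_constantCoeff, hT₀]
    exact IsLocalization.map_units O y
  let T : O →+* MvPowerSeries (Fin n) O := IsLocalization.lift hu
  have hT : ∀ a, T (algebraMap S O a) = map (algebraMap S O) (c.T a) :=
    fun a => IsLocalization.lift_eq hu a
  refine ⟨⟨fun i => algebraMap S O (c.x i), { T with commutes' := fun a => ?_ }, fun i => ?_,
    fun a => ?_, ?_⟩, fun i => rfl, hT⟩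
  · change T (algebraMap k O a) = _
    rw [IsScalarTower.algebraMap_apply k S O, hT, AlgHom.commutes]
    rw [MvPowerSeries.algebraMap_apply, MvPowerSeries.algebraMap_apply, map_C,
      ← IsScalarTower.algebraMap_apply]
  · change T _ = _
    rw [hT, c.T_x, map_add, map_C, map_X]
  · change constantCoeff (T a) = a
    have : (constantCoeff.comp T) = RingHom.id O := by
      apply IsLocalization.ringHom_ext M
      ext a
      simp [hT, c.const_T]
    exact RingHom.congr_fun this a
  · intro N _ _ _ _ d hd
    letI : Module S N := Module.compHom N (algebraMap S O)
    haveI : IsScalarTower S O N := ⟨fun a s v => by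
      rw [Algebra.smul_def, mul_smul]; rfl⟩
    haveI : IsScalarTower k S N := ⟨fun a s v => by
      change algebraMap S O (a • s) • v = a • (algebraMap S O s • v)
      rw [Algebra.smul_def, map_mul, ← IsScalarTower.algebraMap_apply, mul_smul,
        algebraMap_smul]⟩
    have h0 := c.der_ext N (d.compAlgebraMap S) hd
    have h0' : ∀ a, d (algebraMap S O a) = 0 := fun a => DFunLike.congr_fun h0 a
    ext s
    obtain ⟨⟨a, b⟩, hb⟩ := IsLocalization.surj M s
    have h1 := congrArg d hb
    simp only [Derivation.leibniz, h0', smul_zero, zero_add] at h1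
    exact ((IsLocalization.map_units O b).smul_eq_zero).1 h1

namespace TaylorCoords

variable (c : TaylorCoords k S n)

/-- The partial derivatives. -/
def der (i : Fin n) : Derivation k S S where
  toFun a := coeff (Finsupp.single i 1) (c.T a)
  map_add' a b := by simp
  map_smul' r a := by simp
  map_one_eq_zero' := by
    change coeff _ (c.T 1) = 0
    rw [map_one, coeff_one, if_neg (by simp)]
  leibniz' a b := by
    classical
    change coeff (Finsupp.single i 1) (c.T (a * b)) = a • coeff _ (c.T b) + b • coeff _ (c.T a)
    have h : Finset.HasAntidiagonal.antidiagonal (Finsupp.single i 1 : Fin n →₀ ℕ) =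
        {(0, Finsupp.single i 1), (Finsupp.single i 1, 0)} := by
      rw [Finsupp.antidiagonal_single]
      have : (Finset.HasAntidiagonal.antidiagonal 1 : Finset (ℕ × ℕ)) = {(0, 1), (1, 0)} := rfl
      rw [this]
      simp
    rw [map_mul, coeff_mul, h, Finset.sum_pair (by simp [Prod.ext_iff, eq_comm])]
    simp only [coeff_zero_eq_constantCoeff, c.const_T, smul_eq_mul]
    ring

lemma der_x (i j : Fin n) : c.der i (c.x j) = if i = j then 1 else 0 := by
  classical
  change coeff _ (c.T _) = _
  rw [c.T_x, map_add, coeff_C, coeff_X, if_neg (by simp), zero_add]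
  congr 1
  rw [Finsupp.single_left_inj one_ne_zero]

lemma der_ext' {N : Type u} [AddCommGroup N] [Module S N] [Module k N] [IsScalarTower k S N]
    {d d' : Derivation k S N} (h : ∀ i, d (c.x i) = d' (c.x i)) : d = d' :=
  sub_eq_zero.1 (c.der_ext N (d - d') fun i => by simp [h])

/-- The commutator is a derivation that kills the coordinates. -/
lemma der_comm (i j : Fin n) (a : S) : c.der i (c.der j a) = c.der j (c.der i a) := by
  have : ⁅c.der i, c.der j⁆ = 0 := c.der_ext S _ fun l => by
    simp [Derivation.commutator_apply, c.der_x, apply_ite]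
  have := DFunLike.congr_fun this a
  rwa [Derivation.commutator_apply, Derivation.zero_apply, sub_eq_zero] at this

/-- In characteristic two the square of a derivation is again a derivation; this one kills the
coordinates. It is what makes the universal Hessian alternating. -/
lemma der_der_self [CharP k 2] (i : Fin n) (a : S) : c.der i (c.der i a) = 0 := by
  have h2 : (2 : S) = 0 := by
    rw [← map_ofNat (algebraMap k S) 2, CharTwo.two_eq_zero (R := k), map_zero]
  let d : Derivation k S S :=
    { toFun := fun a => c.der i (c.der i a)
      map_add' := by simp
      map_smul' := by simp
      map_one_eq_zero' := by simp
      leibniz' := fun a b => by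
        change c.der i (c.der i (a * b)) = a • c.der i (c.der i b) + b • c.der i (c.der i a)
        simp only [Derivation.leibniz, smul_eq_mul, map_add]
        linear_combination (c.der i a * c.der i b) * h2 }
  have : d = 0 := c.der_ext S _ fun l => by
    change c.der i (c.der i (c.x l)) = 0
    rw [c.der_x]
    split_ifs <;> simp
  exact DFunLike.congr_fun this a

end TaylorCoords

end Taylor

end DiscriminantVariety
end

/-! ### Taylor expansion at a rational point and the completed local ring -/

noncomputable section
namespace DiscriminantVariety

namespace TaylorCoords

open MvPowerSeries

variable {k O : Type u} [Field k] [CommRing O] [Algebra k O] {n : ℕ}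
  (c : TaylorCoords k O n) (ε : O →ₐ[k] k)

/-- The Taylor expansion at a `k`-rational point. -/
def taylorAt : O →ₐ[k] MvPowerSeries (Fin n) k := (mapAlgHom ε).comp c.T

lemma taylorAt_apply (a : O) : c.taylorAt ε a = map (ε : O →+* k) (c.T a) := rfl

lemma constantCoeff_taylorAt (a : O) : constantCoeff (c.taylorAt ε a) = ε a := by
  rw [taylorAt_apply, constantCoeff_map, c.const_T]
  rfl

/-- The coordinates, centered at a `k`-rational point. -/
def centered (i : Fin n) : O := c.x i - algebraMap k O (ε (c.x i))

lemma apply_centered (i : Fin n) : ε (c.centered ε i) = 0 := by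
  simp [centered]

lemma taylorAt_centered (i : Fin n) : c.taylorAt ε (c.centered ε i) = X i := by
  rw [centered, map_sub, AlgHom.commutes, taylorAt_apply, c.T_x, map_add, map_C, map_X,
    MvPowerSeries.algebraMap_apply]
  simp

lemma der_centered (i j : Fin n) : c.der i (c.centered ε j) = if i = j then 1 else 0 := by
  rw [centered, map_sub, Derivation.map_algebraMap, sub_zero, c.der_x]

/-- Both sides are derivations of `O` along the Taylor homomorphism, and they agree on the
coordinates. -/
lemma taylorAt_der (i : Fin n) (a : O) :
    c.taylorAt ε (c.der i a) = MvPowerSeries.pderiv k i (c.taylorAt ε a) := by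
  letI : Module O (MvPowerSeries (Fin n) k) := Module.compHom _ (c.taylorAt ε).toRingHom
  have hsm : ∀ (a : O) (F : MvPowerSeries (Fin n) k), a • F = c.taylorAt ε a * F :=
    fun _ _ => rfl
  haveI : IsScalarTower k O (MvPowerSeries (Fin n) k) := ⟨fun r a F => by
    rw [hsm, hsm, map_smul, smul_mul_assoc]⟩
  let d : Derivation k O (MvPowerSeries (Fin n) k) :=
    { toFun := fun a => c.taylorAt ε (c.der i a)
      map_add' := by simp
      map_smul' := by simp
      map_one_eq_zero' := by simp
      leibniz' := fun a b => by
        change c.taylorAt ε (c.der i (a * b)) = _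
        simp only [hsm, Derivation.leibniz, map_add, smul_eq_mul, map_mul]
        rfl }
  let d' : Derivation k O (MvPowerSeries (Fin n) k) :=
    { toFun := fun a => MvPowerSeries.pderiv k i (c.taylorAt ε a)
      map_add' := by simp
      map_smul' := by simp
      map_one_eq_zero' := by simp
      leibniz' := fun a b => by
        change MvPowerSeries.pderiv k i (c.taylorAt ε (a * b)) = _
        simp only [hsm, Derivation.leibniz, smul_eq_mul, map_mul]
        rfl }
  have : d = d' := c.der_ext' fun j => by
    change c.taylorAt ε (c.der i (c.x j)) = MvPowerSeries.pderiv k i (c.taylorAt ε (c.x j))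
    have h1 : c.x j = c.centered ε j + algebraMap k O (ε (c.x j)) := by simp [centered]
    rw [h1, map_add, Derivation.map_algebraMap, add_zero, map_add, taylorAt_centered,
      AlgHom.commutes, map_add, Derivation.map_algebraMap, add_zero, der_centered, pderiv_X_eq]
    split_ifs <;> simp
  exact DFunLike.congr_fun this a

variable [IsLocalRing O]

lemma ker_eq_maximalIdeal (ε : O →ₐ[k] k) : RingHom.ker ε = maximalIdeal O :=
  IsLocalRing.eq_maximalIdeal
    (RingHom.ker_isMaximal_of_surjective ε fun r => ⟨algebraMap k O r, by simp⟩)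

lemma mem_maximalIdeal_iff {a : O} : a ∈ maximalIdeal O ↔ ε a = 0 := by
  rw [← ker_eq_maximalIdeal ε, RingHom.mem_ker]

variable [IsNoetherianRing O]

lemma maximalIdeal_eq : maximalIdeal O = Ideal.span (Set.range (c.centered ε)) := by
  apply le_antisymm
  · have hle : maximalIdeal O ≤ Ideal.span (Set.range (c.centered ε)) ⊔
        maximalIdeal O • maximalIdeal O := by
      set K := Ideal.span (Set.range (c.centered ε)) ⊔ maximalIdeal O • maximalIdeal O with hK
      have hsq : ∀ a b : O, ε a = 0 → ε b = 0 → a * b ∈ K := fun a b ha hb =>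
        Ideal.mem_sup_right (Ideal.mul_mem_mul ((mem_maximalIdeal_iff ε).2 ha)
          ((mem_maximalIdeal_iff ε).2 hb))
      -- Modulo the centered coordinates and 𝔪², the map a ↦ a - a(p) is a derivation that kills the
      -- coordinates, hence zero. This gives 𝔪 ≤ (x) + 𝔪², and Nakayama's lemma does the rest.
      let d : Derivation k O (O ⧸ K) :=
        { toFun := fun a => Ideal.Quotient.mk K (a - algebraMap k O (ε a))
          map_add' := fun a b => by rw [← map_add]; congr 1; simp only [map_add]; ring
          map_smul' := fun r a => by
            simp only [map_smul, RingHom.id_apply, Algebra.smul_def, map_mul, map_sub,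
              smul_eq_mul, AlgHom.commutes, Algebra.algebraMap_self, RingHom.id_apply, mul_sub]
            rfl
          map_one_eq_zero' := by simp
          leibniz' := fun a b => by
            change Ideal.Quotient.mk K _ = a • Ideal.Quotient.mk K _ + b • Ideal.Quotient.mk K _
            rw [Algebra.smul_def, Algebra.smul_def]
            change _ = Ideal.Quotient.mk K _ * _ + Ideal.Quotient.mk K _ * _
            rw [← map_mul, ← map_mul, ← map_add, Ideal.Quotient.mk_eq_mk_iff_sub_mem]
            have := hsq (a - algebraMap k O (ε a)) (b - algebraMap k O (ε b)) (by simp) (by simp)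
            rw [← neg_mem_iff]
            convert! this using 1
            simp only [map_mul]
            ring }
      have hd : d = 0 := c.der_ext _ _ fun i =>
        Ideal.Quotient.eq_zero_iff_mem.2 (Ideal.mem_sup_left (Ideal.subset_span ⟨i, rfl⟩))
      intro a ha
      have := DFunLike.congr_fun hd a
      have h2 : Ideal.Quotient.mk K (a - algebraMap k O (ε a)) = 0 := this
      rw [(mem_maximalIdeal_iff ε).1 ha, map_zero, sub_zero] at h2
      exact Ideal.Quotient.eq_zero_iff_mem.1 h2
    exact Submodule.le_of_le_smul_of_le_jacobson_bot (IsNoetherian.noetherian _)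
      (IsLocalRing.maximalIdeal_le_jacobson _) hle
  · rw [Ideal.span_le]
    rintro _ ⟨i, rfl⟩
    exact (mem_maximalIdeal_iff ε).2 (c.apply_centered ε i)

/-- Substitution of the centered coordinates in polynomials. -/
def polyEval : MvPolynomial (Fin n) k →ₐ[k] O := MvPolynomial.aeval (c.centered ε)

omit [IsLocalRing O] [IsNoetherianRing O] in
lemma taylorAt_polyEval (p : MvPolynomial (Fin n) k) :
    c.taylorAt ε (c.polyEval ε p) = (p : MvPowerSeries (Fin n) k) := by
  have : (c.taylorAt ε).comp (c.polyEval ε) = MvPolynomial.coeToMvPowerSeries.algHom k := by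
    apply MvPolynomial.algHom_ext
    intro i
    rw [AlgHom.comp_apply, polyEval, MvPolynomial.aeval_X, taylorAt_centered]
    simp
  have := DFunLike.congr_fun this p
  simpa using this

lemma exists_polyEval (N : ℕ) (a : O) :
    ∃ p : MvPolynomial (Fin n) k, a - c.polyEval ε p ∈ maximalIdeal O ^ N := by
  induction N generalizing a with
  | zero => exact ⟨0, by simp⟩
  | succ N ih =>
    have h1 : a - algebraMap k O (ε a) ∈ maximalIdeal O := (mem_maximalIdeal_iff ε).2 (by simp)
    rw [c.maximalIdeal_eq ε, Ideal.span, Submodule.mem_span_range_iff_exists_fun] at h1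
    obtain ⟨b, hb⟩ := h1
    choose p hp using fun i => ih (b i)
    refine ⟨MvPolynomial.C (ε a) + ∑ i, p i * MvPolynomial.X i, ?_⟩
    have : a - c.polyEval ε (MvPolynomial.C (ε a) + ∑ i, p i * MvPolynomial.X i) =
        ∑ i, (b i - c.polyEval ε (p i)) * c.centered ε i := by
      simp only [smul_eq_mul] at hb
      have h2 : ∀ i, c.polyEval ε (MvPolynomial.X i) = c.centered ε i :=
        fun i => MvPolynomial.aeval_X _ _
      have h3 : c.polyEval ε (MvPolynomial.C (ε a)) = algebraMap k O (ε a) :=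
        MvPolynomial.aeval_C _ _
      simp only [map_add, map_sum, map_mul, h2, h3, sub_mul, Finset.sum_sub_distrib, hb]
      ring
    rw [this, pow_succ]
    exact Ideal.sum_mem _ fun i _ => Ideal.mul_mem_mul (hp i)
      ((mem_maximalIdeal_iff ε).2 (c.apply_centered ε i))

lemma taylorAt_mem_of_mem {N : ℕ} {a : O} (ha : a ∈ maximalIdeal O ^ N) :
    c.taylorAt ε a ∈ varIdeal k n ^ N := by
  have : maximalIdeal O ≤ (varIdeal k n).comap (c.taylorAt ε) := fun b hb => by
    rw [Ideal.mem_comap, mem_varIdeal, constantCoeff_taylorAt]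
    exact (mem_maximalIdeal_iff ε).1 hb
  exact Ideal.le_comap_pow _ N (Ideal.pow_right_mono this N ha)

/-- Modulo 𝔪^N every function is a polynomial in the centered coordinates, and the Taylor expansion
of such a polynomial is the polynomial itself. -/
lemma mem_pow_iff {N : ℕ} {a : O} :
    a ∈ maximalIdeal O ^ N ↔ c.taylorAt ε a ∈ varIdeal k n ^ N := by
  refine ⟨c.taylorAt_mem_of_mem ε, fun h => ?_⟩
  obtain ⟨p, hp⟩ := c.exists_polyEval ε N a
  have h2 := sub_mem h (c.taylorAt_mem_of_mem ε hp)
  rw [map_sub, sub_sub_cancel, taylorAt_polyEval, mem_varIdeal_pow] at h2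
  have : c.polyEval ε p ∈ maximalIdeal O ^ N := by
    rw [p.as_sum, map_sum]
    refine Ideal.sum_mem _ fun α hα => ?_
    rw [polyEval, MvPolynomial.aeval_monomial]
    have hdeg : N ≤ α.degree := by
      by_contra! hlt
      have := h2 α hlt
      rw [MvPolynomial.coeff_coe] at this
      exact (MvPolynomial.mem_support_iff.1 hα) this
    refine Ideal.mul_mem_left _ _ (Ideal.pow_le_pow_right hdeg ?_)
    rw [Finsupp.prod, Finsupp.degree_apply, ← Finset.prod_pow_eq_pow_sum]
    exact Ideal.prod_mem_prod fun i _ => Ideal.pow_mem_pow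
      ((mem_maximalIdeal_iff ε).2 (c.apply_centered ε i)) _
  simpa using add_mem hp this

/-- `O / 𝔪^N → k[[t]] / (t)^N`. -/
def quotientTaylor (N : ℕ) :
    O ⧸ maximalIdeal O ^ N →ₐ[k] MvPowerSeries (Fin n) k ⧸ varIdeal k n ^ N :=
  Ideal.quotientMapₐ _ (c.taylorAt ε) fun _ ha => c.taylorAt_mem_of_mem ε ha

lemma quotientTaylor_injective (N : ℕ) : Function.Injective (c.quotientTaylor ε N) := by
  rw [injective_iff_map_eq_zero]
  intro a
  obtain ⟨a, rfl⟩ := Ideal.Quotient.mk_surjective a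
  intro h
  rw [Ideal.Quotient.eq_zero_iff_mem, c.mem_pow_iff ε]
  exact Ideal.Quotient.eq_zero_iff_mem.1 h

lemma quotientTaylor_compat {N N' : ℕ} (hle : N ≤ N') :
    (Ideal.Quotient.factorₐ k (Ideal.pow_le_pow_right hle)).comp
      ((c.quotientTaylor ε N').comp
        ((AdicCompletion.evalₐ (maximalIdeal O) N').restrictScalars k)) =
      (c.quotientTaylor ε N).comp
        ((AdicCompletion.evalₐ (maximalIdeal O) N).restrictScalars k) := by
  ext y
  obtain ⟨s, rfl⟩ := AdicCompletion.mk_surjective _ _ y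
  simp only [AlgHom.comp_apply, AlgHom.restrictScalars_apply, AdicCompletion.evalₐ_mk]
  change Ideal.Quotient.mk _ (c.taylorAt ε (s.val N')) =
    Ideal.Quotient.mk _ (c.taylorAt ε (s.val N))
  rw [Ideal.Quotient.mk_eq_mk_iff_sub_mem, ← map_sub]
  apply c.taylorAt_mem_of_mem ε
  have := s.2 hle
  rw [SModEq.comm, SModEq.sub_mem] at this
  simpa using this

/-- The homomorphism from the completed local ring to the ring of formal power series. -/
def completionTaylor : AdicCompletion (maximalIdeal O) O →ₐ[k] MvPowerSeries (Fin n) k :=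
  haveI : IsAdicComplete (varIdeal k n) (MvPowerSeries (Fin n) k) := by
    unfold varIdeal; infer_instance
  IsAdicComplete.liftAlgHom (varIdeal k n)
    (fun N => (c.quotientTaylor ε N).comp
      ((AdicCompletion.evalₐ (maximalIdeal O) N).restrictScalars k))
    (c.quotientTaylor_compat ε)

lemma mk_completionTaylor (N : ℕ) (y : AdicCompletion (maximalIdeal O) O) :
    Ideal.Quotient.mk (varIdeal k n ^ N) (c.completionTaylor ε y) =
      c.quotientTaylor ε N (AdicCompletion.evalₐ (maximalIdeal O) N y) := by
  haveI : IsAdicComplete (varIdeal k n) (MvPowerSeries (Fin n) k) := by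
    unfold varIdeal; infer_instance
  exact IsAdicComplete.mk_liftAlgHom (varIdeal k n) _ (c.quotientTaylor_compat ε) N y

lemma eq_of_mk_varIdeal_eq {R : Type*} [CommRing R] {n : ℕ} {F G : MvPowerSeries (Fin n) R}
    (h : ∀ N, Ideal.Quotient.mk (varIdeal R n ^ N) F = Ideal.Quotient.mk (varIdeal R n ^ N) G) :
    F = G := by
  rw [← sub_eq_zero, ← Ideal.mem_bot, ← iInf_varIdeal_pow, Ideal.mem_iInf]
  exact fun N => Ideal.Quotient.mk_eq_mk_iff_sub_mem _ _ |>.1 (h N)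

lemma completionTaylor_algebraMap (a : O) :
    c.completionTaylor ε (algebraMap O (AdicCompletion (maximalIdeal O) O) a) =
      c.taylorAt ε a := by
  refine eq_of_mk_varIdeal_eq fun N => ?_
  rw [mk_completionTaylor, AlgHom.commutes]
  rfl

/-- Injectivity holds modulo every power of 𝔪. For surjectivity, the truncations of a power series,
evaluated at the centered coordinates, form a Cauchy sequence. -/
lemma completionTaylor_bijective : Function.Bijective (c.completionTaylor ε) := by
  constructor
  · intro y z h
    refine AdicCompletion.ext_evalₐ fun N => c.quotientTaylor_injective ε N ?_
    rw [← mk_completionTaylor, ← mk_completionTaylor, h]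
  · intro F
    have hF : ∀ N, F - (truncTotal N F : MvPowerSeries (Fin n) k) ∈ varIdeal k n ^ N := fun N => by
      rw [mem_varIdeal_pow]
      intro α hα
      rw [map_sub, MvPolynomial.coeff_coe, coeff_truncTotal _ hα, sub_self]
    let s : AdicCompletion.AdicCauchySequence (maximalIdeal O) O :=
      AdicCompletion.AdicCauchySequence.mk _ _ (fun N => c.polyEval ε (truncTotal N F)) (by
        intro N
        rw [SModEq.sub_mem, smul_eq_mul, Ideal.mul_top, c.mem_pow_iff ε, map_sub,
          taylorAt_polyEval, taylorAt_polyEval]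
        have := sub_mem (Ideal.pow_le_pow_right (Nat.le_succ N) (hF (N + 1))) (hF N)
        simpa using this)
    refine ⟨AdicCompletion.mk _ _ s, eq_of_mk_varIdeal_eq fun N => ?_⟩
    rw [mk_completionTaylor, AdicCompletion.evalₐ_mk]
    change Ideal.Quotient.mk _ (c.taylorAt ε (c.polyEval ε (truncTotal N F))) = _
    rw [taylorAt_polyEval, eq_comm, Ideal.Quotient.mk_eq_mk_iff_sub_mem]
    exact hF N

/-- The formal parameter system given by coordinates. -/
def formalParameters : MvPowerSeries (Fin n) k ≃ₐ[k] AdicCompletion (maximalIdeal O) O :=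
  (AlgEquiv.ofBijective _ (c.completionTaylor_bijective ε)).symm

lemma formalParameters_symm_algebraMap (a : O) :
    (c.formalParameters ε).symm (algebraMap O (AdicCompletion (maximalIdeal O) O) a) =
      c.taylorAt ε a :=
  c.completionTaylor_algebraMap ε a

end TaylorCoords

end DiscriminantVariety
end

noncomputable section
namespace DiscriminantVariety

/-! ## The subschemes `C` and `R` in coordinates -/

section Derivations

variable {k : Type*} [Field k]

/-- A derivation which preserves an ideal induces a derivation of the quotient. -/
lemma exists_derivation_quotient {A : Type*} [CommRing A] [Algebra k A] (I : Ideal A)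
    (D : Derivation k A A) (hD : ∀ a ∈ I, D a ∈ I) :
    ∃ D' : Derivation k (A ⧸ I) (A ⧸ I),
      ∀ a, D' (Ideal.Quotient.mk I a) = Ideal.Quotient.mk I (D a) := by
  let L : (A ⧸ I) →ₗ[k] (A ⧸ I) :=
    Submodule.mapQ (I.restrictScalars k) (I.restrictScalars k) (D : A →ₗ[k] A) hD
  have hL : ∀ a, L (Ideal.Quotient.mk I a) = Ideal.Quotient.mk I (D a) := fun a => rfl
  refine ⟨Derivation.mk' L fun a b => ?_, hL⟩
  obtain ⟨a, rfl⟩ := Ideal.Quotient.mk_surjective a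
  obtain ⟨b, rfl⟩ := Ideal.Quotient.mk_surjective b
  rw [← map_mul, hL, hL, hL, D.leibniz]
  simp [smul_eq_mul]

lemma exists_derivation_quotient_span {A : Type*} [CommRing A] [Algebra k A] (Φ : A)
    (D : Derivation k A A) (hD : D Φ = 0) :
    ∃ D' : Derivation k (A ⧸ Ideal.span {Φ}) (A ⧸ Ideal.span {Φ}),
      ∀ a, D' (Ideal.Quotient.mk _ a) = Ideal.Quotient.mk _ (D a) := by
  refine exists_derivation_quotient _ D fun a ha => ?_
  obtain ⟨b, rfl⟩ := Ideal.mem_span_singleton'.1 ha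
  rw [D.leibniz, hD, smul_zero, zero_add, smul_eq_mul]
  exact Ideal.mul_mem_right _ _ (Ideal.subset_span rfl)

/-- A derivation of the coefficients extends to a localization of a polynomial ring, with
prescribed values on the variables. -/
lemma exists_derivation_localization {O : Type*} [CommRing O] [Algebra k O] {m : ℕ}
    {A : Type*} [CommRing A] [Algebra (MvPolynomial (Fin m) O) A] [Algebra k A]
    [IsScalarTower k (MvPolynomial (Fin m) O) A]
    (M : Submonoid (MvPolynomial (Fin m) O)) [IsLocalization M A]
    (d : Derivation k O O) (β : Fin m → A) :
    ∃ D : Derivation k A A,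
      (∀ a, D (algebraMap (MvPolynomial (Fin m) O) A (MvPolynomial.C a)) =
        algebraMap (MvPolynomial (Fin m) O) A (MvPolynomial.C (d a))) ∧
      ∀ j, D (algebraMap (MvPolynomial (Fin m) O) A (MvPolynomial.X j)) = β j := by
  let ι : O →+* A := (algebraMap (MvPolynomial (Fin m) O) A).comp MvPolynomial.C
  have hι : ∀ c : k, ι (algebraMap k O c) = algebraMap k A c := fun c => by
    rw [IsScalarTower.algebraMap_apply k (MvPolynomial (Fin m) O) A,
      MvPolynomial.algebraMap_apply]
    rfl
  -- A derivation of `A` is a ring homomorphism to the dual numbers over `A` that lifts the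
  -- identity. In this form it extends to polynomials by choosing images of the variables, and to
  -- the localization because an element is a unit as soon as its first component is.
  let h₀ : O →+* TrivSqZeroExt A A :=
    { toFun := fun a => TrivSqZeroExt.inl (ι a) + TrivSqZeroExt.inr (ι (d a))
      map_one' := by simp
      map_zero' := by simp
      map_mul' := fun a b => by
        ext
        · simp
        · simp [mul_comm, add_comm]
      map_add' := fun a b => by
        ext <;> simp }
  let h₁ : MvPolynomial (Fin m) O →+* TrivSqZeroExt A A :=
    MvPolynomial.eval₂Hom h₀ fun j =>
      TrivSqZeroExt.inl (algebraMap (MvPolynomial (Fin m) O) A (MvPolynomial.X j)) + TrivSqZeroExt.inr (β j)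
  have hfst : ∀ p, (h₁ p).fst = algebraMap _ A p := fun p => by
    have : (TrivSqZeroExt.fstHom ℕ A A).toRingHom.comp h₁ =
        algebraMap (MvPolynomial (Fin m) O) A := by
      apply MvPolynomial.ringHom_ext
      · intro a; simp [h₁, h₀, ι]
      · intro j; simp [h₁]
    exact RingHom.congr_fun this p
  have hu : ∀ y : M, IsUnit (h₁ y) := fun y => by
    rw [TrivSqZeroExt.isUnit_iff_isUnit_fst, hfst]
    exact IsLocalization.map_units A y
  let h : A →+* TrivSqZeroExt A A := IsLocalization.lift hu
  have hh : ∀ p, h (algebraMap _ A p) = h₁ p := fun p => IsLocalization.lift_eq hu p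
  have hfst' : ∀ a, (h a).fst = a := fun a => by
    have : (TrivSqZeroExt.fstHom ℕ A A).toRingHom.comp h = RingHom.id A := by
      apply IsLocalization.ringHom_ext M
      ext p
      · simp [hh, hfst]
      · simp [hh, hfst]
    exact RingHom.congr_fun this a
  have hk : ∀ c : k, (h (algebraMap k A c)).snd = 0 := fun c => by
    rw [IsScalarTower.algebraMap_apply k (MvPolynomial (Fin m) O) A,
      MvPolynomial.algebraMap_apply, hh]
    simp [h₁, h₀]
  let L : A →ₗ[k] A :=
    { toFun := fun a => (h a).snd
      map_add' := by simp
      map_smul' := fun c a => by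
        simp [Algebra.smul_def, map_mul, hfst', hk] }
  refine ⟨Derivation.mk' L fun a b => ?_, fun a => ?_, fun j => ?_⟩
  · change (h (a * b)).snd = _
    rw [map_mul, TrivSqZeroExt.snd_mul, hfst', hfst']
    simp [L, mul_comm]
  · change (h _).snd = _
    rw [hh, MvPolynomial.eval₂Hom_C]
    change (TrivSqZeroExt.inl (ι a) + TrivSqZeroExt.inr (ι (d a))).snd = ι (d a)
    rw [TrivSqZeroExt.snd_add, TrivSqZeroExt.snd_inl, TrivSqZeroExt.snd_inr, zero_add]
  · change (h _).snd = _
    rw [hh]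
    simp [h₁]

/-- A derivation is determined by its values on the coordinates. -/
lemma TaylorCoords.derivation_apply {k O B : Type u} [Field k] [CommRing O] [Algebra k O] {n : ℕ}
    (c : TaylorCoords k O n) [CommRing B] [Algebra k B] (ι : O →+* B)
    (hιk : ∀ r : k, ι (algebraMap k O r) = algebraMap k B r) (θ : Derivation k B B) (a : O) :
    θ (ι a) = ∑ l, θ (ι (c.x l)) * ι (c.der l a) := by
  letI : Module O B := Module.compHom _ ι
  have hsm : ∀ (a : O) (b : B), a • b = ι a * b := fun _ _ => rfl
  haveI : IsScalarTower k O B := ⟨fun r a b => by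
    rw [hsm, hsm, Algebra.smul_def, Algebra.smul_def, map_mul, hιk, mul_assoc]⟩
  let δ : Derivation k O B := Derivation.mk'
    { toFun := fun a => θ (ι a)
      map_add' := by simp
      map_smul' := fun r a => by
        rw [Algebra.smul_def, map_mul, hιk, ← Algebra.smul_def, θ.map_smul]
        rfl }
    (fun a b => by
      change θ (ι (a * b)) = ι a * θ (ι b) + ι b * θ (ι a)
      rw [map_mul, Derivation.leibniz]
      rfl)
  let δ' : Derivation k O B := Derivation.mk'
    { toFun := fun a => ∑ l, δ (c.x l) * ι (c.der l a)
      map_add' := by simp [mul_add, Finset.sum_add_distrib]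
      map_smul' := fun r a => by
        rw [RingHom.id_apply, Finset.smul_sum]
        refine Finset.sum_congr rfl fun l _ => ?_
        rw [(c.der l).map_smul, Algebra.smul_def, Algebra.smul_def, map_mul, hιk]
        ring }
    (fun a b => by
      change ∑ l, δ (c.x l) * ι (c.der l (a * b)) = ι a * ∑ l, δ (c.x l) * ι (c.der l b) +
        ι b * ∑ l, δ (c.x l) * ι (c.der l a)
      simp only [Derivation.leibniz, map_add, smul_eq_mul, map_mul, Finset.mul_sum,
        ← Finset.sum_add_distrib]
      refine Finset.sum_congr rfl fun l _ => by ring)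
  have hδ : δ = δ' := c.der_ext' fun l => by
    change δ (c.x l) = ∑ l', δ (c.x l') * ι (c.der l' (c.x l))
    simp [c.der_x, apply_ite]
  exact DFunLike.congr_fun hδ a

/-- Cramer's rule modulo `J`: the determinant kills the vector `v`, one of whose entries is a unit.
-/
lemma det_mem_of_mulVec_mem {B : Type*} [CommRing B] {m : ℕ} (N : Matrix (Fin m) (Fin m) B)
    (J : Ideal B) (v : Fin m → B) (hv : ∀ i, ∑ j, N i j * v j ∈ J) {j₀ : Fin m}
    (hj₀ : IsUnit (v j₀)) : N.det ∈ J := by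
  have hadj : N.det * v j₀ = ∑ i, N.adjugate j₀ i * ∑ j, N i j * v j := by
    have := congrFun (congrArg (Matrix.mulVec · v) (Matrix.adjugate_mul N)) j₀
    simp only [← Matrix.mulVec_mulVec, Matrix.smul_mulVec, Matrix.one_mulVec, Pi.smul_apply,
      smul_eq_mul] at this
    rw [← this]
    rfl
  have hmem : N.det * v j₀ ∈ J := by
    rw [hadj]
    exact Ideal.sum_mem _ fun i _ => Ideal.mul_mem_left _ _ (hv i)
  rw [mul_comm] at hmem
  exact (Ideal.unit_mul_mem_iff_mem _ hj₀).1 hmem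

lemma det_updateCol_smul_one {B : Type*} [CommRing B] {m : ℕ} (u : B) (j₀ : Fin m)
    (v : Fin m → B) :
    ((u • (1 : Matrix (Fin m) (Fin m) B)).updateCol j₀ v).det = u ^ (m - 1) * v j₀ := by
  rw [← Matrix.cramer_apply, Matrix.cramer_eq_adjugate_mulVec, Matrix.adjugate_smul,
    Matrix.adjugate_one, Matrix.smul_mulVec, Matrix.one_mulVec, Pi.smul_apply, smul_eq_mul,
    Fintype.card_fin]

end Derivations

namespace PolarizedVariety

variable {k : Type u} [Field k] {V : PolarizedVariety k} {M : Submodule k V.Sections}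

namespace Frame

variable {m n : ℕ} {P : V.ProdPoint M} (𝔣 : Frame V M m P)

/-- The functions on `X`, as functions on `X × P(M)`. -/
def incl : V.O P.pt →+* 𝔣.LocalRing := (algebraMap 𝔣.Chart 𝔣.LocalRing).comp MvPolynomial.C

/-- The affine coordinates on `P(M)`. -/
def coord (j : Fin m) : 𝔣.LocalRing := algebraMap 𝔣.Chart 𝔣.LocalRing (MvPolynomial.X j)

lemma affineForm_eq (a : Fin (m + 1) → V.O P.pt) :
    𝔣.affineForm a = 𝔣.incl (a 0) + ∑ j : Fin m, 𝔣.incl (a j.succ) * 𝔣.coord j := by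
  simp [affineForm, incl, coord]

lemma incl_algebraMap (c : k) : 𝔣.incl (algebraMap k _ c) = algebraMap k 𝔣.LocalRing c := by
  rw [IsScalarTower.algebraMap_apply k 𝔣.Chart 𝔣.LocalRing, MvPolynomial.algebraMap_apply]
  rfl

lemma affineForm_add (a b : Fin (m + 1) → V.O P.pt) :
    𝔣.affineForm (fun l => a l + b l) = 𝔣.affineForm a + 𝔣.affineForm b := by
  simp only [affineForm_eq, map_add, add_mul, Finset.sum_add_distrib]
  ring

lemma affineForm_mul (g : V.O P.pt) (b : Fin (m + 1) → V.O P.pt) :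
    𝔣.affineForm (fun l => g * b l) = 𝔣.incl g * 𝔣.affineForm b := by
  simp only [affineForm_eq, map_mul, mul_add, Finset.mul_sum, mul_assoc]

lemma affineForm_sum {ι : Type*} (s : Finset ι) (a : ι → Fin (m + 1) → V.O P.pt) :
    𝔣.affineForm (fun l => ∑ i ∈ s, a i l) = ∑ i ∈ s, 𝔣.affineForm (a i) := by
  classical
  induction s using Finset.induction_on with
  | empty => simp [affineForm_eq]
  | insert i s hi ih => simp only [Finset.sum_insert hi, affineForm_add, ih]

lemma derivation_affineForm {N : Type*} [AddCommGroup N] [Module 𝔣.LocalRing N] [Module k N]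
    (D : Derivation k 𝔣.LocalRing N) (a : Fin (m + 1) → V.O P.pt) :
    D (𝔣.affineForm a) = D (𝔣.incl (a 0)) + ∑ j : Fin m, (𝔣.coord j • D (𝔣.incl (a j.succ)) +
      𝔣.incl (a j.succ) • D (𝔣.coord j)) := by
  rw [affineForm_eq, map_add, map_sum]
  congr 1
  refine Finset.sum_congr rfl fun j _ => ?_
  rw [D.leibniz, add_comm]

variable (c : TaylorCoords k (V.O P.pt) n)

/-- The partial derivatives of `Φ` along `X`. -/
def dPhi (i : Fin n) : 𝔣.LocalRing := 𝔣.affineForm fun l => c.der i (𝔣.φ l)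

/-- Applying a vector field θᵢ of D to the relation Φ = 0 and using the chain rule gives ∑ⱼ θᵢ(yⱼ)
φⱼ ∈ (∂Φ). Since some φⱼ is a unit, the determinant of (θᵢ(yⱼ)) lies in this ideal as well. -/
lemma criticalIdeal_le :
    (∃ j₀ : Fin m, IsUnit (𝔣.φ j₀.succ)) →
    𝔣.criticalIdeal ≤ Ideal.span (Set.range fun i => Ideal.Quotient.mk _ (𝔣.dPhi c i)) := by
  rintro ⟨j₀, hj₀⟩
  rw [criticalIdeal, Ideal.span_le]
  rintro _ ⟨θ, rfl⟩
  set J : Ideal 𝔣.LocalRingD := Ideal.span (Set.range fun i => Ideal.Quotient.mk _ (𝔣.dPhi c i))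
    with hJ
  let q : 𝔣.LocalRing →+* 𝔣.LocalRingD := Ideal.Quotient.mk _
  let ι : V.O P.pt →+* 𝔣.LocalRingD := q.comp 𝔣.incl
  set N : Matrix (Fin m) (Fin m) 𝔣.LocalRingD := Matrix.of fun i j => θ i (𝔣.y j) with hN
  have key : ∀ i, ∑ j, N i j * ι (𝔣.φ j.succ) ∈ J := by
    intro i
    have hιk : ∀ r : k, ι (algebraMap k _ r) = algebraMap k 𝔣.LocalRingD r := fun r => by
      change q (𝔣.incl _) = _
      rw [incl_algebraMap]
      rfl
    let δ : V.O P.pt → 𝔣.LocalRingD := fun a => θ i (ι a)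
    have hδ' : ∀ a, θ i (ι a) = ∑ l, δ (c.x l) * ι (c.der l a) :=
      fun a => c.derivation_apply (B := 𝔣.LocalRingD) ι hιk (θ i) a
    have hy : ∀ j, 𝔣.y j = q (𝔣.coord j) := fun j => rfl
    have hΦ : q 𝔣.Phi = 0 := Ideal.Quotient.eq_zero_iff_mem.2 (Ideal.subset_span rfl)
    have h0 : θ i (q 𝔣.Phi) = 0 := by rw [hΦ, map_zero]
    have h1 : θ i (q 𝔣.Phi) = (∑ l, δ (c.x l) * q (𝔣.dPhi c l)) +
        ∑ j, N i j * ι (𝔣.φ j.succ) := by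
      have e (a : Fin (m + 1) → V.O P.pt) : q (𝔣.affineForm a) =
          ι (a 0) + ∑ j : Fin m, ι (a j.succ) * 𝔣.y j := by
        rw [affineForm_eq, map_add, map_sum]
        simp only [map_mul, hy]
        rfl
      have e1 : q 𝔣.Phi = ι (𝔣.φ 0) + ∑ j : Fin m, ι (𝔣.φ j.succ) * 𝔣.y j := e _
      have e2 : ∀ l, q (𝔣.dPhi c l) = ι (c.der l (𝔣.φ 0)) +
          ∑ j : Fin m, ι (c.der l (𝔣.φ j.succ)) * 𝔣.y j := fun l => e _
      rw [e1, map_add, map_sum]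
      simp only [Derivation.leibniz, smul_eq_mul, hδ', e2, mul_add, Finset.sum_add_distrib,
        Finset.mul_sum]
      have e3 : ∀ j, N i j = θ i (𝔣.y j) := fun j => rfl
      simp only [e3]
      rw [Finset.sum_comm (γ := Fin n)]
      have e4 : ∀ j l, 𝔣.y j * (δ (c.x l) * ι (c.der l (𝔣.φ j.succ))) =
        δ (c.x l) * (ι (c.der l (𝔣.φ j.succ)) * 𝔣.y j) := fun j l => by ring
      simp only [e4, mul_comm (θ i (𝔣.y _))]
      ring
    rw [h0] at h1
    have : ∑ j, N i j * ι (𝔣.φ j.succ) = -∑ l, δ (c.x l) * q (𝔣.dPhi c l) := by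
      linear_combination -h1
    rw [this]
    exact neg_mem (Ideal.sum_mem _ fun l _ =>
      Ideal.mul_mem_left _ _ (Ideal.subset_span ⟨l, rfl⟩))
  exact det_mem_of_mulVec_mem N J (fun j => ι (𝔣.φ j.succ)) key (hj₀.map ι)

/-- Suitable vector fields tangent to D realize a unit multiple of ∂ᵢΦ as a maximal minor. -/
lemma mk_dPhi_mem_criticalIdeal (hj : ∃ j₀ : Fin m, IsUnit (𝔣.φ j₀.succ)) (i : Fin n) :
    Ideal.Quotient.mk _ (𝔣.dPhi c i) ∈ 𝔣.criticalIdeal := by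
  obtain ⟨j₀, hj₀⟩ := hj
  let q : 𝔣.LocalRing →+* 𝔣.LocalRingD := Ideal.Quotient.mk _
  have ext : ∀ (d : Derivation k (V.O P.pt) (V.O P.pt)) (β : Fin m → 𝔣.LocalRing),
      (𝔣.affineForm fun l => d (𝔣.φ l)) + ∑ j, 𝔣.incl (𝔣.φ j.succ) * β j = 0 →
      ∃ D : Derivation k 𝔣.LocalRingD 𝔣.LocalRingD, ∀ j, D (𝔣.y j) = q (β j) := by
    intro d β h
    obtain ⟨D, hD1, hD2⟩ := exists_derivation_localization (k := k) (A := 𝔣.LocalRing)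
      𝔣.pointIdeal.primeCompl d β
    obtain ⟨D', hD'⟩ := exists_derivation_quotient_span 𝔣.Phi D (by
      rw [Phi, derivation_affineForm, ← h, affineForm_eq, add_assoc, ← Finset.sum_add_distrib]
      refine congrArg₂ _ (hD1 _) (Finset.sum_congr rfl fun j _ => ?_)
      rw [smul_eq_mul, smul_eq_mul, mul_comm (𝔣.coord j)]
      exact congrArg₂ _ (congrArg₂ _ (hD1 _) rfl) (congrArg₂ _ rfl (hD2 j)))
    exact ⟨D', fun j => (hD' _).trans (congrArg q (hD2 j))⟩
  -- With u = φ_{j₀}, these are the fields u ∂/∂yⱼ - φⱼ ∂/∂y_{j₀} for j ≠ j₀ and u ∂ᵢ - (∂ᵢΦ)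
  -- ∂/∂y_{j₀} for j = j₀, all of which kill Φ. Their values on the coordinates form u times the
  -- identity with column j₀ replaced, of determinant -u^(m-1) ∂ᵢΦ.
  have hex : ∀ j : Fin m, ∃ D : Derivation k 𝔣.LocalRingD 𝔣.LocalRingD, ∀ l,
      D (𝔣.y l) = q (if l = j₀ then (if j = j₀ then -𝔣.dPhi c i else -𝔣.incl (𝔣.φ j.succ))
        else (if j = l then 𝔣.incl (𝔣.φ j₀.succ) else 0)) := by
    intro j
    by_cases h : j = j₀
    · refine ext (𝔣.φ j₀.succ • c.der i) _ ?_
      simp only [Derivation.smul_apply, smul_eq_mul, affineForm_mul, h, if_true]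
      rw [Finset.sum_eq_single j₀]
      · simp only [if_true, dPhi]
        ring
      · intro l _ hl
        rw [if_neg hl, if_neg (Ne.symm hl), mul_zero]
      · simp
    · refine ext 0 _ ?_
      simp only [Derivation.zero_apply, if_neg h]
      have h0 : (𝔣.affineForm fun _ => 0) = 0 := by simp [affineForm_eq]
      rw [h0, zero_add, ← Finset.add_sum_erase _ _ (Finset.mem_univ j₀), if_pos rfl,
        Finset.sum_eq_single j]
      · rw [if_neg h, if_pos rfl]; ring
      · intro l hl hlj
        rw [if_neg (Finset.ne_of_mem_erase hl), if_neg (Ne.symm hlj), mul_zero]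
      · intro h'
        exact absurd (Finset.mem_erase.2 ⟨h, Finset.mem_univ _⟩) h'
  choose D hD using hex
  have hdet : (Matrix.of fun a b => D a (𝔣.y b)) =
      (q (𝔣.incl (𝔣.φ j₀.succ)) • (1 : Matrix (Fin m) (Fin m) 𝔣.LocalRingD)).updateCol j₀
        (fun j => q (if j = j₀ then -𝔣.dPhi c i else -𝔣.incl (𝔣.φ j.succ))) := by
    ext a b
    rw [Matrix.of_apply, hD, Matrix.updateCol_apply]
    split_ifs with h1 h2 h3 <;> simp_all [Matrix.one_apply]
  have hmem : (Matrix.of fun a b => D a (𝔣.y b)).det ∈ 𝔣.criticalIdeal :=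
    Ideal.subset_span ⟨D, rfl⟩
  rw [hdet, det_updateCol_smul_one, if_pos rfl, map_neg] at hmem
  have := (Ideal.unit_mul_mem_iff_mem _ (((hj₀.map 𝔣.incl).map q).pow (m - 1))).1 hmem
  simpa using neg_mem this

/-- The ideal of the critical subscheme is generated by `Φ` and its partial derivatives. -/
theorem idealC_eq (hj : ∃ j₀ : Fin m, IsUnit (𝔣.φ j₀.succ)) :
    𝔣.idealC = Ideal.span {𝔣.Phi} ⊔ Ideal.span (Set.range (𝔣.dPhi c)) := by
  have h : 𝔣.criticalIdeal = (Ideal.span (Set.range (𝔣.dPhi c))).map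
      (Ideal.Quotient.mk (Ideal.span {𝔣.Phi})) := by
    rw [Ideal.map_span, ← Set.range_comp]
    refine le_antisymm (𝔣.criticalIdeal_le c hj) (Ideal.span_le.2 ?_)
    rintro _ ⟨i, rfl⟩
    exact 𝔣.mk_dPhi_mem_criticalIdeal c hj i
  rw [idealC, h, Ideal.comap_map_of_surjective _ Ideal.Quotient.mk_surjective, sup_comm]
  congr 1
  exact Ideal.mk_ker

end Frame

end PolarizedVariety

end DiscriminantVariety
end

/-! ### A lower bound for dimensions, and equations for R -/

noncomputable section
namespace DiscriminantVariety

section Dimension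

open MvPowerSeries

variable {k : Type*} [Field k] {N : ℕ}

/-- The variables with the first `i` of them replaced by zero. -/
def killFirst (k : Type*) [Field k] (N i : ℕ) (j : Fin N) : MvPowerSeries (Fin N) k :=
  if (j : ℕ) < i then 0 else X j

lemma hasSubst_killFirst (i : ℕ) : HasSubst (killFirst k N i) :=
  hasSubst_of_constantCoeff_zero fun j => by unfold killFirst; split_ifs <;> simp

/-- Setting the first `i` variables to zero. -/
def killHom (k : Type*) [Field k] (N i : ℕ) :
    MvPowerSeries (Fin N) k →ₐ[k] MvPowerSeries (Fin N) k :=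
  substAlgHom (hasSubst_killFirst i)

lemma killHom_X (i : ℕ) (j : Fin N) : killHom k N i (X j) = if (j : ℕ) < i then 0 else X j := by
  rw [killHom, coe_substAlgHom, subst_X (hasSubst_killFirst i), killFirst]

instance : IsDomain (MvPowerSeries (Fin N) k) := NoZeroDivisors.to_isDomain _

lemma killHom_killHom {i i' : ℕ} (h : i ≤ i') (F : MvPowerSeries (Fin N) k) :
    killHom k N i' (killHom k N i F) = killHom k N i' F := by
  simp only [killHom, coe_substAlgHom]
  rw [subst_comp_subst_apply (hasSubst_killFirst i) (hasSubst_killFirst i')]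
  congr 1
  ext1 j
  have := killHom_X (k := k) i' j
  rw [killHom, coe_substAlgHom] at this
  unfold killFirst at this ⊢
  split_ifs with h1 h2 h2
  · have h0 := map_zero (killHom k N i')
    rw [killHom, coe_substAlgHom] at h0
    exact h0
  · omega
  · rw [this, if_pos h2]
  · rw [this, if_neg h2]

/-- A ring which dominates a formal power series ring has at least its dimension. -/
theorem le_ringKrullDim_of_powerSeries {A : Type*} [CommRing A]
    (ψ : A →+* MvPowerSeries (Fin N) k) (a : Fin N → A) (h : ∀ i, ψ (a i) = X i) :
    (N : WithBot ℕ∞) ≤ ringKrullDim A := by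
  -- The chain of kernels of ψ followed by setting the first i variables to zero. They are prime
  -- because the power series ring is a domain, and `a i` lies in the next kernel but not in the
  -- present one.
  let f : Fin (N + 1) → PrimeSpectrum A := fun i =>
    ⟨RingHom.ker ((killHom k N i).toRingHom.comp ψ), RingHom.ker_isPrime _⟩
  have hf : StrictMono f := by
    rw [Fin.strictMono_iff_lt_succ]
    intro i
    rw [lt_iff_le_not_ge]
    constructor
    · intro b hb
      have hb' : killHom k N i (ψ b) = 0 := hb
      have := killHom_killHom (Nat.le_succ (i : ℕ)) (ψ b)
      rw [hb', map_zero] at this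
      exact this.symm
    · intro hle
      have h1 : a i ∈ (f i.succ).asIdeal := by
        change killHom k N _ (ψ (a i)) = 0
        rw [h, killHom_X, if_pos (by simp)]
      have h2 : killHom k N i (ψ (a i)) = 0 := hle h1
      rw [h, killHom_X, if_neg (by simp)] at h2
      have := congrArg (coeff (Finsupp.single i 1)) h2
      rw [coeff_index_single_self_X, map_zero] at this
      exact one_ne_zero this
  exact Order.le_krullDim_iff.2 ⟨⟨N, f, fun i => hf (Fin.castSucc_lt_succ)⟩, rfl⟩

end Dimension

lemma pfaffian_sub_mem {R : Type*} [CommRing R] {n : ℕ} (I : Ideal R)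
    {A B : Matrix (Fin n) (Fin n) R} (h : ∀ i j, A i j - B i j ∈ I) :
    pfaffian n A - pfaffian n B ∈ I := by
  rw [← Ideal.Quotient.mk_eq_mk_iff_sub_mem, ← pfaffian_map, ← pfaffian_map]
  congr 1
  ext i j
  exact Ideal.Quotient.mk_eq_mk_iff_sub_mem _ _ |>.2 (h i j)

namespace PolarizedVariety

variable {k : Type u} [Field k] {V : PolarizedVariety k} {M : Submodule k V.Sections}

instance (p : V.X) : IsDomain (V.O p) :=
  haveI := V.isIntegral
  inferInstanceAs (IsDomain (V.X.presheaf.stalk p))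

namespace Frame

variable {m n : ℕ} {P : V.ProdPoint M} (𝔣 : Frame V M m P)

lemma pointIdeal_primeCompl_le : 𝔣.pointIdeal.primeCompl ≤ nonZeroDivisors 𝔣.Chart :=
  𝔣.pointIdeal.primeCompl_le_nonZeroDivisors

instance : IsDomain 𝔣.LocalRing :=
  IsLocalization.isDomain_of_le_nonZeroDivisors _ 𝔣.pointIdeal_primeCompl_le

instance [IsNoetherianRing (V.O P.pt)] : IsNoetherianRing 𝔣.LocalRing :=
  IsLocalization.isNoetherianRing 𝔣.pointIdeal.primeCompl _ inferInstance

lemma notMem_pointIdeal (ε : V.O P.pt →ₐ[k] k) {p : 𝔣.Chart} (hp : p ∈ 𝔣.pointIdeal.primeCompl) :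
    ε (MvPolynomial.constantCoeff p) ≠ 0 := fun h =>
  hp ((TaylorCoords.mem_maximalIdeal_iff ε).2 h)

lemma isUnit_evalPoly (ε : V.O P.pt →ₐ[k] k) (p : 𝔣.pointIdeal.primeCompl) :
    IsUnit (((ε : V.O P.pt →+* k).comp MvPolynomial.constantCoeff) (p : 𝔣.Chart)) :=
  isUnit_iff_ne_zero.2 (𝔣.notMem_pointIdeal ε p.2)

/-- Evaluation at the point `P`. -/
def evalPt (ε : V.O P.pt →ₐ[k] k) : 𝔣.LocalRing →ₐ[k] k :=
  { toRingHom := IsLocalization.lift (M := 𝔣.pointIdeal.primeCompl) (𝔣.isUnit_evalPoly ε)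
    commutes' := fun c => by
      rw [IsScalarTower.algebraMap_apply k 𝔣.Chart 𝔣.LocalRing, MvPolynomial.algebraMap_apply]
      refine (IsLocalization.lift_eq (𝔣.isUnit_evalPoly ε) _).trans ?_
      simp }

variable (ε : V.O P.pt →ₐ[k] k)

lemma evalPt_algebraMap (p : 𝔣.Chart) :
    𝔣.evalPt ε (algebraMap _ _ p) = ε (MvPolynomial.constantCoeff p) :=
  IsLocalization.lift_eq (𝔣.isUnit_evalPoly ε) p

lemma evalPt_incl (a : V.O P.pt) : 𝔣.evalPt ε (𝔣.incl a) = ε a := by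
  refine (𝔣.evalPt_algebraMap ε (MvPolynomial.C a)).trans ?_
  rw [MvPolynomial.constantCoeff_C]

lemma evalPt_coord (j : Fin m) : 𝔣.evalPt ε (𝔣.coord j) = 0 := by
  refine (𝔣.evalPt_algebraMap ε (MvPolynomial.X j)).trans ?_
  rw [MvPolynomial.constantCoeff_X, map_zero]

lemma evalPt_affineForm (a : Fin (m + 1) → V.O P.pt) :
    𝔣.evalPt ε (𝔣.affineForm a) = ε (a 0) := by
  rw [affineForm_eq, map_add, map_sum, evalPt_incl]
  simp [evalPt_coord]

lemma mem_maximalIdeal_iff_evalPt {a : 𝔣.LocalRing} :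
    a ∈ maximalIdeal 𝔣.LocalRing ↔ 𝔣.evalPt ε a = 0 :=
  TaylorCoords.mem_maximalIdeal_iff (𝔣.evalPt ε)

variable (c : TaylorCoords k (V.O P.pt) n)

/-- The universal Hessian in coordinates. -/
def hess : Matrix (Fin n) (Fin n) 𝔣.LocalRing := 𝔣.hessianMatrix c.der

lemma hess_apply (i j : Fin n) :
    𝔣.hess c i j = 𝔣.affineForm fun l => c.der i (c.der j (𝔣.φ l)) := rfl

lemma isAlt_hess [CharP k 2] : IsAlt (𝔣.hess c) := by
  constructor
  · intro i j
    rw [hess_apply, hess_apply]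
    congr 1
    ext l
    exact c.der_comm i j _
  · intro i
    rw [hess_apply]
    have : (fun l => c.der i (c.der i (𝔣.φ l))) = fun _ => 0 := funext fun l =>
      c.der_der_self i _
    rw [this, affineForm_eq]
    simp only [map_zero, zero_mul, Finset.sum_const_zero, add_zero]

instance [CharP k 2] : CharP 𝔣.LocalRing 2 :=
  charP_of_injective_algebraMap (algebraMap k 𝔣.LocalRing).injective 2

lemma derivation_eq_sum (d : Derivation k (V.O P.pt) (V.O P.pt)) (a : V.O P.pt) :
    d a = ∑ l, d (c.x l) * c.der l a :=
  c.derivation_apply (RingHom.id _) (fun _ => rfl) d a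

/-- By the Leibniz rule θᵢθⱼΦ is the bilinear expression in the second derivatives plus ∑ θᵢ(θⱼ x)
∂Φ. The second term vanishes on C, so there the Hessian transforms like a bilinear form. -/
lemma hessianMatrix_sub_mem (θ : Fin n → Derivation k (V.O P.pt) (V.O P.pt)) (i j : Fin n) :
    let g : Matrix (Fin n) (Fin n) 𝔣.LocalRing := Matrix.of fun a b => 𝔣.incl (θ a (c.x b))
    𝔣.hessianMatrix θ i j - (g * 𝔣.hess c * g.transpose) i j ∈
      Ideal.span (Set.range (𝔣.dPhi c)) := by
  intro g
  have h1 : ∀ a, θ i (θ j a) = (∑ x, ∑ y, (θ j (c.x x) * θ i (c.x y)) * c.der y (c.der x a)) +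
      ∑ x, θ i (θ j (c.x x)) * c.der x a := by
    intro a
    rw [derivation_eq_sum c (θ j) a, map_sum, ← Finset.sum_add_distrib]
    refine Finset.sum_congr rfl fun x _ => ?_
    rw [Derivation.leibniz, derivation_eq_sum c (θ i) (c.der x a), smul_eq_mul, smul_eq_mul,
      Finset.mul_sum]
    simp only [mul_assoc]
    ring
  have h2 : 𝔣.hessianMatrix θ i j = (∑ x, ∑ y, 𝔣.incl (θ j (c.x x) * θ i (c.x y)) *
      𝔣.hess c y x) + ∑ x, 𝔣.incl (θ i (θ j (c.x x))) * 𝔣.dPhi c x := by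
    change (𝔣.affineForm fun l => θ i (θ j (𝔣.φ l))) = _
    rw [funext fun l => h1 (𝔣.φ l)]
    simp only [affineForm_add, affineForm_sum, affineForm_mul]
    rfl
  have h3 : (g * 𝔣.hess c * g.transpose) i j =
      ∑ x, ∑ y, 𝔣.incl (θ j (c.x x) * θ i (c.x y)) * 𝔣.hess c y x := by
    simp only [Matrix.mul_apply, Matrix.transpose_apply, Finset.sum_mul]
    refine Finset.sum_congr rfl fun x _ => Finset.sum_congr rfl fun y _ => ?_
    simp only [g, Matrix.of_apply, map_mul]
    ring
  rw [h2, h3, add_sub_cancel_left]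
  exact Ideal.sum_mem _ fun x _ => Ideal.mul_mem_left _ _ (Ideal.subset_span ⟨x, rfl⟩)

/-- The ideal of `R` is generated by `Φ`, its partial derivatives and the Pfaffian. -/
theorem idealR_eq [CharP k 2] (hn : Even n) (hj : ∃ j₀ : Fin m, IsUnit (𝔣.φ j₀.succ)) :
    𝔣.idealR n = Ideal.span (insert 𝔣.Phi (insert (pfaffian n (𝔣.hess c))
      (Set.range (𝔣.dPhi c)))) := by
  have hC := 𝔣.idealC_eq c hj
  have hP : ∀ θ : Fin n → Derivation k (V.O P.pt) (V.O P.pt),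
      pfaffian n (𝔣.hessianMatrix θ) ∈ 𝔣.idealC ⊔ Ideal.span {pfaffian n (𝔣.hess c)} := by
    intro θ
    set g : Matrix (Fin n) (Fin n) 𝔣.LocalRing := Matrix.of fun a b => 𝔣.incl (θ a (c.x b))
    have h1 : pfaffian n (𝔣.hessianMatrix θ) - pfaffian n (g * 𝔣.hess c * g.transpose) ∈
        𝔣.idealC := by
      refine pfaffian_sub_mem _ fun i j => ?_
      rw [hC]
      exact Ideal.mem_sup_right (𝔣.hessianMatrix_sub_mem c θ i j)
    rw [pfaffian_conj hn (𝔣.isAlt_hess c)] at h1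
    have h2 : g.det * pfaffian n (𝔣.hess c) ∈ Ideal.span {pfaffian n (𝔣.hess c)} :=
      Ideal.mul_mem_left _ _ (Ideal.subset_span rfl)
    have h4 := add_mem ((le_sup_left : 𝔣.idealC ≤ 𝔣.idealC ⊔ _) h1)
      ((le_sup_right : _ ≤ 𝔣.idealC ⊔ _) h2)
    rwa [sub_add_cancel] at h4
  have h3 : 𝔣.idealR n = 𝔣.idealC ⊔ Ideal.span {pfaffian n (𝔣.hess c)} := by
    refine le_antisymm (sup_le le_sup_left (Ideal.span_le.2 ?_))
      (sup_le_sup_left (Ideal.span_mono ?_) _)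
    · rintro _ ⟨θ, rfl⟩
      exact hP θ
    · rintro _ rfl
      exact ⟨c.der, rfl⟩
  rw [h3, hC, Ideal.span_insert, Ideal.span_insert, sup_assoc, sup_comm (Ideal.span (Set.range _))]

end Frame

end PolarizedVariety

end DiscriminantVariety
end

/-! ### The points of R and the coordinates at such a point -/

noncomputable section
namespace DiscriminantVariety

section Degenerate

open MvPowerSeries

variable {k : Type*} [Field k] {n : ℕ}

/-- The hypersurface `F = 0` is singular at the origin, with degenerate Hessian. -/
def IsDegenerate (F : MvPowerSeries (Fin n) k) : Prop :=
  F ∈ varIdeal k n ^ 2 ∧ (hessian F).det = 0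

lemma constantCoeff_pderiv {R : Type*} [CommRing R] (i : Fin n) (F : MvPowerSeries (Fin n) R) :
    constantCoeff (MvPowerSeries.pderiv R i F) = coeff (Finsupp.single i 1) F := by
  rw [← coeff_zero_eq_constantCoeff_apply, coeff_pderiv]
  simp

lemma mem_varIdeal_sq_iff {R : Type*} [CommRing R] {F : MvPowerSeries (Fin n) R} :
    F ∈ varIdeal R n ^ 2 ↔
      constantCoeff F = 0 ∧ ∀ i, constantCoeff (MvPowerSeries.pderiv R i F) = 0 := by
  rw [mem_varIdeal_pow]
  constructor
  · intro h
    refine ⟨?_, fun i => ?_⟩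
    · rw [← coeff_zero_eq_constantCoeff_apply]
      exact h 0 (by simp)
    · rw [constantCoeff_pderiv]
      exact h _ (by simp)
  · rintro ⟨h0, h1⟩ α hα
    have : α.degree = 0 ∨ α.degree = 1 := by omega
    rcases this with h | h
    · rw [Finsupp.degree_eq_zero_iff] at h
      rw [h, coeff_zero_eq_constantCoeff_apply, h0]
    · obtain ⟨i, rfl⟩ : ∃ i, α = Finsupp.single i 1 := by
        obtain ⟨i, hi⟩ : ∃ i, α i ≠ 0 := by
          by_contra! h0
          have : α = 0 := Finsupp.ext h0
          rw [this, map_zero] at h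
          exact zero_ne_one h
        have hle : Finsupp.single i 1 ≤ α := Finsupp.single_le_iff.2 (Nat.one_le_iff_ne_zero.2 hi)
        have hd : (α - Finsupp.single i 1).degree = 0 := by
          have := congrArg Finsupp.degree (tsub_add_cancel_of_le hle)
          rw [map_add, Finsupp.degree_single, h] at this
          omega
        rw [Finsupp.degree_eq_zero_iff] at hd
        exact ⟨i, by rw [← tsub_add_cancel_of_le hle, hd, zero_add]⟩
      rw [← constantCoeff_pderiv, h1]

lemma hessian_apply (F : MvPowerSeries (Fin n) k) (i j : Fin n) :
    hessian F i j = constantCoeff (MvPowerSeries.pderiv k i (MvPowerSeries.pderiv k j F)) := rfl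

/-- At a singular point the terms of the product rule that involve F or its first derivatives
vanish. Hence the choice of the local equation only scales the Hessian. -/
lemma hessian_mul {F : MvPowerSeries (Fin n) k} (hF : F ∈ varIdeal k n ^ 2)
    (G : MvPowerSeries (Fin n) k) : hessian (G * F) = constantCoeff G • hessian F := by
  rw [mem_varIdeal_sq_iff] at hF
  ext i j
  rw [Matrix.smul_apply, hessian_apply, hessian_apply]
  simp only [Derivation.leibniz, map_add, smul_eq_mul, map_mul, hF.1, hF.2]
  ring

lemma IsDegenerate.mul {F : MvPowerSeries (Fin n) k} (hF : IsDegenerate F)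
    (G : MvPowerSeries (Fin n) k) : IsDegenerate (G * F) := by
  refine ⟨Ideal.mul_mem_left _ _ hF.1, ?_⟩
  rw [hessian_mul hF.1, Matrix.det_smul, hF.2, mul_zero]

lemma isDegenerate_mul_iff {F G : MvPowerSeries (Fin n) k} (hG : constantCoeff G ≠ 0) :
    IsDegenerate (G * F) ↔ IsDegenerate F := by
  refine ⟨fun h => ?_, fun h => h.mul G⟩
  have := h.mul G⁻¹
  rwa [← mul_assoc, MvPowerSeries.inv_mul_cancel _ hG, one_mul] at this

end Degenerate

namespace TaylorCoords

open MvPowerSeries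

variable {k O : Type u} [Field k] [CommRing O] [Algebra k O] {n : ℕ}
  (c : TaylorCoords k O n) (ε : O →ₐ[k] k)

lemma constantCoeff_pderiv_taylorAt (i : Fin n) (a : O) :
    constantCoeff (MvPowerSeries.pderiv k i (c.taylorAt ε a)) = ε (c.der i a) := by
  rw [← taylorAt_der, constantCoeff_taylorAt]

lemma hessian_taylorAt (i j : Fin n) (a : O) :
    hessian (c.taylorAt ε a) i j = ε (c.der i (c.der j a)) := by
  rw [hessian_apply, ← taylorAt_der, ← taylorAt_der, constantCoeff_taylorAt]

end TaylorCoords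

section Hessian

variable {k : Type*} [Field k] {n : ℕ}

lemma pderiv_pderiv_comm (i j : Fin n) (F : MvPowerSeries (Fin n) k) :
    MvPowerSeries.pderiv k i (MvPowerSeries.pderiv k j F) =
      MvPowerSeries.pderiv k j (MvPowerSeries.pderiv k i F) := by
  ext α
  simp only [MvPowerSeries.coeff_pderiv]
  rcases eq_or_ne i j with rfl | h
  · rfl
  · rw [add_right_comm α]
    simp [Finsupp.single_apply, h, h.symm]
    ring

lemma isAlt_hessian [CharP k 2] (F : MvPowerSeries (Fin n) k) : IsAlt (hessian F) := by
  refine ⟨fun i j => ?_, fun i => ?_⟩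
  · rw [hessian_apply, hessian_apply, pderiv_pderiv_comm]
  · rw [hessian_apply, constantCoeff_pderiv, MvPowerSeries.coeff_pderiv]
    simp [one_add_one_eq_two, CharTwo.two_eq_zero]

end Hessian

namespace PolarizedVariety

variable {k : Type u} [Field k] {V : PolarizedVariety k} {M : Submodule k V.Sections}

namespace Frame

variable {m n : ℕ} {P : V.ProdPoint M} (𝔣 : Frame V M m P)
  (c : TaylorCoords k (V.O P.pt) n) (ε : V.O P.pt →ₐ[k] k)

lemma span_Phi_le_idealC : 𝔣.Phi ∈ 𝔣.idealC := by
  have h : Ideal.Quotient.mk (Ideal.span {𝔣.Phi}) 𝔣.Phi = 0 :=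
    Ideal.Quotient.eq_zero_iff_mem.2 (Ideal.subset_span rfl)
  rw [idealC, Ideal.mem_comap, h]
  exact zero_mem _

lemma map_hess_evalPt :
    (𝔣.hess c).map (𝔣.evalPt ε : 𝔣.LocalRing →+* k) = hessian (c.taylorAt ε (𝔣.φ 0)) := by
  ext i j
  rw [Matrix.map_apply, hess_apply, TaylorCoords.hessian_taylorAt]
  exact 𝔣.evalPt_affineForm ε _

/-- The points of `R`. -/
theorem idealR_ne_top_iff [CharP k 2] (hn : Even n) (hφ : ∃ l, IsUnit (𝔣.φ l)) :
    𝔣.idealR n ≠ ⊤ ↔ IsDegenerate (c.taylorAt ε (𝔣.φ 0)) := by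
  have hunit : ∀ {a : V.O P.pt}, IsUnit a ↔ ε a ≠ 0 := fun {a} => by
    rw [← notMem_maximalIdeal, TaylorCoords.mem_maximalIdeal_iff ε]
  -- If f does not vanish at p, then P is not even on D and both sides fail. Otherwise the unit
  -- among the φ has positive index, which is what the formula for the ideal of R requires.
  by_cases h0 : ε (𝔣.φ 0) = 0
  · have hj : ∃ j₀ : Fin m, IsUnit (𝔣.φ j₀.succ) := by
      obtain ⟨l, hl⟩ := hφ
      rcases Fin.eq_zero_or_eq_succ l with rfl | ⟨j, rfl⟩
      · exact absurd h0 (hunit.1 hl)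
      · exact ⟨j, hl⟩
    have hPf : 𝔣.evalPt ε (pfaffian n (𝔣.hess c)) =
        pfaffian n (hessian (c.taylorAt ε (𝔣.φ 0))) := by
      rw [← map_hess_evalPt]
      exact (pfaffian_map (𝔣.evalPt ε : 𝔣.LocalRing →+* k) _).symm
    have hle : 𝔣.idealR n ≠ ⊤ ↔ 𝔣.idealR n ≤ maximalIdeal 𝔣.LocalRing :=
      ⟨IsLocalRing.le_maximalIdeal, fun h h' => (maximalIdeal.isMaximal _).ne_top
        (top_le_iff.1 (h' ▸ h))⟩
    rw [hle, 𝔣.idealR_eq c hn hj, Ideal.span_le, Set.insert_subset_iff, Set.insert_subset_iff,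
      Set.range_subset_iff]
    simp only [SetLike.mem_coe, 𝔣.mem_maximalIdeal_iff_evalPt ε, hPf,
      pfaffian_eq_zero_iff hn (isAlt_hessian _), IsDegenerate, mem_varIdeal_sq_iff,
      TaylorCoords.constantCoeff_taylorAt, TaylorCoords.constantCoeff_pderiv_taylorAt]
    have h1 : 𝔣.evalPt ε 𝔣.Phi = ε (𝔣.φ 0) := 𝔣.evalPt_affineForm ε _
    have h2 : ∀ i, 𝔣.evalPt ε (𝔣.dPhi c i) = ε (c.der i (𝔣.φ 0)) := fun i =>
      𝔣.evalPt_affineForm ε _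
    simp only [h1, h2]
    tauto
  · constructor
    · intro h
      refine absurd (Ideal.eq_top_of_isUnit_mem _
        ((le_sup_left : 𝔣.idealC ≤ 𝔣.idealR n) 𝔣.span_Phi_le_idealC) ?_) h
      rw [← notMem_maximalIdeal, 𝔣.mem_maximalIdeal_iff_evalPt ε]
      exact fun h' => h0 ((𝔣.evalPt_affineForm ε _).symm.trans h')
    · rintro ⟨h, -⟩
      rw [mem_varIdeal_sq_iff, TaylorCoords.constantCoeff_taylorAt] at h
      exact absurd h.1 h0

/-- The homomorphism to formal power series given by the coordinates on `X × P(M)`. -/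
lemma exists_toPowerSeries : ∃ ψ : 𝔣.LocalRing →+* MvPowerSeries (Fin (n + m)) k,
    (∀ i, ψ (𝔣.incl (c.centered ε i)) = MvPowerSeries.X (Fin.castAdd m i)) ∧
    ∀ j, ψ (𝔣.coord j) = MvPowerSeries.X (Fin.natAdd n j) := by
  let ψ₀ : V.O P.pt →+* MvPowerSeries (Fin (n + m)) k :=
    (MvPowerSeries.rename (Fin.castAdd m) : MvPowerSeries (Fin n) k →ₐ[k] _).toRingHom.comp
      (c.taylorAt ε).toRingHom
  let ψ₁ : 𝔣.Chart →+* MvPowerSeries (Fin (n + m)) k :=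
    MvPolynomial.eval₂Hom ψ₀ fun j => MvPowerSeries.X (Fin.natAdd n j)
  have hψ₀ : ∀ a, MvPowerSeries.constantCoeff (ψ₀ a) = ε a := fun a => by
    change MvPowerSeries.constantCoeff (MvPowerSeries.rename (Fin.castAdd m) (c.taylorAt ε a)) = _
    rw [MvPowerSeries.constantCoeff_rename, TaylorCoords.constantCoeff_taylorAt]
  have hψ₁ : ∀ p, MvPowerSeries.constantCoeff (ψ₁ p) = ε (MvPolynomial.constantCoeff p) := by
    intro p
    have : (MvPowerSeries.constantCoeff).comp ψ₁ =
        ((ε : V.O P.pt →+* k).comp MvPolynomial.constantCoeff) := by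
      apply MvPolynomial.ringHom_ext
      · intro a
        rw [RingHom.comp_apply, MvPolynomial.eval₂Hom_C, hψ₀]
        simp
      · intro j
        simp [ψ₁]
    exact RingHom.congr_fun this p
  have hu : ∀ p : 𝔣.pointIdeal.primeCompl, IsUnit (ψ₁ p) := fun p => by
    rw [MvPowerSeries.isUnit_iff_constantCoeff, hψ₁]
    exact isUnit_iff_ne_zero.2 (𝔣.notMem_pointIdeal ε p.2)
  refine ⟨IsLocalization.lift hu, fun i => ?_, fun j => ?_⟩
  · refine (IsLocalization.lift_eq hu (MvPolynomial.C (c.centered ε i))).trans ?_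
    rw [MvPolynomial.eval₂Hom_C]
    change MvPowerSeries.rename (Fin.castAdd m) (c.taylorAt ε _) = _
    rw [TaylorCoords.taylorAt_centered, MvPowerSeries.rename_X]
  · refine (IsLocalization.lift_eq hu (MvPolynomial.X j)).trans ?_
    exact MvPolynomial.eval₂Hom_X' _ _ _

lemma le_ringKrullDim_localRing (c : TaylorCoords k (V.O P.pt) n) (ε : V.O P.pt →ₐ[k] k) :
    ((n + m : ℕ) : WithBot ℕ∞) ≤ ringKrullDim 𝔣.LocalRing := by
  obtain ⟨ψ, h1, h2⟩ := 𝔣.exists_toPowerSeries c ε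
  refine le_ringKrullDim_of_powerSeries ψ
    (Fin.addCases (fun i => 𝔣.incl (c.centered ε i)) 𝔣.coord) fun i => ?_
  refine Fin.addCases (fun i => ?_) (fun j => ?_) i
  · rw [Fin.addCases_left, h1]
  · rw [Fin.addCases_right, h2]

variable [IsNoetherianRing (V.O P.pt)]

lemma maximalIdeal_le_span :
    maximalIdeal 𝔣.LocalRing ≤
      Ideal.span (Set.range (fun i => 𝔣.incl (c.centered ε i)) ∪ Set.range 𝔣.coord) := by
  rw [← Localization.AtPrime.map_eq_maximalIdeal (I := 𝔣.pointIdeal), Ideal.map_le_iff_le_comap]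
  set K := Ideal.span (Set.range (fun i => 𝔣.incl (c.centered ε i)) ∪ Set.range 𝔣.coord)
  intro p hp
  have hincl : ∀ a ∈ maximalIdeal (V.O P.pt), 𝔣.incl a ∈ K := by
    have : maximalIdeal (V.O P.pt) ≤ K.comap 𝔣.incl := by
      rw [c.maximalIdeal_eq ε, Ideal.span_le]
      rintro _ ⟨i, rfl⟩
      exact Ideal.subset_span (Or.inl ⟨i, rfl⟩)
    exact this
  have hX : ∀ q : 𝔣.Chart, algebraMap _ 𝔣.LocalRing q -
      𝔣.incl (MvPolynomial.constantCoeff q) ∈ K := by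
    intro q
    induction q using MvPolynomial.induction_on with
    | C a => rw [MvPolynomial.constantCoeff_C]; simp [incl]
    | add p q hp hq =>
      rw [map_add, map_add, map_add, add_sub_add_comm]
      exact add_mem hp hq
    | mul_X p j _ =>
      rw [map_mul, map_mul, MvPolynomial.constantCoeff_X, mul_zero, map_zero, sub_zero]
      exact Ideal.mul_mem_left _ _ (Ideal.subset_span (Or.inr ⟨j, rfl⟩))
  have := add_mem (hX p) (hincl _ hp)
  rwa [sub_add_cancel] at this

end Frame

end PolarizedVariety

end DiscriminantVariety
end

/-! ### Regularity of the local ring of R -/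

noncomputable section
namespace DiscriminantVariety

section Pencil

open Polynomial

variable {k : Type*} [Field k] [CharP k 2] {r : ℕ}

/-- The alternating matrix with a single block in the lower right corner. -/
def cornerMatrix (R : Type*) [CommRing R] (r : ℕ) : Matrix (Fin (r + 2)) (Fin (r + 2)) R :=
  Matrix.of fun i j => if (i = Fin.natAdd r 0 ∧ j = Fin.natAdd r 1) ∨
    (i = Fin.natAdd r 1 ∧ j = Fin.natAdd r 0) then 1 else 0

lemma isAlt_cornerMatrix (R : Type*) [CommRing R] : IsAlt (cornerMatrix R r) := by
  refine ⟨fun i j => ?_, fun i => ?_⟩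
  · simp only [cornerMatrix, Matrix.of_apply]
    congr 1
    exact propext ⟨by tauto, by tauto⟩
  · rw [cornerMatrix, Matrix.of_apply, if_neg]
    rintro (⟨h1, h2⟩ | ⟨h1, h2⟩) <;>
      exact absurd ((Fin.natAdd_injective _ r).eq_iff.1 (h1.symm.trans h2)) (by decide)

/-- If the upper left block of a degenerate alternating matrix `H` is invertible, the Pfaffian of
`H + y E` is a nonzero multiple of `y`. -/
lemma exists_mul_eq_zero_of_pfaffian (hr : Even r) {H : Matrix (Fin (r + 2)) (Fin (r + 2)) k}
    (hH : IsAlt H) (hB : (blockB H).det ≠ 0) (hd : H.det = 0) {Q : Type*} [CommRing Q]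
    [Algebra k Q] (y : Q) (h : pfaffian (r + 2)
      (Matrix.of fun i j => algebraMap k Q (H i j) + algebraMap k Q (cornerMatrix k r i j) * y) = 0) :
    y = 0 := by
  -- The generic member of the pencil lives over the domain k[X], where the Schur formula for the
  -- Pfaffian is available: the Schur complement is 0 + X, so Pf(A) = Pf(B) X. Substituting y for X
  -- gives the claim in any algebra.
  let A : Matrix (Fin (r + 2)) (Fin (r + 2)) k[X] :=
    Matrix.of fun i j => C (H i j) + C (cornerMatrix k r i j) * X
  have hA : IsAlt A := ⟨fun i j => by simp [A, hH.1 i j, (isAlt_cornerMatrix k).1 i j],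
    fun i => by simp [A, hH.2 i, (isAlt_cornerMatrix k).2 i]⟩
  have hne : ∀ (i : Fin r) (a : Fin 2), Fin.castAdd 2 i ≠ Fin.natAdd r a := fun i a h => by
    have := congrArg Fin.val h
    simp at this
    omega
  have hBA : blockB A = (blockB H).map C := by
    ext i j : 2
    simp [blockB, A, cornerMatrix, hne]
  have hCA : blockC A = (blockC H).map C := by
    ext i j : 2
    simp [blockC, A, cornerMatrix, hne]
  have hBdet : (blockB A).det = C (blockB H).det := by
    rw [hBA]; exact (RingHom.map_det C _).symm
  have hBu : IsUnit (blockB A).det := by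
    rw [hBdet]; exact (isUnit_iff_ne_zero.2 hB).map C
  have hBi : (blockB A)⁻¹ = ((blockB H)⁻¹).map C := by
    apply Matrix.inv_eq_right_inv
    rw [hBA, ← Matrix.map_mul, Matrix.mul_nonsing_inv _ (isUnit_iff_ne_zero.2 hB)]
    simp
  have hs : schur A 0 1 = X := by
    have h0 := congrFun (congrFun (schur_eq_zero hH hB hd) 0) 1
    have h1 : schur A 0 1 = C (schur H 0 1) + X := by
      simp only [schur, hCA, hBi, ← Matrix.transpose_map, ← Matrix.map_mul, Matrix.sub_apply,
        Matrix.map_apply, map_sub]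
      have : blockD A 0 1 = C (blockD H 0 1) + X := by
        simp [blockD, A, cornerMatrix]
      rw [this]
      ring
    rw [h1, h0]
    simp
  have hPf := pfaffian_eq_schur hr hA hBu
  rw [hs] at hPf
  let f : k[X] →+* Q := (aeval y : k[X] →ₐ[k] Q).toRingHom
  have hfC : ∀ a : k, f (C a) = algebraMap k Q a := fun a => aeval_C y a
  have hfX : f X = y := aeval_X y
  have hAf : A.map f = Matrix.of fun i j =>
      algebraMap k Q (H i j) + algebraMap k Q (cornerMatrix k r i j) * y := by
    ext i j
    simp only [A, Matrix.map_apply, Matrix.of_apply, map_add, map_mul, hfC, hfX]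
  rw [← hAf, pfaffian_map, hPf, hBA, pfaffian_map, map_mul, hfC, hfX] at h
  have hne' : pfaffian r (blockB H) ≠ 0 := fun h' =>
    hB ((pfaffian_eq_zero_iff hr (hH.submatrix _ : IsAlt (blockB H))).1 h')
  exact (((isUnit_iff_ne_zero.2 hne').map (algebraMap k Q)).mul_right_eq_zero).1 h

lemma mem_of_pfaffian_mem (hr : Even r) {H : Matrix (Fin (r + 2)) (Fin (r + 2)) k}
    (hH : IsAlt H) (hB : (blockB H).det ≠ 0) (hd : H.det = 0) {A : Type*} [CommRing A]
    [Algebra k A] (K : Ideal A) (N : Matrix (Fin (r + 2)) (Fin (r + 2)) A) (y : A)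
    (hN : ∀ i j, N i j - (algebraMap k A (H i j) + algebraMap k A (cornerMatrix k r i j) * y) ∈ K)
    (hp : pfaffian (r + 2) N ∈ K) : y ∈ K := by
  rw [← Ideal.Quotient.eq_zero_iff_mem]
  refine exists_mul_eq_zero_of_pfaffian hr hH hB hd _ ?_
  rw [← Ideal.Quotient.eq_zero_iff_mem, ← pfaffian_map] at hp
  rw [← hp]
  congr 1
  ext i j
  rw [Matrix.map_apply, ← sub_eq_zero, ← neg_eq_zero, neg_sub]
  exact Ideal.Quotient.eq_zero_iff_mem.2 (hN i j)

end Pencil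

/-- A criterion for a quotient of a local ring to be regular. -/
lemma isRegularLocalRing_quotient {A : Type*} [CommRing A] [IsLocalRing A] [IsNoetherianRing A]
    {J : Ideal A} (hne : J ≠ ⊤) {s : Finset A} (hs : J = Ideal.span (s : Set A)) {e : ℕ}
    (hsc : s.card ≤ e) {S : Set A} (hfin : S.Finite) {d : ℕ} (hcard : S.ncard ≤ d)
    (hS : S ⊆ maximalIdeal A) (hmax : maximalIdeal A ≤ J ⊔ Ideal.span S)
    (hd : ((d + e : ℕ) : WithBot ℕ∞) ≤ ringKrullDim A) :
    IsRegularLocalRing (A ⧸ J) ∧ ringKrullDim (A ⧸ J) = (d : WithBot ℕ∞) := by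
  haveI : Nontrivial (A ⧸ J) := Ideal.Quotient.nontrivial_iff.2 hne
  have hsurj : Function.Surjective (Ideal.Quotient.mk J) := Ideal.Quotient.mk_surjective
  haveI : IsLocalRing (A ⧸ J) := IsLocalRing.of_surjective' _ hsurj
  have hmax' : maximalIdeal (A ⧸ J) = Ideal.span (Ideal.Quotient.mk J '' S) := by
    rw [← map_maximalIdeal_of_surjective _ hsurj]
    apply le_antisymm
    · refine (Ideal.map_mono hmax).trans ?_
      rw [Ideal.map_sup, Ideal.map_quotient_self, bot_sup_eq, Ideal.map_span]
    · rw [← Ideal.map_span]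
      exact Ideal.map_mono (Ideal.span_le.2 hS)
  -- The embedding dimension is at most d because S generates the maximal ideal. The dimension is at
  -- least d because e equations lower it by at most e. Together they give regularity of dimension
  -- d.
  have hrank : (maximalIdeal (A ⧸ J)).spanFinrank ≤ d := by
    rw [hmax']
    exact (Submodule.spanFinrank_span_le_ncard_of_finite (hfin.image _)).trans
      ((Set.ncard_image_le hfin).trans hcard)
  have hdim : (d : WithBot ℕ∞) ≤ ringKrullDim (A ⧸ J) := by
    have h2 := ringKrullDim_le_ringKrullDim_quotient_add_card s (by
      intro a ha
      have : a ∈ maximalIdeal A := IsLocalRing.le_maximalIdeal hne (hs ▸ Ideal.subset_span ha)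
      rwa [← IsLocalRing.ringJacobson_eq_maximalIdeal] at this)
    rw [← hs] at h2
    have h3 := hd.trans h2
    have h4 : (d : WithBot ℕ∞) + (e : WithBot ℕ∞) ≤
        ringKrullDim (A ⧸ J) + (e : WithBot ℕ∞) := by
      rw [← Nat.cast_add]
      exact h3.trans (by gcongr)
    exact ENat.WithBot.add_le_add_natCast_right_iff.1 h4
  have hle := ringKrullDim_le_spanFinrank_maximalIdeal (A ⧸ J)
  have hle' : ((maximalIdeal (A ⧸ J)).spanFinrank : WithBot ℕ∞) ≤ (d : WithBot ℕ∞) := by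
    exact_mod_cast hrank
  exact ⟨IsRegularLocalRing.of_spanFinrank_maximalIdeal_le _ (hle'.trans hdim),
    le_antisymm (hle.trans hle') hdim⟩

namespace PolarizedVariety

variable {k : Type u} [Field k] {V : PolarizedVariety k} {M : Submodule k V.Sections}

namespace Frame

variable {m n r : ℕ} {P : V.ProdPoint M} (𝔣 : Frame V M m P)

/-- Some of the local expressions of the members of the basis have prescribed 2-jets: `xᵢ` in
position `ι (inl i)`, `1` in position `ι (inr 0)`, and `x_{r+1} x_{r+2}` in position `ι (inr 1)`. -/
structure IsAdapted (c : TaylorCoords k (V.O P.pt) (r + 2)) (ε : V.O P.pt →ₐ[k] k)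
    (ι : Fin (r + 2) ⊕ Fin 2 → Fin m) : Prop where
  injective : Function.Injective ι
  val_x : ∀ i, ε (𝔣.φ (ι (Sum.inl i)).succ) = 0
  der_x : ∀ i l, ε (c.der l (𝔣.φ (ι (Sum.inl i)).succ)) = if l = i then 1 else 0
  val_one : ε (𝔣.φ (ι (Sum.inr 0)).succ) = 1
  der_one : ∀ l, ε (c.der l (𝔣.φ (ι (Sum.inr 0)).succ)) = 0
  val_q : ε (𝔣.φ (ι (Sum.inr 1)).succ) = 0
  der_q : ∀ l, ε (c.der l (𝔣.φ (ι (Sum.inr 1)).succ)) = 0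
  hess_q : ∀ i j, ε (c.der i (c.der j (𝔣.φ (ι (Sum.inr 1)).succ))) = cornerMatrix k r i j

variable {𝔣} {c : TaylorCoords k (V.O P.pt) (r + 2)} {ε : V.O P.pt →ₐ[k] k}
  {ι : Fin (r + 2) ⊕ Fin 2 → Fin m}

/-- The parameters of `R`. -/
def paramSet (𝔣 : Frame V M m P) (c : TaylorCoords k (V.O P.pt) n) (ε : V.O P.pt →ₐ[k] k)
    {κ : Type*} (ι : κ → Fin m) : Set 𝔣.LocalRing :=
  Set.range (fun i => 𝔣.incl (c.centered ε i)) ∪ 𝔣.coord '' (Set.range ι)ᶜ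

lemma IsAdapted.isUnit (h : 𝔣.IsAdapted c ε ι) : IsUnit (𝔣.φ (ι (Sum.inr 0)).succ) := by
  rw [← notMem_maximalIdeal, TaylorCoords.mem_maximalIdeal_iff ε, h.val_one]
  exact one_ne_zero

variable [IsNoetherianRing (V.O P.pt)] [CharP k 2]

/-- Modulo the parameters, functions on X become constants and only the coordinates of the adapted
sections survive. Then Φ becomes the coordinate of the section 1, ∂ᵢΦ becomes the coordinate of the
section xᵢ, and the Pfaffian forces the coordinate of the section ξ₁ξ₂ to vanish. -/
theorem IsAdapted.maximalIdeal_le (hr : Even r) (h : 𝔣.IsAdapted c ε ι)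
    (hdeg : IsDegenerate (c.taylorAt ε (𝔣.φ 0)))
    (hB : (blockB (hessian (c.taylorAt ε (𝔣.φ 0)))).det ≠ 0) :
    maximalIdeal 𝔣.LocalRing ≤ 𝔣.idealR (r + 2) ⊔ Ideal.span (𝔣.paramSet c ε ι) := by
  set K := 𝔣.idealR (r + 2) ⊔ Ideal.span (𝔣.paramSet c ε ι) with hK
  have hR := 𝔣.idealR_eq c (hr.add even_two) ⟨_, h.isUnit⟩
  let q : 𝔣.LocalRing →ₐ[k] 𝔣.LocalRing ⧸ K := Ideal.Quotient.mkₐ k K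
  have hq0 : ∀ {a}, q a = 0 ↔ a ∈ K := Ideal.Quotient.eq_zero_iff_mem
  have hqR : ∀ {a}, a ∈ 𝔣.idealR (r + 2) → q a = 0 := fun ha =>
    hq0.2 ((le_sup_left : _ ≤ K) ha)
  have hqS : ∀ {a}, a ∈ 𝔣.paramSet c ε ι → q a = 0 := fun ha =>
    hq0.2 ((le_sup_right : _ ≤ K) (Ideal.subset_span ha))
  have hqx : ∀ i, q (𝔣.incl (c.centered ε i)) = 0 := fun i => hqS (Or.inl ⟨i, rfl⟩)
  have hqo : ∀ j, j ∉ Set.range ι → q (𝔣.coord j) = 0 := fun j hj => hqS (Or.inr ⟨j, hj, rfl⟩)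
  have hqa : ∀ a, q (𝔣.incl a) = algebraMap k _ (ε a) := by
    intro a
    have hle : maximalIdeal (V.O P.pt) ≤ K.comap 𝔣.incl := by
      rw [c.maximalIdeal_eq ε, Ideal.span_le]
      rintro _ ⟨i, rfl⟩
      exact hq0.1 (hqx i)
    have h1 : a - algebraMap k _ (ε a) ∈ maximalIdeal (V.O P.pt) :=
      (TaylorCoords.mem_maximalIdeal_iff ε).2 (by simp)
    have h2 : q (𝔣.incl (a - algebraMap k _ (ε a))) = 0 := hq0.2 (hle h1)
    rw [map_sub, map_sub, incl_algebraMap, AlgHom.commutes, sub_eq_zero] at h2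
    exact h2
  have hqf : ∀ a : Fin (m + 1) → V.O P.pt, q (𝔣.affineForm a) = algebraMap k _ (ε (a 0)) +
      ∑ s, algebraMap k _ (ε (a (ι s).succ)) * q (𝔣.coord (ι s)) := by
    intro a
    rw [affineForm_eq, map_add, map_sum, hqa]
    congr 1
    simp only [map_mul, hqa]
    rw [← Finset.sum_image (s := Finset.univ) (g := ι)
      (f := fun j => algebraMap k (𝔣.LocalRing ⧸ K) (ε (a j.succ)) * q (𝔣.coord j))
      (fun s _ s' _ hs => h.injective hs)]
    refine (Finset.sum_subset (Finset.subset_univ _) fun j _ hj => ?_).symm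
    rw [hqo j (fun ⟨s, hs⟩ => hj (Finset.mem_image.2 ⟨s, Finset.mem_univ _, hs⟩)), mul_zero]
  rw [IsDegenerate, mem_varIdeal_sq_iff] at hdeg
  obtain ⟨⟨hd0, hd1⟩, hd2⟩ := hdeg
  rw [TaylorCoords.constantCoeff_taylorAt] at hd0
  simp only [TaylorCoords.constantCoeff_pderiv_taylorAt] at hd1
  have hy1 : q (𝔣.coord (ι (Sum.inr 0))) = 0 := by
    have h1 : q 𝔣.Phi = 0 := hqR (hR ▸ Ideal.subset_span (Or.inl rfl))
    have h2 := (hqf 𝔣.φ).symm.trans h1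
    simpa [hd0, h.val_x, h.val_one, h.val_q] using h2
  have hyx : ∀ i, q (𝔣.coord (ι (Sum.inl i))) = 0 := by
    intro i
    have h1 : q (𝔣.dPhi c i) = 0 :=
      hqR (hR ▸ Ideal.subset_span (Or.inr (Or.inr ⟨i, rfl⟩)))
    have h2 := (hqf fun l => c.der i (𝔣.φ l)).symm.trans h1
    simpa [hd1, h.der_x, h.der_one, h.der_q, apply_ite] using h2
  -- The other coordinates must be eliminated first: an adapted frame does not prescribe the second
  -- derivatives of the sections 1 and xᵢ. After that the Hessian is exactly H + yE.
  have hyq : q (𝔣.coord (ι (Sum.inr 1))) = 0 := by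
    refine hq0.2 (mem_of_pfaffian_mem hr (isAlt_hessian (c.taylorAt ε (𝔣.φ 0))) hB hd2 K
      (𝔣.hess c) _ (fun i j => hq0.1 ?_)
      ((le_sup_left : _ ≤ K) (hR ▸ Ideal.subset_span (Or.inr (Or.inl rfl)))))
    rw [map_sub, sub_eq_zero, hess_apply]
    refine (hqf _).trans ?_
    rw [map_add, map_mul, AlgHom.commutes, AlgHom.commutes]
    simp [h.hess_q, hyx, hy1, TaylorCoords.hessian_taylorAt]
  refine (𝔣.maximalIdeal_le_span c ε).trans (Ideal.span_le.2 ?_)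
  rintro _ (⟨i, rfl⟩ | ⟨j, rfl⟩)
  · exact hq0.1 (hqx i)
  · apply hq0.1
    by_cases hj : j ∈ Set.range ι
    · obtain ⟨s, rfl⟩ := hj
      rcases s with i | a
      · exact hyx i
      · fin_cases a
        · exact hy1
        · exact hyq
    · exact hqo j hj

/-- The count: r + 4 equations in a local ring of dimension at least r + 2 + m, and (r + 2) + (m -
(r + 4)) = m - 2 parameters. -/
theorem IsAdapted.isRegularLocalRing (hr : Even r) (h : 𝔣.IsAdapted c ε ι)
    (hdeg : IsDegenerate (c.taylorAt ε (𝔣.φ 0)))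
    (hB : (blockB (hessian (c.taylorAt ε (𝔣.φ 0)))).det ≠ 0) :
    IsRegularLocalRing (𝔣.LocalRing ⧸ 𝔣.idealR (r + 2)) ∧
      ringKrullDim (𝔣.LocalRing ⧸ 𝔣.idealR (r + 2)) = ((m - 2 : ℕ) : WithBot ℕ∞) := by
  classical
  have hne : 𝔣.idealR (r + 2) ≠ ⊤ :=
    (𝔣.idealR_ne_top_iff c ε (hr.add even_two) ⟨_, h.isUnit⟩).2 hdeg
  have hm : r + 4 ≤ m := by
    have := Fintype.card_le_of_injective ι h.injective
    simpa using this
  have hfin : (𝔣.paramSet c ε ι).Finite :=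
    (Set.finite_range _).union ((Set.toFinite _).image _)
  have hcard : (𝔣.paramSet c ε ι).ncard ≤ m - 2 := by
    refine (Set.ncard_union_le _ _).trans ?_
    have h1 : (Set.range fun i => 𝔣.incl (c.centered ε i)).ncard ≤ r + 2 := by
      rw [← Set.image_univ]
      exact (Set.ncard_image_le Set.finite_univ).trans (by simp)
    have h2 : (𝔣.coord '' (Set.range ι)ᶜ).ncard ≤ m - (r + 4) := by
      refine (Set.ncard_image_le (Set.toFinite _)).trans ?_
      rw [Set.ncard_compl, ← Set.image_univ, Set.ncard_image_of_injective _ h.injective,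
        Set.ncard_univ]
      simp
    omega
  let s : Finset 𝔣.LocalRing := insert 𝔣.Phi (insert (pfaffian (r + 2) (𝔣.hess c))
    (Finset.univ.image (𝔣.dPhi c)))
  have hs : 𝔣.idealR (r + 2) = Ideal.span (s : Set 𝔣.LocalRing) := by
    rw [𝔣.idealR_eq c (hr.add even_two) ⟨_, h.isUnit⟩]
    simp [s]
  have hsc : s.card ≤ r + 4 := by
    refine (Finset.card_insert_le _ _).trans ?_
    have h2 := Finset.card_insert_le (pfaffian (r + 2) (𝔣.hess c))
      (Finset.univ.image (𝔣.dPhi c))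
    have h3 : (Finset.univ.image (𝔣.dPhi c)).card ≤ r + 2 := Finset.card_image_le.trans (by simp)
    omega
  refine isRegularLocalRing_quotient hne hs hsc hfin hcard ?_ (h.maximalIdeal_le hr hdeg hB) ?_
  · rintro _ (⟨i, rfl⟩ | ⟨j, -, rfl⟩)
    · exact (𝔣.mem_maximalIdeal_iff_evalPt ε).2 (by rw [evalPt_incl, c.apply_centered])
    · exact (𝔣.mem_maximalIdeal_iff_evalPt ε).2 (𝔣.evalPt_coord ε j)
  · have h1 := 𝔣.le_ringKrullDim_localRing c ε
    rwa [show m - 2 + (r + 4) = r + 2 + m by omega]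

end Frame

end PolarizedVariety

end DiscriminantVariety
end

/-! ### Linear changes of variables and quadratic parts in characteristic two -/

noncomputable section
namespace DiscriminantVariety

section LinearSubstitution

open MvPowerSeries

variable {k : Type*} [Field k] {n : ℕ}

/-- The images of the variables under a linear change of variables. -/
def linearForms (G : Matrix (Fin n) (Fin n) k) (j : Fin n) : MvPowerSeries (Fin n) k :=
  ∑ i, C (G j i) * X i

lemma hasSubst_linearForms (G : Matrix (Fin n) (Fin n) k) : HasSubst (linearForms G) :=
  hasSubst_of_constantCoeff_zero fun j => by simp [linearForms]

/-- A linear change of variables. -/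
def linearSubst (G : Matrix (Fin n) (Fin n) k) :
    MvPowerSeries (Fin n) k →ₐ[k] MvPowerSeries (Fin n) k :=
  substAlgHom (hasSubst_linearForms G)

lemma linearSubst_X (G : Matrix (Fin n) (Fin n) k) (j : Fin n) :
    linearSubst G (X j) = linearForms G j := by
  rw [linearSubst, coe_substAlgHom, subst_X (hasSubst_linearForms G)]

lemma linearSubst_C (G : Matrix (Fin n) (Fin n) k) (a : k) :
    linearSubst G (C a) = C a := by
  have := (linearSubst G).commutes a
  rwa [MvPowerSeries.algebraMap_apply] at this

lemma linearSubst_linearSubst (G G' : Matrix (Fin n) (Fin n) k) (F : MvPowerSeries (Fin n) k) :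
    linearSubst G' (linearSubst G F) = linearSubst (G * G') F := by
  have h : ∀ j, subst (linearForms G') (linearForms G j) = linearForms (G * G') j := fun j => by
    rw [← coe_substAlgHom (hasSubst_linearForms G')]
    change linearSubst G' _ = _
    simp only [linearForms, map_sum, map_mul, linearSubst_C, linearSubst_X, Matrix.mul_apply,
      Finset.mul_sum, Finset.sum_mul]
    rw [Finset.sum_comm]
    simp only [mul_assoc]
  simp only [linearSubst, coe_substAlgHom]
  rw [subst_comp_subst_apply (hasSubst_linearForms G) (hasSubst_linearForms G')]
  simp only [h]

lemma linearSubst_one (F : MvPowerSeries (Fin n) k) : linearSubst 1 F = F := by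
  have h : linearForms (1 : Matrix (Fin n) (Fin n) k) = X := by
    ext1 j
    simp [linearForms, Matrix.one_apply, apply_ite]
  rw [linearSubst, coe_substAlgHom, h, subst_self]
  rfl

/-- A linear automorphism. -/
def linearEquiv (G : Matrix (Fin n) (Fin n) k) (hG : IsUnit G.det) :
    MvPowerSeries (Fin n) k ≃ₐ[k] MvPowerSeries (Fin n) k :=
  AlgEquiv.ofAlgHom (linearSubst G) (linearSubst G⁻¹)
    (by ext1 F; simp [linearSubst_linearSubst, Matrix.nonsing_inv_mul _ hG, linearSubst_one])
    (by ext1 F; simp [linearSubst_linearSubst, Matrix.mul_nonsing_inv _ hG, linearSubst_one])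

lemma linearSubst_mem (G : Matrix (Fin n) (Fin n) k) {d : ℕ} {F : MvPowerSeries (Fin n) k}
    (hF : F ∈ varIdeal k n ^ d) : linearSubst G F ∈ varIdeal k n ^ d := by
  have : varIdeal k n ≤ (varIdeal k n).comap (linearSubst G) := by
    rw [varIdeal, Ideal.span_le]
    rintro _ ⟨i, rfl⟩
    rw [SetLike.mem_coe, Ideal.mem_comap, linearSubst_X]
    exact Ideal.sum_mem _ fun j _ => Ideal.mul_mem_left _ _ (X_mem_varIdeal j)
  exact Ideal.le_comap_pow _ d (Ideal.pow_right_mono this d hF)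

/-- `F` agrees with the quadratic form of `M` up to order three. -/
def HasQuad (F : MvPowerSeries (Fin n) k) (M : Matrix (Fin n) (Fin n) k) : Prop :=
  F - ∑ i, ∑ j, C (M i j) * (X i * X j) ∈ varIdeal k n ^ 3

lemma exists_hasQuad {F : MvPowerSeries (Fin n) k} (hF : F ∈ varIdeal k n ^ 2) :
    ∃ M, HasQuad F M := by
  obtain ⟨F₁, rfl, h1⟩ := exists_eq_sum_X_mul (d := 1) (mem_varIdeal_pow.1 hF)
  choose F₂ h3 h2 using fun i => exists_eq_sum_X_mul (d := 0) (h1 i)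
  refine ⟨Matrix.of fun i j => constantCoeff (F₂ i j), ?_⟩
  have : ∑ i, X i * F₁ i - ∑ i, ∑ j, C (constantCoeff (F₂ i j)) * (X i * X j) =
      ∑ i, ∑ j, X i * X j * (F₂ i j - C (constantCoeff (F₂ i j))) := by
    rw [← Finset.sum_sub_distrib]
    refine Finset.sum_congr rfl fun i _ => ?_
    rw [h3 i, Finset.mul_sum, ← Finset.sum_sub_distrib]
    refine Finset.sum_congr rfl fun j _ => by ring
  rw [HasQuad]
  simp only [Matrix.of_apply]
  rw [this, pow_succ, sq]
  exact Ideal.sum_mem _ fun i _ => Ideal.sum_mem _ fun j _ => Ideal.mul_mem_mul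
    (Ideal.mul_mem_mul (X_mem_varIdeal i) (X_mem_varIdeal j)) (mem_varIdeal.2 (by simp))

lemma sum_comm_four {ι R : Type*} [Fintype ι] [AddCommMonoid R] (f : ι → ι → ι → ι → R) :
    ∑ a, ∑ b, ∑ i, ∑ j, f a b i j = ∑ i, ∑ j, ∑ a, ∑ b, f a b i j := by
  calc _ = ∑ a, ∑ i, ∑ b, ∑ j, f a b i j :=
        Finset.sum_congr rfl fun a _ => Finset.sum_comm
    _ = ∑ i, ∑ a, ∑ b, ∑ j, f a b i j := Finset.sum_comm
    _ = ∑ i, ∑ a, ∑ j, ∑ b, f a b i j :=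
        Finset.sum_congr rfl fun i _ => Finset.sum_congr rfl fun a _ => Finset.sum_comm
    _ = _ := Finset.sum_congr rfl fun i _ => Finset.sum_comm

lemma HasQuad.linearSubst {F : MvPowerSeries (Fin n) k} {M : Matrix (Fin n) (Fin n) k}
    (h : HasQuad F M) (G : Matrix (Fin n) (Fin n) k) :
    HasQuad (linearSubst G F) (G.transpose * M * G) := by
  have := linearSubst_mem G h
  rw [HasQuad]
  convert! this using 1
  rw [map_sub]
  congr 1
  have h1 : ∀ a b, C ((G.transpose * M * G) a b) * (X a * X b) =
      ∑ i, ∑ j, (C (M i j) * (C (G i a) * X a * (C (G j b) * X b)) :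
        MvPowerSeries (Fin n) k) := fun a b => by
    simp only [Matrix.mul_apply, Matrix.transpose_apply, Finset.sum_mul, map_sum]
    rw [Finset.sum_comm]
    refine Finset.sum_congr rfl fun i _ => Finset.sum_congr rfl fun j _ => ?_
    simp only [map_mul]
    ring
  have h2 : ∀ i j, DiscriminantVariety.linearSubst G (C (M i j) * (X i * X j)) =
      ∑ a, ∑ b, C (M i j) * (C (G i a) * X a * (C (G j b) * X b)) := fun i j => by
    simp only [map_mul, linearSubst_C, linearSubst_X, linearForms]
    rw [Finset.sum_mul_sum, Finset.mul_sum]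
    exact Finset.sum_congr rfl fun a _ => Finset.mul_sum _ _ _
  simp only [map_sum, h1, h2]
  exact sum_comm_four _

lemma coeff_X_mul_X (i j a b : Fin n) :
    coeff (Finsupp.single a 1 + Finsupp.single b 1) (X i * X j : MvPowerSeries (Fin n) k) =
      if (i = a ∧ j = b) ∨ (i = b ∧ j = a) then 1 else 0 := by
  classical
  rw [X, X, monomial_mul_monomial, one_mul, coeff_monomial]
  congr 1
  rw [Finsupp.single_add_single_eq_single_add_single one_ne_zero one_ne_zero]
  refine propext ⟨?_, ?_⟩
  · rintro (⟨rfl, rfl⟩ | ⟨-, rfl, rfl⟩ | ⟨h, -⟩)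
    · exact Or.inl ⟨rfl, rfl⟩
    · exact Or.inr ⟨rfl, rfl⟩
    · exact absurd h (by norm_num)
  · rintro (⟨rfl, rfl⟩ | ⟨rfl, rfl⟩)
    · exact Or.inl ⟨rfl, rfl⟩
    · exact Or.inr (Or.inl ⟨rfl, rfl, rfl⟩)

lemma HasQuad.coeff_eq {F : MvPowerSeries (Fin n) k} {M : Matrix (Fin n) (Fin n) k}
    (h : HasQuad F M) (a b : Fin n) :
    coeff (Finsupp.single a 1 + Finsupp.single b 1) F =
      if a = b then M a a else M a b + M b a := by
  have h1 := mem_varIdeal_pow.1 h (Finsupp.single a 1 + Finsupp.single b 1) (by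
    simp)
  rw [map_sub, sub_eq_zero] at h1
  rw [h1]
  simp only [map_sum, coeff_C_mul, coeff_X_mul_X]
  have hsum : ∀ a b : Fin n, (∑ i, ∑ j, M i j * (if i = a ∧ j = b then 1 else 0)) = M a b := by
    intro a b
    rw [Finset.sum_eq_single a (fun i _ hi => Finset.sum_eq_zero fun j _ => by simp [hi])
      (by simp), Finset.sum_eq_single b (fun j _ hj => by simp [hj]) (by simp)]
    simp
  split_ifs with hab
  · subst hab
    simp only [or_self]
    exact hsum a a
  · have : ∀ i j, (if (i = a ∧ j = b) ∨ (i = b ∧ j = a) then (1 : k) else 0) =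
        (if i = a ∧ j = b then 1 else 0) + (if i = b ∧ j = a then 1 else 0) := fun i j => by
      by_cases h1 : i = a ∧ j = b
      · have h2 : ¬ (i = b ∧ j = a) := fun h2 => hab (h1.1.symm.trans h2.1)
        simp [h1, h2, hab]
      · simp [h1]
    simp only [this, mul_add, Finset.sum_add_distrib, hsum]

variable [CharP k 2]

/-- The quadratic part of `F`, as an upper triangular matrix. -/
def quadMatrix {R : Type*} [CommRing R] (F : MvPowerSeries (Fin n) R) :
    Matrix (Fin n) (Fin n) R :=
  Matrix.of fun i j => if i ≤ j then coeff (Finsupp.single i 1 + Finsupp.single j 1) F else 0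

lemma quadMatrix_map {R S : Type*} [CommRing R] [CommRing S] (f : R →+* S)
    (F : MvPowerSeries (Fin n) R) : quadMatrix (map f F) = (quadMatrix F).map f := by
  ext i j
  simp only [quadMatrix, Matrix.of_apply, Matrix.map_apply, coeff_map]
  split_ifs <;> simp

lemma hessian_eq_quadMatrix (F : MvPowerSeries (Fin n) k) :
    hessian F = quadMatrix F + (quadMatrix F).transpose := by
  ext i j
  rw [hessian_apply, constantCoeff_pderiv, coeff_pderiv]
  simp only [quadMatrix, Matrix.add_apply, Matrix.transpose_apply, Matrix.of_apply]
  rcases lt_trichotomy i j with h | h | h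
  · rw [if_pos h.le, if_neg h.not_ge]
    simp [Finsupp.single_apply, h.ne]
  · subst h
    simp [one_add_one_eq_two, CharTwo.two_eq_zero, CharTwo.add_self_eq_zero]
  · rw [if_neg h.not_ge, if_pos h.le, add_comm (Finsupp.single j 1)]
    simp [Finsupp.single_apply, h.ne']

/-- A quadratic form determines the diagonal of a representing matrix and the sums of opposite
entries. Thus two representing matrices differ by an alternating one, which has no effect on values
of the form. -/
lemma HasQuad.isAlt {F : MvPowerSeries (Fin n) k} {M : Matrix (Fin n) (Fin n) k}
    (h : HasQuad F M) : IsAlt (M - quadMatrix F) := by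
  have hij : ∀ i j, i < j → (M - quadMatrix F) i j = (M - quadMatrix F) j i := by
    intro i j hlt
    simp only [Matrix.sub_apply, quadMatrix, Matrix.of_apply]
    rw [if_pos hlt.le, if_neg hlt.not_ge, h.coeff_eq, if_neg hlt.ne, sub_zero, sub_add_cancel_left,
      CharTwo.neg_eq]
  refine ⟨fun i j => ?_, fun i => ?_⟩
  · rcases lt_trichotomy i j with hlt | rfl | hlt
    · exact hij i j hlt
    · rfl
    · exact (hij j i hlt).symm
  · simp only [Matrix.sub_apply, quadMatrix, Matrix.of_apply]
    rw [if_pos le_rfl, h.coeff_eq, if_pos rfl, sub_self]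

lemma HasQuad.hessian_eq {F : MvPowerSeries (Fin n) k} {M : Matrix (Fin n) (Fin n) k}
    (h : HasQuad F M) : hessian F = M + M.transpose := by
  rw [hessian_eq_quadMatrix]
  have h1 := h.isAlt.transpose_eq
  rw [Matrix.transpose_sub] at h1
  ext i j
  have h2 := congrFun (congrFun h1 i) j
  simp only [Matrix.sub_apply, Matrix.add_apply, Matrix.transpose_apply] at h2 ⊢
  have h3 : (M i j - quadMatrix F i j) + (M i j - quadMatrix F i j) = 0 :=
    CharTwo.add_self_eq_zero _
  have h4 : quadMatrix F i j + quadMatrix F i j = 0 := CharTwo.add_self_eq_zero _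
  have h5 : M i j + M i j = 0 := CharTwo.add_self_eq_zero _
  linear_combination -h2 - h5 + h4

/-- The value of the quadratic part of `F` at a vector. -/
def quadValue {R : Type*} [CommRing R] (F : MvPowerSeries (Fin n) R) (w : Fin n → R) : R :=
  ∑ i, ∑ j, w i * quadMatrix F i j * w j

lemma HasQuad.quadValue_eq {F : MvPowerSeries (Fin n) k} {M : Matrix (Fin n) (Fin n) k}
    (h : HasQuad F M) (w : Fin n → k) : quadValue F w = ∑ i, ∑ j, w i * M i j * w j := by
  have := h.isAlt.sum_mul_mul_self w
  simp only [Matrix.sub_apply, mul_sub, sub_mul, Finset.sum_sub_distrib, sub_eq_zero] at this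
  exact this.symm

/-- The coefficient of `ξ²` after a linear change of variables. -/
lemma coeff_linearSubst {F : MvPowerSeries (Fin n) k} (hF : F ∈ varIdeal k n ^ 2)
    (G : Matrix (Fin n) (Fin n) k) (a : Fin n) :
    coeff (Finsupp.single a 1 + Finsupp.single a 1) (linearSubst G F) =
      quadValue F fun i => G i a := by
  obtain ⟨M, hM⟩ := exists_hasQuad hF
  rw [(hM.linearSubst G).coeff_eq, if_pos rfl, hM.quadValue_eq]
  simp only [Matrix.mul_apply, Matrix.transpose_apply, Finset.sum_mul]
  exact Finset.sum_comm

/-- The Hessian is M + Mᵀ for any matrix M of the quadratic part, and M transforms by congruence. -/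
lemma hessian_linearSubst {F : MvPowerSeries (Fin n) k} (hF : F ∈ varIdeal k n ^ 2)
    (G : Matrix (Fin n) (Fin n) k) :
    hessian (linearSubst G F) = G.transpose * hessian F * G := by
  obtain ⟨M, hM⟩ := exists_hasQuad hF
  rw [(hM.linearSubst G).hessian_eq, hM.hessian_eq]
  simp only [Matrix.transpose_mul, Matrix.transpose_transpose, Matrix.mul_add, Matrix.add_mul,
    Matrix.mul_assoc]

end LinearSubstitution

/-! ### Type A as a nonvanishing condition that specializes well -/

section TypeA

variable {k : Type*} [Field k] [CharP k 2] {r : ℕ}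

/-- The Hessian, over an arbitrary ring of characteristic two. -/
def hessianOver {R : Type*} [CommRing R] {n : ℕ} (F : MvPowerSeries (Fin n) R) :
    Matrix (Fin n) (Fin n) R := quadMatrix F + (quadMatrix F).transpose

/-- A multiple of the vector in the kernel of the upper rows of the Hessian that corresponds to
the first of the last two variables. -/
def kernelVector {R : Type*} [CommRing R] (F : MvPowerSeries (Fin (r + 2)) R) :
    Fin (r + 2) → R :=
  Fin.addCases
    (fun i => -((blockB (hessianOver F)).adjugate * blockC (hessianOver F)) i 0)
    (fun b => if b = 0 then (blockB (hessianOver F)).det else 0)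

/-- If the quadratic part of `F` does not vanish on the kernel vector, then `F` is of type A. -/
theorem exists_hasFormA (hr : Even r) {F : MvPowerSeries (Fin (r + 2)) k} (hF : IsDegenerate F)
    (hB : (blockB (hessian F)).det ≠ 0) (hq : quadValue F (kernelVector F) ≠ 0) :
    ∃ g : MvPowerSeries (Fin (r + 2)) k ≃ₐ[k] MvPowerSeries (Fin (r + 2)) k, HasFormA (g F) := by
  obtain ⟨G, hG, hstd, hG1, hG2⟩ := exists_normalizing hr (isAlt_hessian F) hB hF.2
  refine ⟨linearEquiv G hG, ?_, Fin.natAdd r 0, Fin.natAdd r 1, by simp, by simp, (2, 0), by simp,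
    ?_⟩
  · change hessian (linearSubst G F) = _
    rw [hessian_linearSubst hF.1, hstd]
    simp
  · have h1 : (Finsupp.single (Fin.natAdd r 0 : Fin (r + 2)) 2 +
        Finsupp.single (Fin.natAdd r 1 : Fin (r + 2)) 0 : Fin (r + 2) →₀ ℕ) =
        Finsupp.single (Fin.natAdd r 0) 1 + Finsupp.single (Fin.natAdd r 0) 1 := by
      rw [Finsupp.single_zero, add_zero, ← Finsupp.single_add]
    change MvPowerSeries.coeff _ (linearSubst G F) ≠ 0
    rw [h1, coeff_linearSubst hF.1]
    intro h0
    apply hq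
    -- The kernel vector is the column of G for ξ₁ scaled by det B. The scaling replaces the inverse
    -- of B by its adjugate, so that the vector makes sense in families; the quadratic value changes
    -- only by (det B)².
    have hw : kernelVector F =
        fun i => (blockB (hessian F)).det * G i (Fin.natAdd r 0) := by
      have hH : hessianOver F = hessian F := (hessian_eq_quadMatrix F).symm
      ext i
      refine Fin.addCases (fun i => ?_) (fun b => ?_) i
      · rw [kernelVector, Fin.addCases_left, hG1, hH, Matrix.inv_def]
        simp [hB]
      · rw [kernelVector, Fin.addCases_right, hG2, hH]
        split_ifs <;> simp
    rw [hw]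
    have : quadValue F (fun i => (blockB (hessian F)).det * G i (Fin.natAdd r 0)) =
        (blockB (hessian F)).det ^ 2 * quadValue F fun i => G i (Fin.natAdd r 0) := by
      simp only [quadValue, Finset.mul_sum]
      refine Finset.sum_congr rfl fun i _ => Finset.sum_congr rfl fun j _ => by ring
    rw [this, h0, mul_zero]

lemma hessianOver_map {R S : Type*} [CommRing R] [CommRing S] {n : ℕ} (f : R →+* S)
    (F : MvPowerSeries (Fin n) R) :
    hessianOver (MvPowerSeries.map f F) = (hessianOver F).map f := by
  ext i j
  simp [hessianOver, quadMatrix_map]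

lemma blockB_map {R S : Type*} [CommRing R] [CommRing S] (f : R →+* S)
    (A : Matrix (Fin (r + 2)) (Fin (r + 2)) R) : blockB (A.map f) = (blockB A).map f := rfl

lemma kernelVector_map {R S : Type*} [CommRing R] [CommRing S] (f : R →+* S)
    (F : MvPowerSeries (Fin (r + 2)) R) (i : Fin (r + 2)) :
    kernelVector (MvPowerSeries.map f F) i = f (kernelVector F i) := by
  have hC : blockC ((hessianOver F).map f) = (blockC (hessianOver F)).map f := rfl
  refine Fin.addCases (fun i => ?_) (fun b => ?_) i
  · rw [kernelVector, kernelVector, Fin.addCases_left, Fin.addCases_left, hessianOver_map,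
      blockB_map, hC, ← RingHom.mapMatrix_apply, ← RingHom.map_adjugate, RingHom.mapMatrix_apply,
      ← Matrix.map_mul, Matrix.map_apply, map_neg]
  · rw [kernelVector, kernelVector, Fin.addCases_right, Fin.addCases_right, hessianOver_map,
      blockB_map, apply_ite f, map_zero, RingHom.map_det]
    rfl

lemma quadValue_kernelVector_map {R S : Type*} [CommRing R] [CommRing S] (f : R →+* S)
    (F : MvPowerSeries (Fin (r + 2)) R) :
    quadValue (MvPowerSeries.map f F) (kernelVector (MvPowerSeries.map f F)) =
      f (quadValue F (kernelVector F)) := by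
  simp only [quadValue, kernelVector_map, quadMatrix_map, Matrix.map_apply, map_sum, map_mul]

end TypeA

end DiscriminantVariety
end

/-! ### Local generators of the line bundle -/

noncomputable section
namespace DiscriminantVariety

open Opposite

/-- `e` generates the module `L` freely over every open subset of `U`. -/
def IsFreeSection {X : Scheme.{u}} (L : X.Modules) {U : X.Opens} (e : Γ(L, U)) : Prop :=
  ∀ (W : X.Opens) (h : W ≤ U) (s : Γ(L, W)),
    ∃! a : Γ(X, W), s = a • L.presheaf.map (homOfLE h).op e

lemma IsFreeSection.of_iso {X : Scheme.{u}} {L N : X.Modules} (α : L ≅ N) {U : X.Opens}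
    {e : Γ(N, U)} (he : IsFreeSection N e) : IsFreeSection L (α.inv.app U e) := by
  intro W h s
  have hnat : L.presheaf.map (homOfLE h).op (α.inv.app U e) =
      α.inv.app W (N.presheaf.map (homOfLE h).op e) :=
    (congr($(α.inv.mapPresheaf.naturality (homOfLE h).op) e)).symm
  have hinv (s : Γ(L, W)) : α.inv.app W (α.hom.app W s) = s := by
    have h : (α.hom ≫ α.inv).app W = 𝟙 _ := by rw [α.hom_inv_id]; rfl
    exact congr($h s)
  have hhom (s : Γ(N, W)) : α.hom.app W (α.inv.app W s) = s := by
    have h : (α.inv ≫ α.hom).app W = 𝟙 _ := by rw [α.inv_hom_id]; rfl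
    exact congr($h s)
  rw [hnat]
  obtain ⟨a, ha, hu⟩ := he W h (α.hom.app W s)
  refine ⟨a, ?_, fun b hb => hu b ?_⟩
  · dsimp only
    rw [← Scheme.Modules.Hom.app_smul, ← ha, hinv]
  · dsimp only at hb ⊢
    rw [hb, Scheme.Modules.Hom.app_smul, hhom]

lemma isFreeSection_unit (X : Scheme.{u}) :
    IsFreeSection (SheafOfModules.unit X.ringCatSheaf : X.Modules) (U := ⊤) (1 : Γ(X, ⊤)) := by
  intro W h s
  have h1 (a : Γ(X, W)) : a * (X.presheaf.map (homOfLE h).op).hom (1 : Γ(X, ⊤)) = a := by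
    rw [map_one, mul_one]
  exact ⟨(s : Γ(X, W)), (h1 s).symm, fun b hb => (h1 b).symm.trans hb.symm⟩

lemma exists_section_of_restrict_iso {X : Scheme.{u}} {L : X.Modules} (U : X.Opens)
    (α : (L.restrict U.ι : (U : Scheme.{u}).Modules) ≅
      (SheafOfModules.unit (U : Scheme.{u}).ringCatSheaf : (U : Scheme.{u}).Modules)) :
    ∃ e : Γ(L, U), IsFreeSection L e := by
  have he := (isFreeSection_unit (U : Scheme.{u})).of_iso α
  set e := α.inv.app ⊤ (1 : Γ((U : Scheme.{u}), ⊤))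
  suffices H : ∃ e : Γ(L, U.ι ''ᵁ ⊤), IsFreeSection L e by
    have hU : U.ι ''ᵁ ⊤ = U := by simp
    rwa [hU] at H
  refine ⟨(L.restrictAppIso U.ι ⊤).hom e, ?_⟩
  intro W h s
  obtain ⟨W', rfl⟩ : ∃ W', U.ι ''ᵁ W' = W := ⟨U.ι ⁻¹ᵁ W, by
    rw [Scheme.Hom.image_preimage_eq_opensRange_inf]; simpa using h⟩
  obtain ⟨a, ha, hu⟩ := he W' le_top s
  refine ⟨(U.ι.appIso W').inv a, ha, fun b hb => ?_⟩
  have := hu ((U.ι.appIso W').hom b) (hb.trans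
    (congr($(Scheme.Modules.smul_restrictAppIso_inv U.ι L W' b) (L.presheaf.map (homOfLE h).op e))))
  rw [← this]
  exact congr($((U.ι.appIso W').hom_inv_id) b).symm

namespace PolarizedVariety

variable {k : Type u} [Field k] (V : PolarizedVariety k)

/-- The germ at `p` of a section of `L`. -/
def germL (U : V.X.Opens) (p : V.X) (hp : p ∈ U) : Γ(V.L, U) →+ V.LStalk p :=
  (V.L.presheaf.germ U p hp).hom

lemma germL_smul (U : V.X.Opens) (p : V.X) (hp : p ∈ U) (a : Γ(V.X, U)) (s : Γ(V.L, U)) :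
    V.germL U p hp (a • s) = V.germ U p hp a • V.germL U p hp s :=
  PresheafOfModules.germ_smul V.presheafL p U hp a s

lemma germL_res {U W : V.X.Opens} (h : W ≤ U) (p : V.X) (hp : p ∈ W) (s : Γ(V.L, U)) :
    V.germL W p hp (V.L.presheaf.map (homOfLE h).op s) = V.germL U p (h hp) s :=
  congr($(V.L.presheaf.germ_res (homOfLE h) p hp) s)

lemma germ_res {U W : V.X.Opens} (h : W ≤ U) (p : V.X) (hp : p ∈ W) (a : Γ(V.X, U)) :
    V.germ W p hp (V.X.presheaf.map (homOfLE h).op a) = V.germ U p (h hp) a :=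
  congr($(V.X.presheaf.germ_res (homOfLE h) p hp) a)

/-- Freeness is demanded over every smaller open subset, and germs and their relations are
represented on such subsets. -/
lemma isGenerator_germL {U : V.X.Opens} {e : Γ(V.L, U)} (he : IsFreeSection V.L e) {p : V.X}
    (hp : p ∈ U) : V.IsGenerator p (V.germL U p hp e) := by
  constructor
  · have : ∀ a : V.O p, a • V.germL U p hp e = 0 → a = 0 := by
      intro a ha
      obtain ⟨W, hpW, a, rfl⟩ := V.X.presheaf.exists_germ_eq (x := p) a
      set W₁ := W ⊓ U
      have hp1 : p ∈ W₁ := ⟨hpW, hp⟩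
      have h1 : V.germL W₁ p hp1 (V.X.presheaf.map (homOfLE (inf_le_left : W₁ ≤ W)).op a •
          V.L.presheaf.map (homOfLE (inf_le_right : W₁ ≤ U)).op e) = V.germL W₁ p hp1 0 := by
        rw [germL_smul, germL_res, germ_res, map_zero]
        exact ha
      obtain ⟨W₂, hp2, i, j, h2⟩ := V.L.presheaf.germ_eq p hp1 hp1 _ _ h1
      rw [Subsingleton.elim j i, map_zero] at h2
      have h3 : V.X.presheaf.map (homOfLE (i.le.trans inf_le_left)).op a •
          V.L.presheaf.map (homOfLE (i.le.trans inf_le_right)).op e = 0 := by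
        have := Scheme.Modules.map_smul V.L i (V.X.presheaf.map (homOfLE (inf_le_left : W₁ ≤ W)).op a)
          (V.L.presheaf.map (homOfLE (inf_le_right : W₁ ≤ U)).op e)
        have h4 := h2.symm.trans this
        refine (Eq.trans ?_ h4.symm)
        congr 1
        · exact congr($(V.X.presheaf.map_comp (homOfLE (inf_le_left : W₁ ≤ W)).op i.op) a)
        · exact congr($(V.L.presheaf.map_comp (homOfLE (inf_le_right : W₁ ≤ U)).op i.op) e)
      have h5 : V.X.presheaf.map (homOfLE (i.le.trans inf_le_left)).op a = 0 :=
        (he W₂ (i.le.trans inf_le_right) 0).unique h3.symm (zero_smul _ _).symm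
      have h6 := V.germ_res (i.le.trans inf_le_left) p hp2 a
      rw [h5, map_zero] at h6
      exact h6.symm
    intro a b hab
    rw [← sub_eq_zero]
    refine this _ ?_
    rw [sub_smul, sub_eq_zero]
    exact hab
  · intro t
    obtain ⟨W, hpW, s, rfl⟩ := V.L.presheaf.exists_germ_eq (x := p) t
    have hp1 : p ∈ W ⊓ U := ⟨hpW, hp⟩
    obtain ⟨a, ha, -⟩ := he (W ⊓ U) inf_le_right (V.L.presheaf.map (homOfLE inf_le_left).op s)
    refine ⟨V.germ _ p hp1 a, ?_⟩
    have := V.germL_res inf_le_left p hp1 s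
    rw [ha, germL_smul, germL_res] at this
    exact this

end PolarizedVariety

end DiscriminantVariety
end

/-! ### Charts: étale coordinates with a trivialisation -/

noncomputable section
namespace DiscriminantVariety

open Opposite

/-- A maximal ideal of a finitely generated algebra over an algebraically closed field is a rational
point, and so is the local ring. -/
lemma exists_algHom_of_isLocalization {k S O : Type*} [Field k] [IsAlgClosed k] [CommRing S]
    [Algebra k S] [Algebra.FiniteType k S] [CommRing O] [Algebra S O] [Algebra k O]
    [IsScalarTower k S O] (q : Ideal S) [hq : q.IsMaximal] [IsLocalization.AtPrime O q] :
    Nonempty (O →ₐ[k] k) := by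
  letI : Field (S ⧸ q) := Ideal.Quotient.field q
  -- The Nullstellensatz: the residue field is finite over the algebraically closed field k, so it
  -- equals k.
  have : Module.Finite k (S ⧸ q) := finite_of_finite_type_of_isJacobsonRing k (S ⧸ q)
  have hb : Function.Bijective (algebraMap k (S ⧸ q)) :=
    IsAlgClosed.algebraMap_bijective_of_isIntegral
  let e : k ≃ₐ[k] (S ⧸ q) := AlgEquiv.ofBijective (Algebra.ofId k (S ⧸ q)) hb
  let ε : S →ₐ[k] k := e.symm.toAlgHom.comp (Ideal.Quotient.mkₐ k q)
  refine ⟨IsLocalization.liftAlgHom (M := q.primeCompl) (f := ε) ?_⟩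
  rintro ⟨s, hs⟩
  rw [isUnit_iff_ne_zero]
  intro h
  apply hs
  have : e.symm (Ideal.Quotient.mk q s) = 0 := h
  rw [map_eq_zero_iff _ e.symm.injective] at this
  exact Ideal.Quotient.eq_zero_iff_mem.mp this

namespace PolarizedVariety

variable {k : Type u} [Field k] (V : PolarizedVariety k)

/-- Regular functions form a `k`-algebra. -/
instance (U : V.X.Opens) : Algebra k Γ(V.X, U) :=
  ((V.X.presheaf.map (homOfLE (le_top : U ≤ ⊤)).op).hom.comp V.const).toAlgebra

/-- The germ at `q` as a homomorphism of `k`-algebras. -/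
def germₐ (U : V.X.Opens) (q : V.X) (hq : q ∈ U) : Γ(V.X, U) →ₐ[k] V.O q where
  __ := V.germ U q hq
  commutes' c := V.germ_res (le_top : U ≤ ⊤) q hq (V.const c)

/-- An open subset with coordinates and a trivialisation of `L`, together with the values of
functions at its closed points. -/
structure Chart (n : ℕ) where
  /-- the open subset -/
  U : V.X.Opens
  /-- the coordinates -/
  c : TaylorCoords k Γ(V.X, U) n
  /-- the local equations of the sections of `L` -/
  φ : V.Sections →ₗ[k] Γ(V.X, U)
  /-- the generator of `L` -/
  e : ∀ q ∈ U, V.LStalk q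
  isGenerator : ∀ q hq, V.IsGenerator q (e q hq)
  sectionGerm_eq : ∀ q hq s, V.sectionGerm q s = V.germ U q hq (φ s) • e q hq
  /-- the value of functions at a closed point -/
  ε : ∀ q ∈ U, IsClosed ({q} : Set V.X) → V.O q →ₐ[k] k
  isNoetherianRing : ∀ q ∈ U, IsNoetherianRing (V.O q)
  /-- the coordinates in the local rings -/
  coords : ∀ q ∈ U, TaylorCoords k (V.O q) n
  coords_T : ∀ q hq a, (coords q hq).T (V.germ U q hq a) =
    MvPowerSeries.map (V.germ U q hq) (c.T a)

lemma exists_linearMap_of_isFreeSection {U : V.X.Opens} {e : Γ(V.L, U)}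
    (he : IsFreeSection V.L e) : ∃ φ : V.Sections →ₗ[k] Γ(V.X, U), ∀ s,
      V.L.presheaf.map (homOfLE (le_top : U ≤ ⊤)).op s = φ s • e := by
  have h (s : V.Sections) : ∃! a : Γ(V.X, U),
      V.L.presheaf.map (homOfLE (le_top : U ≤ ⊤)).op s = a • e := by
    have := he U le_rfl (V.L.presheaf.map (homOfLE (le_top : U ≤ ⊤)).op s)
    have hid : V.L.presheaf.map (homOfLE (le_refl U)).op e = e :=
      congr($(V.L.presheaf.map_id (op U)) e)
    rwa [hid] at this
  choose φ hφ hu using h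
  refine ⟨⟨⟨φ, fun s t => ?_⟩, fun c s => ?_⟩, hφ⟩
  · symm
    apply hu
    dsimp only
    rw [add_smul, ← hφ, ← hφ]
    exact map_add (V.L.presheaf.map (homOfLE (le_top : U ≤ ⊤)).op).hom s t
  · symm
    apply hu
    dsimp only
    rw [RingHom.id_apply, Algebra.smul_def, mul_smul, ← hφ]
    exact Scheme.Modules.map_smul V.L (homOfLE (le_top : U ≤ ⊤)) (V.const c) s

/-- A smooth morphism is locally standard smooth, hence étale over an affine space; the base is a
point, so it need not be shrunk. -/
lemma exists_etale_chart {n : ℕ} {p : V.X} (hp : V.IsNonsingularAt n p) :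
    ∃ U : V.X.Opens, p ∈ U ∧ IsAffineOpen U ∧ Algebra.FiniteType k Γ(V.X, U) ∧
      Nonempty (TaylorCoords k Γ(V.X, U) n) := by
  obtain ⟨U₀, hp0, hsm⟩ := hp
  obtain ⟨W, hW, V', hV', hx, hle, hstd⟩ :=
    hsm.exists_isStandardSmoothOfRelativeDimension ⟨p, hp0⟩
  have hWtop : W = ⊤ := by
    rw [eq_top_iff]
    intro y _
    have : Subsingleton (Spec (CommRingCat.of k)) :=
      inferInstanceAs (Subsingleton (PrimeSpectrum k))
    rw [Subsingleton.elim y ((U₀.ι ≫ V.toSpec) ⟨p, hp0⟩)]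
    exact hle hx
  subst hWtop
  let U : V.X.Opens := U₀.ι ''ᵁ V'
  have hmap : (Scheme.ΓSpecIso (CommRingCat.of k)).inv ≫ (U₀.ι ≫ V.toSpec).appLE ⊤ V' hle =
      CommRingCat.ofHom (algebraMap k Γ(V.X, U)) := by
    have h1 : (U₀.ι ≫ V.toSpec).appLE ⊤ V' hle =
        V.toSpec.appTop ≫ V.X.presheaf.map (homOfLE (le_top : U ≤ ⊤)).op := by
      rw [Scheme.Hom.appLE, Scheme.Hom.comp_app]
      refine (Category.assoc _ _ _).trans ?_
      refine congrArg (V.toSpec.appTop ≫ ·) ?_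
      rw [Scheme.Opens.ι_app, Scheme.Opens.toScheme_presheaf_map]
      exact (V.X.presheaf.map_comp _ _).symm
    rw [h1]
    rfl
  have hstd' : (algebraMap k Γ(V.X, U)).IsStandardSmoothOfRelativeDimension n := by
    have heq : algebraMap k Γ(V.X, U) = ((U₀.ι ≫ V.toSpec).appLE ⊤ V' hle).hom.comp
        ((Scheme.ΓSpecIso (CommRingCat.of k)).symm.commRingCatIsoToRingEquiv).toRingHom :=
      congr($(hmap).hom).symm
    rw [heq]
    exact RingHom.isStandardSmoothOfRelativeDimension_respectsIso.2 _ _ hstd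
  have hUp : p ∈ U := ⟨⟨p, hp0⟩, hx, rfl⟩
  refine ⟨U, hUp, hV'.image_of_isOpenImmersion _, ?_, ?_⟩
  · have : Algebra.FinitePresentation k Γ(V.X, U) := hstd'.isStandardSmooth.finitePresentation
    infer_instance
  · obtain ⟨g, hg, het⟩ := hstd'.exists_etale_mvPolynomial
    exact exists_taylorCoords { g with commutes' := fun c => congr($hg c) } het.formallyEtale

/-- An étale chart is shrunk to a basic open subset on which the line bundle is trivial. Such a
subset, like each local ring, is a localization, so coordinates and Taylor expansions carry over. -/
theorem exists_chart [IsAlgClosed k] {n : ℕ} {p : V.X} (hp : V.IsNonsingularAt n p) :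
    ∃ C : V.Chart n, p ∈ C.U := by
  obtain ⟨U₀, hp0, haff0, hfin0, ⟨c₀⟩⟩ := V.exists_etale_chart hp
  obtain ⟨U₁, hp1, ⟨α⟩⟩ := V.isLineBundle p
  obtain ⟨e₁, he₁⟩ := exists_section_of_restrict_iso U₁ α
  obtain ⟨a, haU, hpa⟩ := haff0.exists_basicOpen_le (V := U₁) ⟨p, hp1⟩ hp0
  let U := V.X.basicOpen a
  have haff : IsAffineOpen U := haff0.basicOpen a
  have hloc : IsLocalization.Away a Γ(V.X, U) := haff0.isLocalization_basicOpen a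
  have htow : IsScalarTower k Γ(V.X, U₀) Γ(V.X, U) := by
    refine IsScalarTower.of_algebraMap_eq fun c => ?_
    exact congr($(V.X.presheaf.map_comp (homOfLE (le_top : U₀ ≤ ⊤)).op
      (homOfLE (V.X.basicOpen_le a)).op) (V.const c))
  have hfin : Algebra.FiniteType k Γ(V.X, U) :=
    .trans hfin0 (IsLocalization.finiteType_of_monoid_fg (Submonoid.powers a) _)
  obtain ⟨c, -, -⟩ := exists_localize c₀ (Submonoid.powers a) Γ(V.X, U)
  have he : IsFreeSection V.L (V.L.presheaf.map (homOfLE haU).op e₁) := by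
    intro W h s
    have hid : V.L.presheaf.map (homOfLE h).op (V.L.presheaf.map (homOfLE haU).op e₁) =
        V.L.presheaf.map (homOfLE (h.trans haU)).op e₁ :=
      congr($(V.L.presheaf.map_comp (homOfLE haU).op (homOfLE h).op) e₁).symm
    rw [hid]
    exact he₁ W (h.trans haU) s
  obtain ⟨φ, hφ⟩ := V.exists_linearMap_of_isFreeSection he
  have hnoeth : IsNoetherianRing Γ(V.X, U) := Algebra.FiniteType.isNoetherianRing k _
  have key : ∀ q (hq : q ∈ U), ∃ (_ : Algebra Γ(V.X, U) (V.O q)), 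
      (algebraMap Γ(V.X, U) (V.O q) = V.germ U q hq) ∧ IsScalarTower k Γ(V.X, U) (V.O q) ∧
      IsLocalization.AtPrime (V.O q) (haff.primeIdealOf ⟨q, hq⟩).asIdeal := by
    intro q hq
    refine ⟨(V.germ U q hq).toAlgebra, rfl, ?_, haff.isLocalization_stalk ⟨q, hq⟩⟩
    letI := (V.germ U q hq).toAlgebra
    exact IsScalarTower.of_algebraMap_eq fun c => ((V.germₐ U q hq).commutes c).symm
  have hO : ∀ q (hq : q ∈ U), IsNoetherianRing (V.O q) := by
    intro q hq
    obtain ⟨_, -, -, h3⟩ := key q hq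
    exact IsLocalization.isNoetherianRing (haff.primeIdealOf ⟨q, hq⟩).asIdeal.primeCompl _ hnoeth
  have hε : ∀ q ∈ U, IsClosed ({q} : Set V.X) → Nonempty (V.O q →ₐ[k] k) := by
    intro q hq hcl
    obtain ⟨_, -, h2, h3⟩ := key q hq
    have := haff.primeIdealOf_isMaximal_of_isClosed ⟨q, hq⟩ hcl
    exact exists_algHom_of_isLocalization (haff.primeIdealOf ⟨q, hq⟩).asIdeal (S := Γ(V.X, U))
  have hc : ∀ q (hq : q ∈ U), ∃ c' : TaylorCoords k (V.O q) n, ∀ a, c'.T (V.germ U q hq a) =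
      MvPowerSeries.map (V.germ U q hq) (c.T a) := by
    intro q hq
    obtain ⟨_, h1, h2, h3⟩ := key q hq
    obtain ⟨c', -, hc'⟩ := exists_localize c (haff.primeIdealOf ⟨q, hq⟩).asIdeal.primeCompl (V.O q)
    exact ⟨c', by simpa only [h1] using hc'⟩
  choose coords hcoords using hc
  refine ⟨⟨U, c, φ, fun q hq => V.germL U q hq _, fun q hq => V.isGenerator_germL he hq, ?_,
    fun q hq hcl => (hε q hq hcl).some, hO, coords, hcoords⟩, hpa⟩
  intro q hq s
  rw [← germL_smul]
  exact (V.germL_res (le_top : U ≤ ⊤) q hq s).symm.trans (congrArg (V.germL U q hq) (hφ s))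

end PolarizedVariety

end DiscriminantVariety
end

/-! ### Jets of sections, and R in terms of jets -/

noncomputable section
namespace DiscriminantVariety

namespace PolarizedVariety

variable {k : Type u} [Field k] {V : PolarizedVariety k} {n : ℕ}

lemma IsGenerator.mem_smul_top_iff {p : V.X} {e : V.LStalk p} (he : V.IsGenerator p e)
    (I : Ideal (V.O p)) (a : V.O p) :
    a • e ∈ I • (⊤ : Submodule (V.O p) (V.LStalk p)) ↔ a ∈ I := by
  have htop : (⊤ : Submodule (V.O p) (V.LStalk p)) = Submodule.span (V.O p) {e} := by
    rw [eq_comm, eq_top_iff]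
    intro t _
    obtain ⟨b, rfl⟩ := he.2 t
    exact Submodule.smul_mem _ _ (Submodule.mem_span_singleton_self e)
  rw [htop, Submodule.mem_smul_span_singleton]
  constructor
  · rintro ⟨y, hy, h⟩
    rwa [← he.1 h]
  · exact fun h => ⟨a, h, rfl⟩

lemma evalMap_surjective_of_le {M : Submodule k V.Sections} {p : V.X} {d d' : ℕ} (h : d ≤ d')
    (hs : Function.Surjective (V.evalMap M p d')) : Function.Surjective (V.evalMap M p d) := by
  intro t
  obtain ⟨t, rfl⟩ := Submodule.Quotient.mk_surjective _ t
  obtain ⟨f, hf⟩ := hs (Submodule.Quotient.mk t)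
  refine ⟨f, ?_⟩
  rw [evalMap, Submodule.Quotient.eq] at hf ⊢
  exact Submodule.smul_mono_left (Ideal.pow_le_pow_right (by omega)) hf

namespace Chart

variable (C : V.Chart n)

/-- The closed points of a chart. -/
abbrev Point : Type u := {q : V.X // q ∈ C.U ∧ IsClosed ({q} : Set V.X)}

/-- The value of a regular function at a closed point. -/
def ev (q : C.Point) : Γ(V.X, C.U) →ₐ[k] k :=
  (C.ε q q.2.1 q.2.2).comp (V.germₐ C.U q q.2.1)

/-- The Taylor expansion at a closed point of the local equation of a section. -/
def jet (q : C.Point) : V.Sections →ₗ[k] MvPowerSeries (Fin n) k :=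
  ((C.coords q q.2.1).taylorAt (C.ε q q.2.1 q.2.2)).toLinearMap ∘ₗ
    (V.germₐ C.U q q.2.1).toLinearMap ∘ₗ C.φ

lemma jet_apply (q : C.Point) (s : V.Sections) : C.jet q s =
    (C.coords q q.2.1).taylorAt (C.ε q q.2.1 q.2.2) (V.germ C.U q q.2.1 (C.φ s)) := rfl

lemma jet_eq_map (q : C.Point) (s : V.Sections) :
    C.jet q s = MvPowerSeries.map (C.ev q : Γ(V.X, C.U) →+* k) (C.c.T (C.φ s)) := by
  rw [jet_apply, TaylorCoords.taylorAt_apply, C.coords_T]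
  ext α
  simp only [MvPowerSeries.coeff_map]
  rfl

lemma isUnit_germ_iff (q : C.Point) (a : Γ(V.X, C.U)) :
    IsUnit (V.germ C.U q q.2.1 a) ↔ C.ev q a ≠ 0 := by
  rw [← notMem_maximalIdeal, TaylorCoords.mem_maximalIdeal_iff (C.ε q q.2.1 q.2.2)]
  rfl

/-- This is how surjectivity of the evaluation map is used throughout: sections in M with a
prescribed polynomial as d-jet. -/
lemma exists_jet_sub_mem {M : Submodule k V.Sections} (q : C.Point) {d : ℕ}
    (hs : Function.Surjective (V.evalMap M q d)) (G : MvPolynomial (Fin n) k) :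
    ∃ f : M, C.jet q f - (G : MvPowerSeries (Fin n) k) ∈ varIdeal k n ^ (d + 1) := by
  have := C.isNoetherianRing q q.2.1
  set c := C.coords q q.2.1
  set ε := C.ε q q.2.1 q.2.2
  obtain ⟨f, hf⟩ := hs (Submodule.Quotient.mk (c.polyEval ε G • C.e q q.2.1))
  refine ⟨f, ?_⟩
  rw [evalMap, Submodule.Quotient.eq, C.sectionGerm_eq q q.2.1, ← sub_smul,
    (C.isGenerator q q.2.1).mem_smul_top_iff, c.mem_pow_iff ε, map_sub, c.taylorAt_polyEval] at hf
  exact hf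

variable {M : Submodule k V.Sections}

/-- The point of a chart below a point of the product. -/
abbrev under (P : V.ProdPoint M) (hP : P.pt ∈ C.U) : C.Point := ⟨P.pt, hP, P.isClosed⟩

/-- Two generators of the stalk of the line bundle differ by a unit, whose Taylor expansion is the
factor G. -/
lemma exists_frame_factor {m : ℕ} {P : V.ProdPoint M} (hP : P.pt ∈ C.U) (𝔣 : Frame V M m P) :
    ∃ G : MvPowerSeries (Fin n) k, MvPowerSeries.constantCoeff G ≠ 0 ∧
      ∀ l, (C.coords P.pt hP).taylorAt (C.ε P.pt hP P.isClosed) (𝔣.φ l) =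
        G * C.jet (C.under P hP) (𝔣.b l) := by
  obtain ⟨a, ha⟩ := 𝔣.isGenerator.2 (C.e P.pt hP)
  obtain ⟨b, hb⟩ := (C.isGenerator P.pt hP).2 𝔣.e
  dsimp only at ha hb
  have hab : a * b = 1 := by
    apply 𝔣.isGenerator.1
    dsimp only
    rw [mul_comm, mul_smul, ha, hb, one_smul]
  refine ⟨(C.coords P.pt hP).taylorAt (C.ε P.pt hP P.isClosed) a, ?_, fun l => ?_⟩
  · rw [TaylorCoords.constantCoeff_taylorAt]
    intro h
    have := congrArg (C.ε P.pt hP P.isClosed) hab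
    rw [map_mul, h, zero_mul, map_one] at this
    exact zero_ne_one this
  · rw [jet_apply, ← map_mul]
    congr 1
    apply 𝔣.isGenerator.1
    dsimp only
    rw [← 𝔣.φ_spec, C.sectionGerm_eq P.pt hP, ← ha, smul_smul, mul_comm]

end Chart

lemma Frame.exists_isUnit_φ {m : ℕ} {P : V.ProdPoint M} (𝔣 : Frame V M m P)
    (hP : P.pt ∉ V.baseLocus M) : ∃ l, IsUnit (𝔣.φ l) := by
  by_contra! h
  apply hP
  intro s hs
  have h1 := 𝔣.b.sum_repr ⟨s, hs⟩
  have h2 : s = ∑ l, 𝔣.b.repr ⟨s, hs⟩ l • (𝔣.b l : V.Sections) := by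
    have := congrArg M.subtype h1
    rw [map_sum] at this
    exact this.symm
  rw [h2, map_sum]
  refine sum_mem fun l _ => ?_
  rw [sectionGerm_smul_const, 𝔣.φ_spec, smul_smul, 𝔣.isGenerator.mem_smul_top_iff]
  exact Ideal.mul_mem_left _ _ ((mem_maximalIdeal _).2 (h l))

lemma exists_basis_fin_zero_eq {k M : Type*} [Field k] [AddCommGroup M] [Module k M] {m : ℕ}
    (hM : Module.finrank k M = m + 1) {κ : Type*} (v : Option κ → M) (hv : LinearIndependent k v) :
    ∃ (b : Module.Basis (Fin (m + 1)) k M) (ι : κ → Fin m), Function.Injective ι ∧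
      b 0 = v none ∧ ∀ i, b (ι i).succ = v (some i) := by
  classical
  have : Module.Finite k M := Module.finite_of_finrank_pos (by omega)
  let B := Module.Basis.sumExtend hv
  have hB : ∀ i, B (Sum.inl i) = v i := fun i => by
    simp only [B, Module.Basis.sumExtend, Module.Basis.coe_reindex, Function.comp_apply,
      Module.Basis.coe_extend]
    rfl
  let I := Module.Basis.sumExtendIndex hv
  have hfin : Finite (Option κ ⊕ I) := Module.Finite.finite_basis B
  have hfin' : Finite (κ ⊕ I) := Finite.of_injective (Sum.map some id : κ ⊕ I → Option κ ⊕ I)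
    (Function.Injective.sumMap (Option.some_injective _) Function.injective_id)
  let e₀ : Option κ ⊕ I ≃ Option (κ ⊕ I) :=
    { toFun := Sum.elim (Option.map Sum.inl) fun i => some (Sum.inr i)
      invFun := fun
        | none => Sum.inl none
        | some (Sum.inl a) => Sum.inl (some a)
        | some (Sum.inr i) => Sum.inr i
      left_inv := by rintro ((_ | _) | _) <;> rfl
      right_inv := by rintro (_ | _ | _) <;> rfl }
  have hcard : Nat.card (κ ⊕ I) = m := by
    have h1 := Module.finrank_eq_nat_card_basis B
    rw [hM, Nat.card_congr e₀, Finite.card_option] at h1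
    omega
  let e₁ : κ ⊕ I ≃ Fin m := Finite.equivFinOfCardEq hcard
  let e : Option κ ⊕ I ≃ Fin (m + 1) :=
    e₀.trans ((Equiv.optionCongr e₁).trans (finSuccEquiv m).symm)
  refine ⟨B.reindex e, fun i => e₁ (Sum.inl i), fun i j h => Sum.inl_injective (e₁.injective h),
    ?_, fun i => ?_⟩
  · rw [← hB, Module.Basis.reindex_apply]
    exact congrArg B ((Equiv.symm_apply_eq _).2 (by simp [e, e₀]))
  · rw [← hB, Module.Basis.reindex_apply]
    exact congrArg B ((Equiv.symm_apply_eq _).2 (by simp [e, e₀]))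

lemma ProdPoint.f_ne_zero {M : Submodule k V.Sections} (P : V.ProdPoint M) : P.f ≠ 0 :=
  P.hyp.rep_nonzero

/-- The frame defined by a chart and a basis. -/
def Chart.frame (C : V.Chart n) {M : Submodule k V.Sections} {m : ℕ} {P : V.ProdPoint M}
    (hP : P.pt ∈ C.U) (b : Module.Basis (Fin (m + 1)) k M) (hb : b 0 = P.f) : Frame V M m P where
  e := C.e P.pt hP
  isGenerator := C.isGenerator P.pt hP
  b := b
  b_zero := hb
  φ l := V.germ C.U P.pt hP (C.φ (b l))
  φ_spec l := C.sectionGerm_eq P.pt hP (b l)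

/-- The frame in the definition of R is arbitrary, but the jets of f in a frame and in the chart
differ by a unit, which does not affect degeneracy. A frame exists because f can be completed to a
basis. -/
theorem mem_R_iff [CharP k 2] {M : Submodule k V.Sections} {m : ℕ} (hn : Even n)
    (hM : Module.finrank k M = m + 1) (C : V.Chart n) {P : V.ProdPoint M} (hP : P.pt ∈ C.U)
    (hI : P.pt ∈ V.immersedPart M n) :
    P ∈ V.R M n m ↔ IsDegenerate (C.jet (C.under P hP) P.f) := by
  have key : ∀ 𝔣 : Frame V M m P, 𝔣.idealR n ≠ ⊤ ↔ IsDegenerate (C.jet (C.under P hP) P.f) := by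
    intro 𝔣
    obtain ⟨G, hG, h⟩ := C.exists_frame_factor hP 𝔣
    rw [𝔣.idealR_ne_top_iff (C.coords P.pt hP) (C.ε P.pt hP P.isClosed) hn
      (𝔣.exists_isUnit_φ hI.1.2.2), h, isDegenerate_mul_iff hG, 𝔣.b_zero]
  obtain ⟨b, -, -, hb, -⟩ := exists_basis_fin_zero_eq hM (κ := PEmpty.{1}) (fun _ => P.f)
    (LinearIndependent.of_subsingleton none P.f_ne_zero)
  exact ⟨fun ⟨_, 𝔤, h⟩ => (key 𝔤).1 h, fun h => ⟨hI, C.frame hP b hb, (key _).2 h⟩⟩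

end PolarizedVariety

end DiscriminantVariety
end

/-! ### Smooth points of R and singularity types, from jets -/

noncomputable section
namespace DiscriminantVariety

section TwoJets

open MvPowerSeries

variable {k : Type*} [Field k] {n : ℕ}

lemma hessian_add (F G : MvPowerSeries (Fin n) k) : hessian (F + G) = hessian F + hessian G := by
  ext i j; simp [hessian_apply]

lemma hessian_smul (a : k) (F : MvPowerSeries (Fin n) k) : hessian (a • F) = a • hessian F := by
  ext i j; simp [hessian_apply]

lemma hessian_eq_zero_of_mem {F : MvPowerSeries (Fin n) k} (hF : F ∈ varIdeal k n ^ 3) :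
    hessian F = 0 := by
  ext i j
  have h := pderiv_mem_varIdeal_pow (pderiv_mem_varIdeal_pow hF j) i
  simp only [pow_one, Nat.add_one_sub_one, Nat.reduceSub] at h
  rw [hessian_apply]
  exact mem_varIdeal.1 h

lemma twoJet_eq {F G : MvPowerSeries (Fin n) k} (h : F - G ∈ varIdeal k n ^ 3) :
    constantCoeff F = constantCoeff G ∧
    (∀ i, constantCoeff (MvPowerSeries.pderiv k i F) =
      constantCoeff (MvPowerSeries.pderiv k i G)) ∧ hessian F = hessian G := by
  have h2 := mem_varIdeal_sq_iff.1 (Ideal.pow_le_pow_right (by norm_num : 2 ≤ 3) h)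
  refine ⟨by simpa [sub_eq_zero] using h2.1, fun i => by simpa [sub_eq_zero] using h2.2 i, ?_⟩
  have h3 := hessian_eq_zero_of_mem h
  have h4 := hessian_add (F - G) G
  rwa [sub_add_cancel, h3, zero_add] at h4

lemma hessian_X (i : Fin n) : hessian (X i : MvPowerSeries (Fin n) k) = 0 := by
  ext a b
  rw [hessian_apply, pderiv_X_eq]
  split_ifs <;> simp

lemma hessian_X_mul_X (i j a b : Fin n) : hessian (X i * X j : MvPowerSeries (Fin n) k) a b =
    (if a = i then 1 else 0) * (if b = j then 1 else 0) +
      (if a = j then 1 else 0) * (if b = i then 1 else 0) := by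
  rw [hessian_apply]
  simp only [Derivation.leibniz, map_add, smul_eq_mul, map_mul, pderiv_X_eq]
  split_ifs <;> simp

end TwoJets

namespace PolarizedVariety

variable {k : Type u} [Field k] {V : PolarizedVariety k} {r m : ℕ} {M : Submodule k V.Sections}
  (C : V.Chart (r + 2)) {P : V.ProdPoint M}

/-- The two-jets of the auxiliary sections. -/
def auxJet (k : Type*) [Field k] (r : ℕ) : Fin (r + 2) ⊕ Fin 2 → MvPolynomial (Fin (r + 2)) k :=
  Sum.elim MvPolynomial.X
    ![1, MvPolynomial.X (Fin.natAdd r 0) * MvPolynomial.X (Fin.natAdd r 1)]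

lemma hessian_corner : hessian (MvPowerSeries.X (Fin.natAdd r 0) * MvPowerSeries.X (Fin.natAdd r 1) :
    MvPowerSeries (Fin (r + 2)) k) = cornerMatrix k r := by
  have h01 : (Fin.natAdd r (0 : Fin 2)) ≠ Fin.natAdd r 1 := by simp [Fin.ext_iff]
  ext a b
  rw [hessian_X_mul_X, cornerMatrix, Matrix.of_apply]
  by_cases h1 : a = Fin.natAdd r 0 <;> by_cases h2 : a = Fin.natAdd r 1 <;>
    by_cases h3 : b = Fin.natAdd r 0 <;> by_cases h4 : b = Fin.natAdd r 1 <;> simp_all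

/-- Surjectivity onto 2-jets gives sections with jets xᵢ, 1 and ξ₁ξ₂. Together with f they are
linearly independent, so they extend to a basis of M, which gives an adapted frame. -/
theorem mem_RSmooth [CharP k 2] (hr : Even r) (hM : Module.finrank k M = m + 1)
    (hP : P.pt ∈ C.U) (hR : P ∈ V.R M (r + 2) m)
    (hs : Function.Surjective (V.evalMap M P.pt 2))
    (hB : (blockB (hessian (C.jet (C.under P hP) P.f))).det ≠ 0) :
    P ∈ V.RSmooth M (r + 2) m := by
  have hdeg := (mem_R_iff (hr.add even_two) hM C hP hR.1).1 hR
  choose g hg using fun s => C.exists_jet_sub_mem (C.under P hP) hs (auxJet k r s)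
  set q := C.under P hP
  set J : Fin (r + 2) ⊕ Fin 2 → MvPowerSeries (Fin (r + 2)) k := fun s => C.jet q (g s) with hJ
  set F := C.jet q P.f with hF
  have hF1 := mem_varIdeal_sq_iff.1 hdeg.1
  have hx := fun i => twoJet_eq (hg (Sum.inl i))
  have h1 := twoJet_eq (hg (Sum.inr 0))
  have hq := twoJet_eq (hg (Sum.inr 1))
  simp only [auxJet, Sum.elim_inl, Sum.elim_inr, Matrix.cons_val_zero, Matrix.cons_val_one,
    MvPolynomial.coe_X, MvPolynomial.coe_one, MvPolynomial.coe_mul, MvPowerSeries.constantCoeff_X,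
    pderiv_X_eq, map_one, map_mul, mul_zero, Derivation.leibniz, smul_eq_mul, map_add, zero_mul,
    hessian_X, hessian_corner, map_zero, add_zero, Derivation.map_one_eq_zero, apply_ite
      (MvPowerSeries.constantCoeff (R := k) (σ := Fin (r + 2)))] at hx h1 hq
  have hone : hessian (1 : MvPowerSeries (Fin (r + 2)) k) = 0 := by
    ext a b; simp [hessian_apply]
  rw [hone] at h1
  have hli : LinearIndependent k
      (fun o : Option (Fin (r + 2) ⊕ Fin 2) => o.elim P.f g) := by
    rw [Fintype.linearIndependent_iff]
    intro a ha
    simp only [Fintype.sum_option, Fintype.sum_sum_type, Fin.sum_univ_two, Option.elim] at ha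
    have hjet : a none • F + (∑ i, a (some (Sum.inl i)) • J (Sum.inl i) +
        (a (some (Sum.inr 0)) • J (Sum.inr 0) + a (some (Sum.inr 1)) • J (Sum.inr 1))) = 0 := by
      have := congrArg (C.jet q ∘ₗ M.subtype) ha
      simp only [map_add, map_sum, map_smul, map_zero] at this
      exact this
    have e1 : a (some (Sum.inr 0)) = 0 := by
      have := congrArg (MvPowerSeries.constantCoeff (R := k) (σ := Fin (r + 2))) hjet
      simpa [hJ, hx, h1.1, hq.1, hF1.1, MvPowerSeries.smul_eq_C_mul] using this
    have ex : ∀ l, a (some (Sum.inl l)) = 0 := by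
      intro l
      have := congrArg (fun G => MvPowerSeries.constantCoeff (MvPowerSeries.pderiv k l G)) hjet
      simpa [hJ, hx, h1.2.1, hq.2.1, hF1.2, MvPowerSeries.smul_eq_C_mul] using this
    have eH : a none • hessian F + a (some (Sum.inr 1)) • cornerMatrix k r = 0 := by
      have := congrArg hessian hjet
      simp only [ex, e1, zero_smul, Finset.sum_const_zero, zero_add, hessian_add, hessian_smul,
        hJ, hq.2.2] at this
      rw [this]
      exact hessian_eq_zero_of_mem (zero_mem _)
    -- A nontrivial relation would make a multiple of the Hessian of f equal to a nonzero multiple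
    -- of the corner matrix. Then that multiple of C vanishes and, since D = CᵀB⁻¹C, so does that of
    -- D, contradicting the corner entry.
    have e2 : a (some (Sum.inr 1)) = 0 := by
      by_contra hne
      have hC : a none • blockC (hessian F) = 0 := by
        ext i j
        have h3 := congr($eH (Fin.castAdd 2 i) (Fin.natAdd r j))
        have h4 : cornerMatrix k r (Fin.castAdd 2 i) (Fin.natAdd r j) = 0 := by
          rw [cornerMatrix, Matrix.of_apply, if_neg]
          simp only [Fin.ext_iff, Fin.val_castAdd, Fin.val_natAdd]
          have := i.2
          omega
        simp only [Matrix.add_apply, Matrix.smul_apply, h4, smul_zero, add_zero] at h3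
        exact h3
      have hD : a none • blockD (hessian F) = 0 := by
        have h3 := schur_eq_zero (isAlt_hessian F) hB hdeg.2
        rw [schur, sub_eq_zero] at h3
        rw [h3, ← Matrix.mul_smul, hC, Matrix.mul_zero]
      have h5 := congr($eH (Fin.natAdd r 0) (Fin.natAdd r 1))
      have h6 : (a none • hessian F) (Fin.natAdd r 0) (Fin.natAdd r 1) = 0 := congr($hD 0 1)
      rw [Matrix.add_apply, h6] at h5
      simp [cornerMatrix] at h5
      exact hne h5
    have e3 : a none = 0 := by
      simp only [ex, e1, e2, zero_smul, Finset.sum_const_zero, add_zero, smul_eq_zero] at ha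
      exact ha.resolve_right P.f_ne_zero
    rintro (_ | l | l)
    · exact e3
    · exact ex l
    · fin_cases l
      · exact e1
      · exact e2
  obtain ⟨b, ι, hι, hb, hbι⟩ := exists_basis_fin_zero_eq hM _ hli
  refine ⟨hR, C.frame hP b hb, ?_⟩
  have hφ (l) : (C.coords P.pt hP).taylorAt (C.ε P.pt hP P.isClosed) ((C.frame hP b hb).φ l) =
      C.jet q (b l) := rfl
  have had : (C.frame hP b hb).IsAdapted (C.coords P.pt hP) (C.ε P.pt hP P.isClosed) ι := by
    refine ⟨hι, fun i => ?_, fun i l => ?_, ?_, fun l => ?_, ?_, fun l => ?_, fun i j => ?_⟩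
    all_goals
      first
      | rw [← TaylorCoords.hessian_taylorAt, hφ, hbι]
      | rw [← TaylorCoords.constantCoeff_pderiv_taylorAt, hφ, hbι]
      | rw [← TaylorCoords.constantCoeff_taylorAt (C.coords P.pt hP), hφ, hbι]
    · exact (hx i).1
    · exact (hx i).2.1 l
    · exact h1.1
    · exact h1.2.1 l
    · exact hq.1
    · exact hq.2.1 l
    · exact congr($(hq.2.2) i j)
  have := C.isNoetherianRing P.pt hP
  refine had.isRegularLocalRing hr ?_ ?_
  · rw [hφ, hb]; exact hdeg
  · rw [hφ, hb]; exact hB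

variable [CharP k 2]

/-- The scalar c is absorbed by the generator of the line bundle, replaced by c⁻¹e, and the
automorphism g by the formal parameter system. -/
lemma singularOfForm_of_jet {n : ℕ} (C : V.Chart n) (hP : P.pt ∈ C.U) {c : k} (hc : c ≠ 0)
    (hF : C.jet (C.under P hP) (c • P.f : M) ∈ varIdeal k n ^ 2)
    {T : MvPowerSeries (Fin n) k → Prop}
    (g : MvPowerSeries (Fin n) k ≃ₐ[k] MvPowerSeries (Fin n) k)
    (hT : T (g (C.jet (C.under P hP) (c • P.f : M)))) : V.SingularOfForm T P.f P.pt := by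
  have := C.isNoetherianRing P.pt hP
  have hcc : algebraMap k (V.O P.pt) c⁻¹ * algebraMap k (V.O P.pt) c = 1 := by
    rw [← map_mul, inv_mul_cancel₀ hc, map_one]
  have h1 : V.IsLocalEquation P.f P.pt (V.germ C.U P.pt hP (C.φ (c • P.f : M))) := by
    have he := C.isGenerator P.pt hP
    refine ⟨algebraMap k (V.O P.pt) c⁻¹ • C.e P.pt hP, ⟨fun x y h => ?_, fun t => ?_⟩, ?_⟩
    · dsimp only at h
      rw [smul_smul, smul_smul] at h
      have h2 := he.1 h
      have h3 := congrArg (· * algebraMap k (V.O P.pt) c) h2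
      simpa only [mul_assoc, hcc, mul_one] using h3
    · obtain ⟨a, rfl⟩ := he.2 t
      refine ⟨a * algebraMap k (V.O P.pt) c, ?_⟩
      dsimp only
      rw [smul_smul, mul_assoc, mul_comm (algebraMap k (V.O P.pt) c), hcc, mul_one]
    · rw [smul_smul, mul_comm, ← smul_smul, ← C.sectionGerm_eq P.pt hP,
        Submodule.coe_smul, sectionGerm_smul_const, smul_smul, hcc, one_smul]
  refine ⟨_, h1, ((C.coords P.pt hP).mem_pow_iff (C.ε P.pt hP P.isClosed)).2 hF,
    g.symm.trans ((C.coords P.pt hP).formalParameters (C.ε P.pt hP P.isClosed)), ?_⟩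
  have h3 := (C.coords P.pt hP).formalParameters_symm_algebraMap (C.ε P.pt hP P.isClosed)
    (V.germ C.U P.pt hP (C.φ (c • P.f : M)))
  rw [C.jet_apply, ← h3] at hT
  exact hT

theorem isTypeA_of_jet (hr : Even r) (hP : P.pt ∈ C.U) {c : k} (hc : c ≠ 0)
    (hdeg : IsDegenerate (C.jet (C.under P hP) (c • P.f : M)))
    (hB : (blockB (hessian (C.jet (C.under P hP) (c • P.f : M)))).det ≠ 0)
    (hq : quadValue (C.jet (C.under P hP) (c • P.f : M))
      (kernelVector (C.jet (C.under P hP) (c • P.f : M))) ≠ 0) :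
    IsTypeA (r + 2) P := by
  obtain ⟨g, hg⟩ := exists_hasFormA hr hdeg hB hq
  exact singularOfForm_of_jet C hP hc hdeg.1 g hg

theorem isTypeC_of_jet (hP : P.pt ∈ C.U) {c : k} (hc : c ≠ 0)
    (hdeg : IsDegenerate (C.jet (C.under P hP) (c • P.f : M)))
    (hB : (blockB (hessian (C.jet (C.under P hP) (c • P.f : M)))).det ≠ 0)
    (hrank : Module.rank k (MvPowerSeries (Fin (r + 2)) k ⧸
      idealC (C.jet (C.under P hP) (c • P.f : M))) ≤ 4) :
    IsTypeC (r + 2) P :=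
  singularOfForm_of_jet C hP hc hdeg.1 AlgEquiv.refl
    ⟨rank_eq_of_block (isAlt_hessian _) hB hdeg.2, hrank⟩

omit [CharP k 2] in
-- The ideal for (R) contains the ideal for (C), so its quotient is no larger.
theorem IsTypeC.isTypeR {n : ℕ} (h : IsTypeC n P) : IsTypeR n P := by
  obtain ⟨φ, h1, h2, x, h3, h4⟩ := h
  refine ⟨φ, h1, h2, x, h3, le_trans ?_ h4⟩
  have hle := (le_sup_left : _ ≤ idealR (x.symm (algebraMap (V.O P.pt)
    (AdicCompletion (maximalIdeal (V.O P.pt)) (V.O P.pt)) φ)))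
  exact LinearMap.rank_le_of_surjective
    (Ideal.Quotient.factorₐ k hle).toLinearMap (Ideal.Quotient.factor_surjective hle)

end PolarizedVariety

end DiscriminantVariety
end

/-! ### The Zariski topology on the product -/

noncomputable section
namespace DiscriminantVariety

lemma eval₂_smul_of_isHomogeneous {R S σ : Type*} [CommRing R] [CommRing S] {d : ℕ}
    {F : MvPolynomial σ R} (hF : F.IsHomogeneous d) (f : R →+* S) (x : σ → S) (c : S) :
    MvPolynomial.eval₂ f (fun i => c * x i) F = c ^ d * MvPolynomial.eval₂ f x F := by
  rw [MvPolynomial.eval₂_eq, MvPolynomial.eval₂_eq, Finset.mul_sum]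
  refine Finset.sum_congr rfl fun α hα => ?_
  have hd : ∑ i ∈ α.support, α i = d := by
    have := hF (MvPolynomial.mem_support_iff.1 hα)
    rwa [Pi.one_def, ← Finsupp.degree_eq_weight_one] at this
  simp_rw [mul_pow]
  rw [Finset.prod_mul_distrib, Finset.prod_pow_eq_pow_sum, hd]
  ring

namespace PolarizedVariety

variable {k : Type u} [Field k] {V : PolarizedVariety k} {M : Submodule k V.Sections} {n : ℕ}

namespace ProdPoint

/-- The point `(q, [f])`. -/
def of (q : V.X) (hq : IsClosed ({q} : Set V.X)) (f : M) (hf : f ≠ 0) : V.ProdPoint M :=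
  ⟨q, hq, Projectivization.mk k f hf⟩

/-- The representative chosen for [f] is only a multiple of f; hence the scalar c that accompanies
many later statements. -/
lemma exists_f_of {q : V.X} {hq : IsClosed ({q} : Set V.X)} {f : M} {hf : f ≠ 0} :
    ∃ c : k, c ≠ 0 ∧ (of q hq f hf).f = c • f := by
  obtain ⟨a, ha⟩ := Projectivization.exists_smul_eq_mk_rep k f hf
  exact ⟨a, a.ne_zero, ha.symm⟩

lemma of_f (P : V.ProdPoint M) : of P.pt P.isClosed P.f P.f_ne_zero = P := by
  obtain ⟨p, hp, h⟩ := P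
  simp only [of, f, Projectivization.mk_rep]

/-- The subbasic open sets. -/
def basicSet (U : V.X.Opens) (b : Module.Basis (Fin (Module.finrank k M)) k M)
    (F : MvPolynomial (Fin (Module.finrank k M)) Γ(V.X, U)) : Set (V.ProdPoint M) :=
  {P | ∃ hp : P.pt ∈ U, IsUnit (MvPolynomial.eval₂ (V.germ U P.pt hp)
        (fun i => algebraMap k (V.O P.pt) (b.repr P.f i)) F)}

lemma isOpen_basicSet {U : V.X.Opens} {b : Module.Basis (Fin (Module.finrank k M)) k M} {d : ℕ}
    {F : MvPolynomial (Fin (Module.finrank k M)) Γ(V.X, U)} (hF : F.IsHomogeneous d) :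
    IsOpen (basicSet U b F) :=
  TopologicalSpace.isOpen_generateFrom_of_mem ⟨U, b, d, F, hF, rfl⟩

lemma of_mem_basicSet {U : V.X.Opens} {b : Module.Basis (Fin (Module.finrank k M)) k M} {d : ℕ}
    {F : MvPolynomial (Fin (Module.finrank k M)) Γ(V.X, U)} (hF : F.IsHomogeneous d)
    {q : V.X} {hq : IsClosed ({q} : Set V.X)} {f : M} {hf : f ≠ 0} :
    of q hq f hf ∈ basicSet U b F ↔ ∃ hp : q ∈ U, IsUnit (MvPolynomial.eval₂ (V.germ U q hp)
        (fun i => algebraMap k (V.O q) (b.repr f i)) F) := by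
  obtain ⟨c, hc, h⟩ := exists_f_of (hq := hq) (hf := hf)
  refine exists_congr fun hp => ?_
  have h1 : (fun i => algebraMap k (V.O q) (b.repr (of q hq f hf).f i)) =
      fun i => algebraMap k (V.O q) c * algebraMap k (V.O q) (b.repr f i) := by
    ext i
    rw [h, map_smul, Finsupp.smul_apply, smul_eq_mul, map_mul]
  have h2 := eval₂_smul_of_isHomogeneous hF (V.germ U q hp)
    (fun i => algebraMap k (V.O q) (b.repr f i)) (algebraMap k (V.O q) c)
  rw [← h1] at h2
  refine (iff_of_eq (congrArg IsUnit h2)).trans ?_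
  have hu : IsUnit (algebraMap k (V.O q) c ^ d) := ((isUnit_iff_ne_zero.2 hc).map _).pow d
  exact ⟨fun h => isUnit_of_mul_isUnit_right h, fun h => hu.mul h⟩

/-- Induction over open sets. -/
lemma isOpen_induction {p : Set (V.ProdPoint M) → Prop}
    (basic : ∀ U b d F, MvPolynomial.IsHomogeneous F d → p (basicSet U b F))
    (univ : p Set.univ) (inter : ∀ s t, p s → p t → p (s ∩ t))
    (sUnion : ∀ S : Set (Set (V.ProdPoint M)), (∀ s ∈ S, p s) → p (⋃₀ S))
    {W : Set (V.ProdPoint M)} (hW : IsOpen W) : p W := by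
  induction hW with
  | basic s hs =>
    obtain ⟨U, b, d, F, hF, rfl⟩ := hs
    exact basic U b d F hF
  | univ => exact univ
  | inter s t _ _ h1 h2 => exact inter s t h1 h2
  | sUnion S _ h => exact sUnion S h

end ProdPoint

open ProdPoint

namespace Chart

variable (C : V.Chart n)

/-- A family of sections parametrised by the points of the chart. -/
def IsRegularFamily (g : C.Point → M) : Prop :=
  ∀ ℓ : M →ₗ[k] k, ∃ a : Γ(V.X, C.U), ∀ q, ℓ (g q) = C.ev q a

/-- A regular family of sections defines a continuous map to the product. For a basic open set,
substituting the coordinates of the family into its polynomial yields a regular function, whose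
nonvanishing locus is the required neighbourhood. -/
lemma exists_open_of_mem {g : C.Point → M} (hg : C.IsRegularFamily g) {W : Set (V.ProdPoint M)}
    (hW : IsOpen W) (p : C.Point) (hgp : g p ≠ 0) (hp : of p p.2.2 (g p) hgp ∈ W) :
    ∃ U : V.X.Opens, (p : V.X) ∈ U ∧ ∀ q : C.Point, (q : V.X) ∈ U → ∀ hgq : g q ≠ 0,
      of q q.2.2 (g q) hgq ∈ W := by
  revert hp
  refine isOpen_induction (p := fun W => of p p.2.2 (g p) hgp ∈ W → ∃ U : V.X.Opens,
    (p : V.X) ∈ U ∧ ∀ q : C.Point, (q : V.X) ∈ U → ∀ hgq : g q ≠ 0, of q q.2.2 (g q) hgq ∈ W)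
    ?_ ?_ ?_ ?_ hW
  rotate_left
  · exact fun _ => ⟨⊤, trivial, fun _ _ _ => trivial⟩
  · intro s t hs ht hp
    obtain ⟨U₁, h1, h1'⟩ := hs hp.1
    obtain ⟨U₂, h2, h2'⟩ := ht hp.2
    exact ⟨U₁ ⊓ U₂, ⟨h1, h2⟩, fun q hq hgq => ⟨h1' q hq.1 hgq, h2' q hq.2 hgq⟩⟩
  · rintro S ih ⟨s, hs, hps⟩
    obtain ⟨U, h1, h2⟩ := ih s hs hps
    exact ⟨U, h1, fun q hq hgq => ⟨s, hs, h2 q hq hgq⟩⟩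
  · intro U b d F hF hp
    choose a ha using fun i => hg (b.coord i)
    obtain ⟨hpU, hpu⟩ := (of_mem_basicSet hF).1 hp
    let U' := U ⊓ C.U
    let res₁ : Γ(V.X, U) →+* Γ(V.X, U') := (V.X.presheaf.map (homOfLE inf_le_left).op).hom
    let res₂ : Γ(V.X, C.U) →+* Γ(V.X, U') := (V.X.presheaf.map (homOfLE inf_le_right).op).hom
    let Δ : Γ(V.X, U') := MvPolynomial.eval₂ res₁ (fun i => res₂ (a i)) F
    have key : ∀ q : C.Point, ∀ hq : (q : V.X) ∈ U, IsUnit (V.germ U' q ⟨hq, q.2.1⟩ Δ) ↔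
        IsUnit (MvPolynomial.eval₂ (V.germ U q hq)
          (fun i => algebraMap k (V.O q) (b.repr (g q) i)) F) := by
      intro q hq
      rw [← notMem_maximalIdeal, ← notMem_maximalIdeal,
        TaylorCoords.mem_maximalIdeal_iff (C.ε q q.2.1 q.2.2),
        TaylorCoords.mem_maximalIdeal_iff (C.ε q q.2.1 q.2.2)]
      refine not_congr (Eq.congr_left ?_)
      let ε : V.O (q : V.X) →+* k := (C.ε q q.2.1 q.2.2 : V.O (q : V.X) →+* k)
      change ε (V.germ U' q ⟨hq, q.2.1⟩ Δ) = ε _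
      rw [MvPolynomial.hom_eval₂, MvPolynomial.hom_eval₂, MvPolynomial.hom_eval₂]
      congr 1
      · ext x
        exact congrArg ε (V.germ_res (inf_le_left : U' ≤ U) q ⟨hq, q.2.1⟩ x)
      · ext i
        have h1 : ε (algebraMap k (V.O (q : V.X)) (b.repr (g q) i)) = b.repr (g q) i :=
          (C.ε q q.2.1 q.2.2).commutes _
        exact (congrArg ε (V.germ_res (inf_le_right : U' ≤ C.U) q ⟨hq, q.2.1⟩ (a i))).trans
          ((ha i q).symm.trans h1.symm)
    refine ⟨V.X.basicOpen Δ, ?_, fun q hq hgq => ?_⟩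
    · rw [Scheme.mem_basicOpen _ _ _ (show (p : V.X) ∈ U' from ⟨hpU, p.2.1⟩)]
      exact (key p hpU).2 hpu
    · have hqU' := V.X.basicOpen_le Δ hq
      rw [Scheme.mem_basicOpen _ _ _ hqU'] at hq
      exact (of_mem_basicSet hF).2 ⟨hqU'.1, (key q hqU'.1).1 hq⟩

end Chart

end PolarizedVariety

end DiscriminantVariety
end

/-! ### Polynomial curves and the universal Taylor expansion -/

noncomputable section
namespace DiscriminantVariety

/-- Polynomial functions of one variable. -/
def IsPolyFun {k : Type*} [CommRing k] (g : k → k) : Prop :=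
  ∃ p : Polynomial k, ∀ s, g s = p.eval s

namespace IsPolyFun

variable {k : Type*} [CommRing k] {g h : k → k}

lemma const (a : k) : IsPolyFun fun _ => a := ⟨Polynomial.C a, by simp⟩

lemma id : IsPolyFun fun s : k => s := ⟨Polynomial.X, by simp⟩

lemma add (hg : IsPolyFun g) (hh : IsPolyFun h) : IsPolyFun fun s => g s + h s := by
  obtain ⟨p, hp⟩ := hg
  obtain ⟨q, hq⟩ := hh
  exact ⟨p + q, fun s => by simp [hp, hq]⟩

lemma mul (hg : IsPolyFun g) (hh : IsPolyFun h) : IsPolyFun fun s => g s * h s := by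
  obtain ⟨p, hp⟩ := hg
  obtain ⟨q, hq⟩ := hh
  exact ⟨p * q, fun s => by simp [hp, hq]⟩

lemma sum {ι : Type*} (t : Finset ι) {g : ι → k → k} (hg : ∀ i, IsPolyFun (g i)) :
    IsPolyFun fun s => ∑ i ∈ t, g i s := by
  choose p hp using hg
  exact ⟨∑ i ∈ t, p i, fun s => by simp [hp, Polynomial.eval_finset_sum]⟩

lemma finite_zeros [IsDomain k] (hg : IsPolyFun g) {s₀ : k} (h : g s₀ ≠ 0) :
    {s | g s = 0}.Finite := by
  classical
  obtain ⟨p, hp⟩ := hg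
  have hp0 : p ≠ 0 := by
    rintro rfl
    simp [hp] at h
  refine (p.roots.toFinset.finite_toSet).subset fun s hs => ?_
  rw [Set.mem_setOf_eq, hp] at hs
  simp [hp0, Polynomial.IsRoot, hs]

end IsPolyFun

namespace PolarizedVariety

variable {k : Type u} [Field k] {V : PolarizedVariety k} {M : Submodule k V.Sections} {n : ℕ}

open ProdPoint

namespace Chart

variable (C : V.Chart n)

section EvalAt

variable (b : Module.Basis (Fin (Module.finrank k M)) k M)

/-- The value of a polynomial function at a closed point and a section. -/
def evalAt (q : C.Point) (f : M) :
    MvPolynomial (Fin (Module.finrank k M)) Γ(V.X, C.U) →ₐ[k] k where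
  __ := MvPolynomial.eval₂Hom (C.ev q : Γ(V.X, C.U) →+* k) (b.repr f)
  commutes' c := (MvPolynomial.eval₂_C _ _ _).trans ((C.ev q).commutes c)

lemma evalAt_apply (q : C.Point) (f : M)
    (F : MvPolynomial (Fin (Module.finrank k M)) Γ(V.X, C.U)) :
    C.evalAt b q f F = MvPolynomial.eval₂ (C.ev q : Γ(V.X, C.U) →+* k) (b.repr f) F := rfl

lemma isUnit_eval₂_iff (q : C.Point) (f : M)
    (F : MvPolynomial (Fin (Module.finrank k M)) Γ(V.X, C.U)) :
    IsUnit (MvPolynomial.eval₂ (V.germ C.U q q.2.1)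
      (fun i => algebraMap k (V.O (q : V.X)) (b.repr f i)) F) ↔ C.evalAt b q f F ≠ 0 := by
  rw [← notMem_maximalIdeal, TaylorCoords.mem_maximalIdeal_iff (C.ε q q.2.1 q.2.2)]
  refine not_congr (Eq.congr_left ?_)
  refine (MvPolynomial.hom_eval₂ F (V.germ C.U q q.2.1)
    (C.ε q q.2.1 q.2.2 : V.O (q : V.X) →+* k) _).trans ?_
  rw [evalAt_apply]
  congr 1
  ext i
  exact (C.ε q q.2.1 q.2.2).commutes _

lemma evalAt_smul (q : C.Point) (f : M) (c : k)
    (F : MvPolynomial (Fin (Module.finrank k M)) Γ(V.X, C.U)) :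
    C.evalAt b q (c • f) F = ∑ d ∈ Finset.range (F.totalDegree + 1),
      c ^ d * C.evalAt b q f (MvPolynomial.homogeneousComponent d F) := by
  conv_lhs => rw [← MvPolynomial.sum_homogeneousComponent F]
  rw [map_sum]
  refine Finset.sum_congr rfl fun d _ => ?_
  have h : (b.repr (c • f) : Fin (Module.finrank k M) → k) = fun i => c * b.repr f i := by
    ext i; simp
  rw [evalAt_apply, evalAt_apply, h, eval₂_smul_of_isHomogeneous
    (MvPolynomial.homogeneousComponent_isHomogeneous d F)]

/-- Since Δ need not be homogeneous, the set is described as the union of the nonvanishing loci of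
its homogeneous components. If one component is nonzero at a point, then Δ is nonzero at some
nonzero multiple of f because k is infinite. -/
lemma isOpen_evalAt_ne_zero [Infinite k]
    (Δ : MvPolynomial (Fin (Module.finrank k M)) Γ(V.X, C.U)) :
    IsOpen {P : V.ProdPoint M | ∃ hP : P.pt ∈ C.U, ∃ c : k, c ≠ 0 ∧
      C.evalAt b (C.under P hP) (c • P.f) Δ ≠ 0} := by
  have : {P : V.ProdPoint M | ∃ hP : P.pt ∈ C.U, ∃ c : k, c ≠ 0 ∧
      C.evalAt b (C.under P hP) (c • P.f) Δ ≠ 0} =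
      ⋃ d, basicSet C.U b (MvPolynomial.homogeneousComponent d Δ) := by
    ext P
    rw [Set.mem_setOf_eq, Set.mem_iUnion]
    constructor
    · rintro ⟨hP, c, -, h⟩
      rw [evalAt_smul] at h
      obtain ⟨d, -, hd⟩ := Finset.exists_ne_zero_of_sum_ne_zero h
      exact ⟨d, hP, (C.isUnit_eval₂_iff b (C.under P hP) P.f _).2 (right_ne_zero_of_mul hd)⟩
    · rintro ⟨d, hP, h⟩
      have hd := (C.isUnit_eval₂_iff b (C.under P hP) P.f _).1 h
      refine ⟨hP, ?_⟩
      let p : Polynomial k := ∑ d ∈ Finset.range (Δ.totalDegree + 1), Polynomial.monomial d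
        (C.evalAt b (C.under P hP) P.f (MvPolynomial.homogeneousComponent d Δ))
      have hp : ∀ c, p.eval c = C.evalAt b (C.under P hP) (c • P.f) Δ := fun c => by
        rw [evalAt_smul, Polynomial.eval_finset_sum]
        exact Finset.sum_congr rfl fun d _ => by rw [Polynomial.eval_monomial, mul_comm]
      have hlt : d < Δ.totalDegree + 1 := by
        by_contra hlt
        rw [MvPolynomial.homogeneousComponent_eq_zero d Δ (by omega), map_zero] at hd
        exact hd rfl
      have hp0 : p ≠ 0 := fun h0 => hd (by
        have := congrArg (Polynomial.coeff · d) h0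
        simpa [p, Polynomial.finset_sum_coeff, Polynomial.coeff_monomial, hlt] using this)
      by_contra! hc
      -- The factor X takes care of c = 0, which is not covered by the assumption.
      have : Polynomial.X * p = 0 := Polynomial.funext fun c => by
        rw [Polynomial.eval_mul, Polynomial.eval_X, hp, Polynomial.eval_zero]
        rcases eq_or_ne c 0 with rfl | h
        · rw [zero_mul]
        · rw [hc c h, mul_zero]
      exact hp0 ((mul_eq_zero.1 this).resolve_left Polynomial.X_ne_zero)
  rw [this]
  exact isOpen_iUnion fun d => isOpen_basicSet
    (MvPolynomial.homogeneousComponent_isHomogeneous d Δ)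

/-- The universal Taylor expansion. -/
def universalJet :
    MvPowerSeries (Fin n) (MvPolynomial (Fin (Module.finrank k M)) Γ(V.X, C.U)) :=
  ∑ i, MvPowerSeries.C (MvPolynomial.X i) *
    MvPowerSeries.map MvPolynomial.C (C.c.T (C.φ (b i : V.Sections)))

lemma map_universalJet (q : C.Point) (f : M) :
    MvPowerSeries.map (C.evalAt b q f : _ →+* k) (C.universalJet b) = C.jet q f := by
  have h1 : C.jet q f = ∑ i, b.repr f i • C.jet q (b i : V.Sections) := by
    conv_lhs => rw [← b.sum_repr f]
    rw [← M.subtype_apply, map_sum, map_sum]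
    exact Finset.sum_congr rfl fun i _ => by rw [map_smul, map_smul, M.subtype_apply]
  rw [h1, universalJet, map_sum]
  refine Finset.sum_congr rfl fun i _ => ?_
  rw [map_mul, MvPowerSeries.map_C, MvPowerSeries.smul_eq_C_mul, C.jet_eq_map]
  congr 1
  · congr 1
    exact MvPolynomial.eval₂_X _ _ _
  · ext α
    rw [MvPowerSeries.coeff_map, MvPowerSeries.coeff_map, MvPowerSeries.coeff_map]
    exact MvPolynomial.eval₂_C _ _ _

end EvalAt

/-- A polynomial family of sections. -/
def _root_.DiscriminantVariety.IsPolyCurve {k M : Type*} [CommRing k] [AddCommGroup M] [Module k M]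
    (g : k → M) : Prop := ∀ ℓ : M →ₗ[k] k, IsPolyFun fun s => ℓ (g s)

/-- An open set that contains one point of a polynomial curve in a fibre contains all but finitely
many of them: on a basic open set the condition is the nonvanishing of a one-variable polynomial. -/
lemma finite_notMem [Module.Finite k M] {g : k → M} (hg : IsPolyCurve g) (q : C.Point)
    {W : Set (V.ProdPoint M)} (hW : IsOpen W) {s₀ : k} (h0 : g s₀ ≠ 0)
    (h : of q q.2.2 (g s₀) h0 ∈ W) : {s | ∀ hs : g s ≠ 0, of q q.2.2 (g s) hs ∉ W}.Finite := by
  have hz : {s | g s = 0}.Finite := by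
    have h1 : (Module.finBasis k M).repr (g s₀) ≠ 0 := fun h =>
      h0 ((Module.finBasis k M).repr.map_eq_zero_iff.1 h)
    obtain ⟨i, hi⟩ := Finsupp.ne_iff.1 h1
    refine ((hg ((Module.finBasis k M).coord i)).finite_zeros hi).subset fun s hs => ?_
    rw [Set.mem_setOf_eq] at hs ⊢
    rw [hs, map_zero]
  revert h
  refine isOpen_induction (p := fun W => of q q.2.2 (g s₀) h0 ∈ W →
    {s | ∀ hs : g s ≠ 0, of q q.2.2 (g s) hs ∉ W}.Finite) ?_ ?_ ?_ ?_ hW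
  · intro U b d F hF h
    obtain ⟨hqU, hu⟩ := (of_mem_basicSet hF).1 h
    choose p hp using fun i => hg (b.coord i)
    let ε : V.O (q : V.X) →+* k := (C.ε q q.2.1 q.2.2 : V.O (q : V.X) →+* k)
    let P : Polynomial k := MvPolynomial.eval₂
      (Polynomial.C.comp (ε.comp (V.germ U q hqU))) p F
    have key : ∀ s, P.eval s ≠ 0 ↔ IsUnit (MvPolynomial.eval₂ (V.germ U q hqU)
        (fun i => algebraMap k (V.O (q : V.X)) (b.repr (g s) i)) F) := by
      intro s
      rw [← notMem_maximalIdeal, TaylorCoords.mem_maximalIdeal_iff (C.ε q q.2.1 q.2.2)]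
      refine not_congr (Eq.congr_left ?_)
      change Polynomial.evalRingHom s P = ε _
      rw [MvPolynomial.hom_eval₂, MvPolynomial.hom_eval₂]
      congr 1
      · ext x; simp
      · ext i
        exact (hp i s).symm.trans ((C.ε q q.2.1 q.2.2).commutes _).symm
    have hP : IsPolyFun fun s => P.eval s := ⟨P, fun _ => rfl⟩
    refine ((hP.finite_zeros ((key s₀).2 hu)).union hz).subset ?_
    intro s hs
    by_contra hcon
    rw [Set.mem_union, not_or] at hcon
    exact hs hcon.2 ((of_mem_basicSet hF).2 ⟨hqU, (key s).1 hcon.1⟩)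
  · exact fun _ => hz.subset fun s hs => by_contra fun h => hs h trivial
  · intro s t hs ht h
    refine ((hs h.1).union (ht h.2)).subset fun x hx => ?_
    by_contra hcon
    simp only [Set.mem_union, Set.mem_setOf_eq, not_or, not_forall, not_not] at hcon
    obtain ⟨⟨h1, h2⟩, h3, h4⟩ := hcon
    exact hx h1 ⟨h2, h4⟩
  · rintro S ih ⟨s, hs, h⟩
    exact (ih s hs h).subset fun x hx h1 h2 => hx h1 ⟨s, hs, h2⟩

end Chart

end PolarizedVariety

end DiscriminantVariety
end

/-! ### Irreducibility of the fibres of R, and local sections of R -/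

noncomputable section
namespace DiscriminantVariety

/-- A degenerate alternating matrix is induced from a smaller space. -/
lemma exists_degenerate_factor {k : Type*} [Field k] {n : ℕ} [NeZero n]
    {H : Matrix (Fin n) (Fin n) k} (hH : IsAlt H) (hd : H.det = 0) :
    ∃ G K : Matrix (Fin n) (Fin n) k, IsAlt K ∧ (∀ i, G i 0 = 0) ∧ H = G * K * G.transpose := by
  obtain ⟨w, hw0, hw⟩ := Matrix.exists_mulVec_eq_zero_iff.2 hd
  obtain ⟨j, hj⟩ := Function.ne_iff.1 hw0
  rw [Pi.zero_apply] at hj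
  -- With w in the kernel and wⱼ ≠ 0, the matrix G = 1 - wⱼ⁻¹ eⱼ wᵀ has zero column j and satisfies
  -- GH = H, so H = G H Gᵀ. The transposition of 0 and j then moves the zero column to the front.
  let G : Matrix (Fin n) (Fin n) k := 1 - Matrix.vecMulVec (Pi.single j (w j)⁻¹) w
  have hGH : G * H = H := by
    have h1 : Matrix.vecMul w H = 0 := by
      rw [← hH.transpose_eq, Matrix.vecMul_transpose, hw]
    rw [Matrix.sub_mul, one_mul, Matrix.vecMulVec_mul, h1, Matrix.vecMulVec_zero, sub_zero]
  have hHG : H * G.transpose = H := by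
    have := congrArg Matrix.transpose hGH
    rwa [Matrix.transpose_mul, hH.transpose_eq] at this
  let σ := Equiv.swap 0 j
  refine ⟨G.submatrix id σ, H.submatrix σ σ, hH.submatrix σ, fun i => ?_, ?_⟩
  · simp only [Matrix.submatrix_apply, σ, Equiv.swap_apply_left, G, Matrix.sub_apply,
      Matrix.vecMulVec_apply, Matrix.one_apply, id]
    rcases eq_or_ne i j with rfl | h
    · simp [hj]
    · simp [h]
  · rw [Matrix.submatrix_mul_equiv, Matrix.transpose_submatrix, Matrix.submatrix_mul_equiv,
      hGH, hHG]
    rfl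

section Quad

open MvPowerSeries

variable {k : Type*} [Field k] {n : ℕ}

lemma hasQuad_quadMatrix [CharP k 2] {F : MvPowerSeries (Fin n) k} (hF : F ∈ varIdeal k n ^ 2) :
    HasQuad F (quadMatrix F) := by
  obtain ⟨M, hM⟩ := exists_hasQuad hF
  have : CharP (MvPowerSeries (Fin n) k) 2 := charP_of_injective_ringHom
    (f := (C : k →+* MvPowerSeries (Fin n) k)) (C_injective) 2
  have h1 := (hM.isAlt.map (C : k →+* MvPowerSeries (Fin n) k)).sum_mul_mul_self X
  have h2 : ∑ i, ∑ j, C (M i j) * (X i * X j : MvPowerSeries (Fin n) k) =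
      ∑ i, ∑ j, C (quadMatrix F i j) * (X i * X j) := by
    rw [← sub_eq_zero, ← h1]
    simp only [← Finset.sum_sub_distrib, Matrix.map_apply, Matrix.sub_apply, map_sub]
    refine Finset.sum_congr rfl fun i _ => Finset.sum_congr rfl fun j _ => ?_
    ring
  rwa [HasQuad, ← h2]

lemma HasQuad.mem_sq {F : MvPowerSeries (Fin n) k} {U : Matrix (Fin n) (Fin n) k}
    (h : HasQuad F U) : F ∈ varIdeal k n ^ 2 := by
  have h1 : ∑ i, ∑ j, C (U i j) * (X i * X j : MvPowerSeries (Fin n) k) ∈ varIdeal k n ^ 2 :=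
    sum_mem fun i _ => sum_mem fun j _ => Ideal.mul_mem_left _ _ (by
      rw [sq]; exact Ideal.mul_mem_mul (X_mem_varIdeal i) (X_mem_varIdeal j))
  simpa using add_mem (Ideal.pow_le_pow_right (by norm_num : 2 ≤ 3) h) h1

lemma hasQuad_sum {g : Fin n → Fin n → MvPowerSeries (Fin n) k}
    (hg : ∀ i j, g i j - X i * X j ∈ varIdeal k n ^ 3) {F : MvPowerSeries (Fin n) k}
    (hF : F ∈ varIdeal k n ^ 3) (U : Matrix (Fin n) (Fin n) k) :
    HasQuad (F + ∑ i, ∑ j, U i j • g i j) U := by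
  rw [HasQuad, add_sub_assoc, ← Finset.sum_sub_distrib]
  refine add_mem hF (sum_mem fun i _ => ?_)
  rw [← Finset.sum_sub_distrib]
  refine sum_mem fun j _ => ?_
  rw [smul_eq_C_mul, ← mul_sub]
  exact Ideal.mul_mem_left _ _ (hg i j)

lemma IsDegenerate.of_sub_mem {F G : MvPowerSeries (Fin n) k} (hG : IsDegenerate G)
    (h : F - G ∈ varIdeal k n ^ 3) : IsDegenerate F := by
  refine ⟨?_, (twoJet_eq h).2.2 ▸ hG.2⟩
  simpa using add_mem (Ideal.pow_le_pow_right (by norm_num : 2 ≤ 3) h) hG.1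

lemma IsDegenerate.smul {F : MvPowerSeries (Fin n) k} (hF : IsDegenerate F) (a : k) :
    IsDegenerate (a • F) := by
  rw [smul_eq_C_mul]
  exact hF.mul _

end Quad

lemma IsPolyFun.matrix_mul {k : Type*} [CommRing k] {l m n : Type*} [Fintype m]
    {A : k → Matrix l m k} {B : k → Matrix m n k} (hA : ∀ i j, IsPolyFun fun s => A s i j)
    (hB : ∀ i j, IsPolyFun fun s => B s i j) (i : l) (j : n) :
    IsPolyFun fun s => (A s * B s) i j := by
  simp only [Matrix.mul_apply]
  exact .sum _ fun x => (hA i x).mul (hB x j)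

namespace PolarizedVariety

variable {k : Type u} [Field k] [CharP k 2] [Infinite k] {V : PolarizedVariety k}
  {M : Submodule k V.Sections} {n : ℕ} [NeZero n]

open ProdPoint

namespace Chart

variable (C : V.Chart n)

/-- The fibres of `R` over the points of `X` are irreducible. -/
theorem exists_mem_inter_of_fibre [Module.Finite k M] (q : C.Point)
    (hs : Function.Surjective (V.evalMap M q 2)) {W₁ W₂ : Set (V.ProdPoint M)} (hW₁ : IsOpen W₁)
    (hW₂ : IsOpen W₂) {f₁ f₂ : M} (h₁ : f₁ ≠ 0) (h₂ : f₂ ≠ 0)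
    (hd₁ : IsDegenerate (C.jet q f₁)) (hd₂ : IsDegenerate (C.jet q f₂))
    (hm₁ : of q q.2.2 f₁ h₁ ∈ W₁) (hm₂ : of q q.2.2 f₂ h₂ ∈ W₂) :
    ∃ (f : M) (hf : f ≠ 0), IsDegenerate (C.jet q f) ∧ of q q.2.2 f hf ∈ W₁ ∩ W₂ := by
  choose g hg using fun i j => C.exists_jet_sub_mem q hs (MvPolynomial.X i * MvPolynomial.X j)
  simp only [MvPolynomial.coe_mul, MvPolynomial.coe_X] at hg
  obtain ⟨G₁, K₁, hK₁, hG₁, hH₁⟩ := exists_degenerate_factor (isAlt_hessian _) hd₁.2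
  obtain ⟨G₂, K₂, hK₂, hG₂, hH₂⟩ := exists_degenerate_factor (isAlt_hessian _) hd₂.2
  set Q₁ := quadMatrix (C.jet q f₁) with hQ₁
  set Q₂ := quadMatrix (C.jet q f₂) with hQ₂
  -- The factors, not the Hessians, are interpolated: G(s) keeps its zero column, so G(s) K(s) G(s)ᵀ
  -- is degenerate for every s, which a line joining the two Hessians would not guarantee.
  let G (s : k) : Matrix (Fin n) (Fin n) k := Matrix.of fun i j => G₁ i j + s * (G₂ i j - G₁ i j)
  let K (s : k) : Matrix (Fin n) (Fin n) k := Matrix.of fun i j => K₁ i j + s * (K₂ i j - K₁ i j)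
  let H (s : k) : Matrix (Fin n) (Fin n) k := G s * K s * (G s).transpose
  -- The quadratic part with polar form H(s). Its squares are invisible to H(s) and are interpolated
  -- linearly.
  let U (s : k) : Matrix (Fin n) (Fin n) k := Matrix.of fun i j =>
    if i < j then H s i j else if i = j then Q₁ i j + s * (Q₂ i j - Q₁ i j) else 0
  -- κ removes the quadratic part, leaving a section that vanishes to order three. This remainder,
  -- interpolated linearly, ensures that the curve passes exactly through f₁ and f₂.
  let κ (f : M) : M := f - ∑ i, ∑ j, quadMatrix (C.jet q f) i j • g i j
  let f (s : k) : M := κ f₁ + s • (κ f₂ - κ f₁) + ∑ i, ∑ j, U s i j • g i j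
  have hlin (A B : Matrix (Fin n) (Fin n) k) (i j : Fin n) :
      IsPolyFun fun s => A i j + s * (B i j - A i j) := (IsPolyFun.const _).add
        (IsPolyFun.id.mul (.const _))
  have hHpoly (i j) : IsPolyFun fun s => H s i j :=
    IsPolyFun.matrix_mul (IsPolyFun.matrix_mul (hlin G₁ G₂) (hlin K₁ K₂))
      (fun i j => hlin G₁ G₂ j i) i j
  have hUpoly (i j) : IsPolyFun fun s => U s i j := by
    simp only [U, Matrix.of_apply]
    split_ifs
    · exact hHpoly i j
    · exact hlin Q₁ Q₂ i j
    · exact .const 0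
  have hf : IsPolyCurve f := by
    intro ℓ
    simp only [f, map_add, map_smul, map_sum, smul_eq_mul]
    exact ((IsPolyFun.const _).add (IsPolyFun.id.mul (.const _))).add
      (.sum _ fun i => .sum _ fun j => (hUpoly i j).mul (.const _))
  have hquad (F : M) (hF : C.jet q F ∈ varIdeal k n ^ 2) : C.jet q (κ F) ∈ varIdeal k n ^ 3 := by
    have h1 := hasQuad_quadMatrix hF
    have h2 := hasQuad_sum hg (zero_mem (varIdeal k n ^ 3)) (quadMatrix (C.jet q F))
    rw [zero_add] at h2
    have h3 := sub_mem h1 h2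
    rw [sub_sub_sub_cancel_right] at h3
    have h4 : C.jet q (κ F) = C.jet q F -
        ∑ i, ∑ j, quadMatrix (C.jet q F) i j • C.jet q (g i j) := by
      simp only [κ, Submodule.coe_sub, map_sub, Submodule.coe_sum, map_sum, Submodule.coe_smul,
        map_smul]
    rwa [h4]
  have hHalt (s : k) : IsAlt (H s) := by
    refine IsAlt.conj ⟨fun i j => ?_, fun i => ?_⟩ (G s)
    · simp only [K, Matrix.of_apply, hK₁.1 i j, hK₂.1 i j]
    · simp only [K, Matrix.of_apply, hK₁.2, hK₂.2, sub_zero, mul_zero, add_zero]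
  have hUH (s : k) : U s + (U s).transpose = H s := by
    ext i j
    simp only [U, Matrix.add_apply, Matrix.transpose_apply, Matrix.of_apply]
    rcases lt_trichotomy i j with h | rfl | h
    · simp [h, h.not_gt, h.ne']
    · simp [CharTwo.add_self_eq_zero, (hHalt s).2]
    · simp [h, h.not_gt, h.ne', (hHalt s).1 i j]
  have hdeg (s : k) : IsDegenerate (C.jet q (f s)) := by
    have h1 : HasQuad (C.jet q (f s)) (U s) := by
      have h2 : C.jet q (κ f₁ + s • (κ f₂ - κ f₁) : M) ∈ varIdeal k n ^ 3 := by
        simp only [Submodule.coe_add, Submodule.coe_sub, Submodule.coe_smul, map_add, map_sub,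
          map_smul, MvPowerSeries.smul_eq_C_mul]
        exact add_mem (hquad f₁ hd₁.1) (Ideal.mul_mem_left _ _
          (sub_mem (hquad f₂ hd₂.1) (hquad f₁ hd₁.1)))
      have h3 := hasQuad_sum hg h2 (U s)
      have h4 : C.jet q (f s) = C.jet q (κ f₁ + s • (κ f₂ - κ f₁) : M) +
          ∑ i, ∑ j, U s i j • C.jet q (g i j) := by
        simp only [f, Submodule.coe_add (κ f₁ + s • (κ f₂ - κ f₁)), map_add, Submodule.coe_sum,
          map_sum, Submodule.coe_smul, map_smul]
      rwa [h4]
    refine ⟨h1.mem_sq, ?_⟩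
    rw [h1.hessian_eq, hUH, Matrix.det_mul, Matrix.det_mul]
    have : (G s).det = 0 := Matrix.det_eq_zero_of_column_eq_zero 0 fun i => by
      simp [G, hG₁, hG₂]
    rw [this, zero_mul, zero_mul]
  have hQ (F : MvPowerSeries (Fin n) k) (i j : Fin n) :
      quadMatrix F i j = if i < j then hessian F i j else if i = j then quadMatrix F i j else 0 := by
    rw [hessian_eq_quadMatrix]
    simp only [quadMatrix, Matrix.add_apply, Matrix.transpose_apply, Matrix.of_apply]
    rcases lt_trichotomy i j with h | rfl | h
    · simp [h, h.le, h.not_ge]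
    · simp
    · simp [h.not_ge, h.not_gt, h.ne']
  have hU0 : U 0 = Q₁ := by
    ext i j
    rw [hQ₁, hQ]
    simp only [U, Matrix.of_apply, H, G, K, zero_mul, add_zero, hH₁, hQ₁]
    rfl
  have hU1 : U 1 = Q₂ := by
    ext i j
    rw [hQ₂, hQ]
    simp only [U, Matrix.of_apply, H, G, K, one_mul, add_sub_cancel, hH₂, hQ₂]
    rfl
  have hf0 : f 0 = f₁ := by
    simp only [f, zero_smul, add_zero, hU0, κ, ← hQ₁, sub_add_cancel]
  have hf1 : f 1 = f₂ := by
    simp only [f, one_smul, add_sub_cancel, hU1, κ, ← hQ₂, sub_add_cancel]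
  have hfin1 := C.finite_notMem hf q hW₁ (s₀ := 0) (hf0.symm ▸ h₁) (by simpa only [hf0] using hm₁)
  have hfin2 := C.finite_notMem hf q hW₂ (s₀ := 1) (hf1.symm ▸ h₂) (by simpa only [hf1] using hm₂)
  -- Each open set misses only finitely many parameters, and k is infinite.
  obtain ⟨s, hs⟩ := (hfin1.union hfin2).exists_notMem
  simp only [Set.mem_union, Set.mem_setOf_eq, not_or, not_forall, not_not] at hs
  obtain ⟨⟨hn, h1⟩, _, h2⟩ := hs
  exact ⟨f s, hn, hdeg s, h1, h2⟩

omit [CharP k 2] [Infinite k] [NeZero n] in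
/-- A point of `R` extends to a local section of `R` over `X`. -/
theorem exists_open_spread [Module.Finite k M] (p : C.Point)
    (hs : Function.Surjective (V.evalMap M p 2))
    {W : Set (V.ProdPoint M)} (hW : IsOpen W) {f : M} (hf : f ≠ 0)
    (hd : IsDegenerate (C.jet p f)) (hm : of p p.2.2 f hf ∈ W) :
    ∃ U : V.X.Opens, (p : V.X) ∈ U ∧ ∀ q : C.Point, (q : V.X) ∈ U →
      ∃ (f' : M) (hf' : f' ≠ 0), IsDegenerate (C.jet q f') ∧ of q q.2.2 f' hf' ∈ W := by
  classical
  let J := {α : Fin n →₀ ℕ // α.degree < 3}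
  letI : Fintype J := (Finsupp.finite_of_degree_lt (σ := Fin n) 3).fintype
  choose g hg using fun j : J => C.exists_jet_sub_mem p hs (MvPolynomial.monomial j.1 1)
  have hev (q : C.Point) (c : k) : C.ev q (algebraMap k Γ(V.X, C.U) c) = c := (C.ev q).commutes c
  let t (s : M) (α : J) : Γ(V.X, C.U) := MvPowerSeries.coeff α.1 (C.c.T (C.φ s))
  have ht (q : C.Point) (s : M) (α : J) :
      C.ev q (t s α) = MvPowerSeries.coeff α.1 (C.jet q s) := by
    rw [C.jet_eq_map, MvPowerSeries.coeff_map]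
    rfl
  -- The 2-jets at a variable point of sections whose 2-jets at p are the monomials; this is the
  -- identity matrix at p.
  let N : Matrix J J Γ(V.X, C.U) := Matrix.of fun α j => t (g j) α
  have hN : N.map (C.ev p) = 1 := by
    ext α j
    have h1 := mem_varIdeal_pow.1 (hg j) α.1 α.2
    rw [map_sub, sub_eq_zero, MvPolynomial.coe_monomial, MvPowerSeries.coeff_monomial] at h1
    change C.ev p (t (g j) α) = _
    rw [ht, h1, Matrix.one_apply]
    exact if_congr Subtype.ext_iff.symm rfl rfl
  -- The amount by which the 2-jet of f at a variable point differs from its 2-jet at p. Correcting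
  -- f by Cramer's rule, without dividing by det N, gives a regular family F whose 2-jet at q is det
  -- N(q) times the 2-jet of f at p, hence degenerate.
  let v : J → Γ(V.X, C.U) := fun α => t f α - algebraMap k Γ(V.X, C.U) (C.ev p (t f α))
  let w : J → Γ(V.X, C.U) := N.adjugate.mulVec v
  let F (q : C.Point) : M := C.ev q N.det • f - ∑ j, C.ev q (w j) • g j
  have hFreg : C.IsRegularFamily F := by
    intro ℓ
    refine ⟨N.det * algebraMap k Γ(V.X, C.U) (ℓ f) - ∑ j, w j * algebraMap k Γ(V.X, C.U) (ℓ (g j)), fun q => ?_⟩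
    simp only [F, map_sub, map_sum, map_smul, map_mul, hev, smul_eq_mul]
  have hFp : F p = f := by
    have h1 : C.ev p N.det = 1 := by
      rw [AlgHom.map_det]
      change (N.map (C.ev p)).det = 1
      rw [hN, Matrix.det_one]
    have h2 (j) : C.ev p (w j) = 0 := by
      simp only [w, Matrix.mulVec, dotProduct, map_sum, map_mul, v, map_sub, hev,
        sub_self, mul_zero, Finset.sum_const_zero]
    simp only [F, h1, h2, one_smul, zero_smul, Finset.sum_const_zero, sub_zero]
  have hFjet (q : C.Point) :
      C.jet q (F q) - C.ev q N.det • C.jet p f ∈ varIdeal k n ^ 3 := by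
    rw [mem_varIdeal_pow]
    intro α hα
    have h1 : N.mulVec w = N.det • v := by
      rw [Matrix.mulVec_mulVec, Matrix.mul_adjugate, Matrix.smul_mulVec, Matrix.one_mulVec]
    have h2 := congrArg (C.ev q) (congrFun h1 ⟨α, hα⟩)
    simp only [Matrix.mulVec, dotProduct, map_sum, map_mul, Pi.smul_apply, smul_eq_mul, v, map_sub,
      hev, N, Matrix.of_apply, ht] at h2
    have h3 : C.jet q (F q) = C.ev q N.det • C.jet q f - ∑ j, C.ev q (w j) • C.jet q (g j) := by
      simp only [F, Submodule.coe_sub, map_sub, Submodule.coe_sum, map_sum, Submodule.coe_smul,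
        map_smul]
    rw [h3]
    simp only [map_sub, map_sum, map_smul, smul_eq_mul]
    simp only [mul_comm (C.ev q (w _)), N] at h2 ⊢
    linear_combination -h2
  have hFne : F p ≠ 0 := hFp ▸ hf
  obtain ⟨U₁, hp1, h1⟩ := C.exists_open_of_mem hFreg hW p hFne (by simpa only [hFp] using hm)
  obtain ⟨i, hi⟩ := Finsupp.ne_iff.1 (fun h => hf ((Module.finBasis k M).repr.map_eq_zero_iff.1 h) :
    (Module.finBasis k M).repr f ≠ 0)
  obtain ⟨a, ha⟩ := hFreg ((Module.finBasis k M).coord i)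
  refine ⟨U₁ ⊓ V.X.basicOpen a, ⟨hp1, ?_⟩, fun q hq => ?_⟩
  · refine (Scheme.mem_basicOpen _ _ _ p.2.1).2 ((C.isUnit_germ_iff p a).2 ?_)
    rw [← ha, hFp]
    exact hi
  · have hq2 := (C.isUnit_germ_iff q a).1 ((Scheme.mem_basicOpen _ _ _ q.2.1).1 hq.2)
    have hne : F q ≠ 0 := fun h => hq2 (by rw [← ha, h, map_zero])
    exact ⟨F q, hne, (hd.smul _).of_sub_mem (hFjet q), h1 q hq.1 hne⟩

end Chart

end PolarizedVariety

end DiscriminantVariety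
end

/-! ### The quadratic part of the model singularity -/

noncomputable section
namespace DiscriminantVariety

section StandardForm

open MvPowerSeries

variable {k : Type*} [Field k] [CharP k 2] {r : ℕ}

/-- The standard form as a polynomial. -/
def standardPoly (k : Type*) [Field k] (r : ℕ) : MvPolynomial (Fin (r + 2)) k :=
  ∑ ν : Fin (r / 2), MvPolynomial.X ⟨2 * ν, by omega⟩ * MvPolynomial.X ⟨2 * ν + 1, by omega⟩ +
    MvPolynomial.X (Fin.natAdd r 0) ^ 2 + MvPolynomial.X (Fin.natAdd r 0) ^ 3 +
    MvPolynomial.X (Fin.natAdd r 1) ^ 3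

omit [CharP k 2] in
lemma coe_standardPoly : (standardPoly k r : MvPowerSeries (Fin (r + 2)) k) = standardForm k r := by
  rw [← MvPolynomial.coeToMvPowerSeries.ringHom_apply]
  simp only [standardPoly, standardForm, map_add, map_sum, map_mul, map_pow,
    MvPolynomial.coeToMvPowerSeries.ringHom_apply, MvPolynomial.coe_X]

/-- The coefficients of the quadratic part of the standard form. -/
def standardQuad (k : Type*) [Field k] (r : ℕ) : Matrix (Fin (r + 2)) (Fin (r + 2)) k :=
  Matrix.of fun i j => if (i : ℕ) < r ∧ Even (i : ℕ) ∧ (j : ℕ) = i + 1 then 1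
    else if i = Fin.natAdd r 0 ∧ j = Fin.natAdd r 0 then 1 else 0

lemma sum_sum_ite_and {ι A : Type*} [Fintype ι] [DecidableEq ι] [AddCommMonoid A] (a b : ι)
    (f : ι → ι → A) : ∑ i, ∑ j, (if i = a ∧ j = b then f i j else 0) = f a b := by
  rw [Finset.sum_eq_single a, Finset.sum_eq_single b] <;> simp +contextual

lemma sum_sum_sum_add {ι κ A : Type*} [Fintype ι] [Fintype κ] [AddCommMonoid A]
    (f : κ → ι → ι → A) (g : ι → ι → A) :
    ∑ i, ∑ j, (∑ ν, f ν i j + g i j) = ∑ ν, ∑ i, ∑ j, f ν i j + ∑ i, ∑ j, g i j := by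
  simp only [Finset.sum_add_distrib]
  congr 1
  exact (Finset.sum_congr rfl fun i _ => Finset.sum_comm).trans Finset.sum_comm

omit [CharP k 2] in
lemma hasQuad_standardForm (hr : Even r) : HasQuad (standardForm k r) (standardQuad k r) := by
  have hr2 := Nat.even_iff.1 hr
  have h1 : ∑ i, ∑ j, C (standardQuad k r i j) * (X i * X j : MvPowerSeries (Fin (r + 2)) k) =
      ∑ ν : Fin (r / 2), X ⟨2 * ν, by omega⟩ * X ⟨2 * ν + 1, by omega⟩ + ξ₁ k r ^ 2 := by
    have h2 (i j : Fin (r + 2)) : C (standardQuad k r i j) * (X i * X j) =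
        ∑ ν : Fin (r / 2), (if i = ⟨2 * ν, by omega⟩ ∧ j = ⟨2 * ν + 1, by omega⟩ then
          (X i * X j : MvPowerSeries (Fin (r + 2)) k) else 0) +
        if i = Fin.natAdd r 0 ∧ j = Fin.natAdd r 0 then X i * X j else 0 := by
      rw [standardQuad, Matrix.of_apply]
      by_cases h : (i : ℕ) < r ∧ Even (i : ℕ) ∧ (j : ℕ) = i + 1
      · have h' : ¬ (i = Fin.natAdd r 0 ∧ j = Fin.natAdd r 0) := by
          rintro ⟨h3, -⟩
          have := congrArg Fin.val h3
          simp at this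
          omega
        obtain ⟨h3, ⟨t, ht⟩, h4⟩ := h
        rw [if_pos ⟨h3, ⟨t, ht⟩, h4⟩, if_neg h', map_one, one_mul, add_zero,
          Finset.sum_eq_single ⟨t, by omega⟩, if_pos]
        · constructor <;> ext <;> simp <;> omega
        · intro ν _ hν
          rw [if_neg]
          rintro ⟨h5, -⟩
          apply hν
          have := congrArg Fin.val h5
          ext
          simp at this ⊢
          omega
        · simp
      · rw [if_neg h, Finset.sum_eq_zero, zero_add]
        · split_ifs <;> simp
        · intro ν _
          rw [if_neg]
          rintro ⟨rfl, rfl⟩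
          refine h ⟨?_, by simp, by simp⟩
          have := ν.2
          simp
          omega
    rw [Finset.sum_congr rfl fun i _ => Finset.sum_congr rfl fun j _ => h2 i j]
    refine (sum_sum_sum_add _ _).trans ?_
    rw [sum_sum_ite_and, sq]
    congr 1
    exact Finset.sum_congr rfl fun ν _ => sum_sum_ite_and _ _ _
  rw [HasQuad, h1, standardForm, add_assoc _ (ξ₁ k r ^ 3), add_sub_cancel_left]
  exact add_mem (Ideal.pow_mem_pow (X_mem_varIdeal _) 3) (Ideal.pow_mem_pow (X_mem_varIdeal _) 3)

lemma standardQuad_add_transpose (hr : Even r) :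
    standardQuad k r + (standardQuad k r).transpose = stdAlternating k (r + 2) (r / 2) := by
  obtain ⟨t, rfl⟩ := hr
  ext i j
  simp only [Matrix.add_apply, Matrix.transpose_apply, standardQuad, Matrix.of_apply,
    stdAlternating, CharTwo.neg_eq, Fin.ext_iff, Fin.val_natAdd]
  have h2 : 2 * ((t + t) / 2) = t + t := by omega
  rw [h2]
  by_cases h3 : (i : ℕ) < t + t ∧ Even (i : ℕ) ∧ (j : ℕ) = i + 1
  · rw [if_pos h3, if_pos h3, if_neg, if_neg, add_zero]
    · rintro ⟨h4, h5⟩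
      have := h3.1
      simp at h5
      omega
    · rintro ⟨-, -, h4⟩
      omega
  · rw [if_neg h3, if_neg h3]
    by_cases h4 : (j : ℕ) < t + t ∧ Even (j : ℕ) ∧ (i : ℕ) = j + 1
    · rw [if_pos h4, if_pos h4, if_neg, zero_add]
      rintro ⟨h5, h6⟩
      have := h4.1
      simp at h6
      omega
    · rw [if_neg h4, if_neg h4]
      by_cases h5 : (i : ℕ) = t + t + (0 : Fin 2) ∧ (j : ℕ) = t + t + (0 : Fin 2)
      · rw [if_pos h5, if_pos h5.symm, CharTwo.add_self_eq_zero]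
      · rw [if_neg h5, if_neg (fun h => h5 h.symm), add_zero]

variable {F : MvPowerSeries (Fin (r + 2)) k}

lemma blockB_stdAlternating (hr : Even r) :
    blockB (stdAlternating k (r + 2) (r / 2)) = stdAlternating k r (r / 2) := by
  ext i j
  exact congr($(submatrix_stdAlternating (k := k) hr) (Sum.inl i) (Sum.inl j))

lemma blockC_stdAlternating (hr : Even r) :
    blockC (stdAlternating k (r + 2) (r / 2)) = 0 := by
  ext i j
  exact congr($(submatrix_stdAlternating (k := k) hr) (Sum.inl i) (Sum.inr j))

lemma hessian_of_hasQuad_standardQuad (hr : Even r) (hF : HasQuad F (standardQuad k r)) :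
    hessian F = stdAlternating k (r + 2) (r / 2) := by
  rw [hF.hessian_eq, standardQuad_add_transpose hr]

lemma isDegenerate_of_hasQuad_standardQuad (hr : Even r) (hF : HasQuad F (standardQuad k r)) :
    IsDegenerate F := by
  refine ⟨hF.mem_sq, ?_⟩
  rw [hessian_of_hasQuad_standardQuad hr hF, ← Matrix.det_submatrix_equiv_self finSumFinEquiv,
    submatrix_stdAlternating hr, Matrix.det_fromBlocks_zero₂₁, Matrix.det_zero, mul_zero]

lemma det_blockB_of_hasQuad_standardQuad (hr : Even r) (hF : HasQuad F (standardQuad k r)) :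
    (blockB (hessian F)).det ≠ 0 := by
  rw [hessian_of_hasQuad_standardQuad hr hF, blockB_stdAlternating hr]
  exact det_stdAlternating_ne_zero hr

/-- The kernel vector is a nonzero multiple of the basis vector of ξ₁, and the coefficient of ξ₁² is
1. The square in the model is included for this purpose. -/
lemma quadValue_kernelVector_of_hasQuad_standardQuad (hr : Even r)
    (hF : HasQuad F (standardQuad k r)) : quadValue F (kernelVector F) ≠ 0 := by
  have hH : hessianOver F = stdAlternating k (r + 2) (r / 2) :=
    (hessian_eq_quadMatrix F).symm.trans (hessian_of_hasQuad_standardQuad hr hF)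
  have hw : ∀ i, i ≠ Fin.natAdd r 0 → kernelVector F i = 0 := by
    intro i
    refine Fin.addCases (fun i _ => ?_) (fun b hb => ?_) i
    · rw [kernelVector, Fin.addCases_left, hH, blockC_stdAlternating hr]
      simp
    · rw [kernelVector, Fin.addCases_right, if_neg fun h => hb (by rw [h])]
  have hw0 : kernelVector F (Fin.natAdd r 0) ≠ 0 := by
    rw [kernelVector, Fin.addCases_right, if_pos rfl, hH, blockB_stdAlternating hr]
    exact det_stdAlternating_ne_zero hr
  have hU : standardQuad k r (Fin.natAdd r 0) (Fin.natAdd r 0) = 1 := by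
    simp [standardQuad]
  rw [hF.quadValue_eq, Finset.sum_eq_single (Fin.natAdd r 0),
    Finset.sum_eq_single (Fin.natAdd r 0), hU, mul_one]
  · exact mul_ne_zero hw0 hw0
  · intro i _ hi
    rw [hw i hi, mul_zero]
  · simp
  · intro i _ hi
    exact Finset.sum_eq_zero fun j _ => by rw [hw i hi, zero_mul, zero_mul]
  · simp

end StandardForm

end DiscriminantVariety
end

/-! ### Irreducibility of R and the good open subset -/

noncomputable section
namespace DiscriminantVariety

namespace PolarizedVariety

variable {k : Type u} [Field k] [IsAlgClosed k] [CharP k 2] {V : PolarizedVariety k}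
  {M : Submodule k V.Sections} {n m : ℕ}

open ProdPoint

lemma of_mem_R_iff (hn : Even n) (hM : Module.finrank k M = m + 1) (C : V.Chart n) (q : C.Point)
    (hq : (q : V.X) ∈ V.immersedPart M n) {f : M} (hf : f ≠ 0) :
    of q q.2.2 f hf ∈ V.R M n m ↔ IsDegenerate (C.jet q f) := by
  obtain ⟨c, hc, h⟩ := exists_f_of (hq := q.2.2) (hf := hf)
  refine (mem_R_iff (P := of (q : V.X) q.2.2 f hf) hn hM C q.2.1 hq).trans ?_
  have h1 : C.jet (C.under (of (q : V.X) q.2.2 f hf) q.2.1) (of (q : V.X) q.2.2 f hf).f =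
      c • C.jet q f := by
    rw [h, Submodule.coe_smul, map_smul]
    rfl
  rw [h1]
  refine ⟨fun h => ?_, fun h => h.smul c⟩
  have := h.smul c⁻¹
  rwa [inv_smul_smul₀ hc] at this

lemma exists_open_spread_R (hn : Even n) (hM : Module.finrank k M = m + 1)
    (hs : ∀ p ∈ V.immersedPart M n, Function.Surjective (V.evalMap M p 2))
    {W : Set (V.ProdPoint M)} (hW : IsOpen W) {P : V.ProdPoint M} (hP : P ∈ V.R M n m)
    (hPW : P ∈ W) :
    ∃ (U : V.X.Opens), P.pt ∈ U ∧ ∀ (q : V.X) (hq : q ∈ V.immersedPart M n), q ∈ U →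
      ∃ (f : M) (hf : f ≠ 0), of q hq.1.1 f hf ∈ V.R M n m ∧ of q hq.1.1 f hf ∈ W := by
  have : Module.Finite k M := Module.finite_of_finrank_pos (by omega)
  obtain ⟨C, hPC⟩ := V.exists_chart hP.1.1.2.1
  obtain ⟨U, hPU, h⟩ := C.exists_open_spread (C.under P hPC) (hs _ hP.1) hW P.f_ne_zero
    ((mem_R_iff hn hM C hPC hP.1).1 hP) (by rwa [of_f])
  refine ⟨U ⊓ C.U, ⟨hPU, hPC⟩, fun q hq hqU => ?_⟩
  obtain ⟨f, hf, hd, hm⟩ := h ⟨q, hqU.2, hq.1.1⟩ hqU.1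
  exact ⟨f, hf, (of_mem_R_iff hn hM C ⟨q, hqU.2, hq.1.1⟩ hq hf).2 hd, hm⟩

lemma nonempty_immersedPart (hdense : Dense (V.immersedPart M n)) :
    (V.immersedPart M n).Nonempty := by
  have := V.isIntegral
  exact hdense.nonempty

/-- Two nonempty open subsets of R both spread out over nonempty open subsets of X. These meet in a
point of the dense set X°, over which the irreducibility of the fibre applies. -/
theorem isIrreducible_R (hn0 : 0 < n) (hn : Even n) (hM : Module.finrank k M = m + 1)
    (hdense : Dense (V.immersedPart M n))
    (hs : ∀ p ∈ V.immersedPart M n, Function.Surjective (V.evalMap M p 2)) :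
    IsIrreducible (V.R M n m) := by
  have : Module.Finite k M := Module.finite_of_finrank_pos (by omega)
  have : NeZero n := ⟨hn0.ne'⟩
  have : Infinite k := IsAlgClosed.instInfinite
  refine ⟨?_, ?_⟩
  · obtain ⟨q, hq⟩ := nonempty_immersedPart hdense
    obtain ⟨C, hqC⟩ := V.exists_chart hq.1.2.1
    -- A section with 2-jet x₀² lies in R, since its Hessian at the point vanishes in characteristic
    -- two.
    obtain ⟨f, hf⟩ := C.exists_jet_sub_mem ⟨q, hqC, hq.1.1⟩ (hs q hq)
      (MvPolynomial.X 0 * MvPolynomial.X 0)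
    simp only [MvPolynomial.coe_mul, MvPolynomial.coe_X] at hf
    have hne : f ≠ 0 := by
      rintro rfl
      have h1 := mem_varIdeal_pow.1 hf (Finsupp.single 0 1 + Finsupp.single 0 1) (by simp)
      rw [map_sub, coeff_X_mul_X] at h1
      simp at h1
    refine ⟨of q hq.1.1 f hne, (of_mem_R_iff hn hM C ⟨q, hqC, hq.1.1⟩ hq hne).2 ?_⟩
    refine IsDegenerate.of_sub_mem ⟨?_, ?_⟩ hf
    · rw [sq]
      exact Ideal.mul_mem_mul (X_mem_varIdeal _) (X_mem_varIdeal _)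
    · refine Matrix.det_eq_zero_of_row_eq_zero 0 fun j => ?_
      rw [hessian_X_mul_X, CharTwo.add_self_eq_zero]
  · rintro W₁ W₂ hW₁ hW₂ ⟨P₁, hP₁, hP₁W⟩ ⟨P₂, hP₂, hP₂W⟩
    obtain ⟨U₁, hU₁, h₁⟩ := exists_open_spread_R hn hM hs hW₁ hP₁ hP₁W
    obtain ⟨U₂, hU₂, h₂⟩ := exists_open_spread_R hn hM hs hW₂ hP₂ hP₂W
    have := V.isIntegral
    have hne := nonempty_preirreducible_inter U₁.isOpen U₂.isOpen ⟨_, hU₁⟩ ⟨_, hU₂⟩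
    obtain ⟨q, hqU, hq⟩ := hdense.inter_open_nonempty _ (U₁.isOpen.inter U₂.isOpen) hne
    obtain ⟨f₁, hf₁, hR₁, hm₁⟩ := h₁ q hq hqU.1
    obtain ⟨f₂, hf₂, hR₂, hm₂⟩ := h₂ q hq hqU.2
    obtain ⟨C, hqC⟩ := V.exists_chart hq.1.2.1
    let q' : C.Point := ⟨q, hqC, hq.1.1⟩
    obtain ⟨f, hf, hd, hm⟩ := C.exists_mem_inter_of_fibre q' (hs q hq) hW₁ hW₂ hf₁ hf₂
      ((of_mem_R_iff hn hM C q' hq hf₁).1 hR₁) ((of_mem_R_iff hn hM C q' hq hf₂).1 hR₂) hm₁ hm₂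
    exact ⟨_, (of_mem_R_iff hn hM C q' hq hf).2 hd, hm⟩

/-- There is a nonempty open subset of `R` at whose points the singularities are mild. -/
theorem exists_open_good {r : ℕ} (hr : Even r) (hM : Module.finrank k M = m + 1)
    (hdense : Dense (V.immersedPart M (r + 2)))
    (hs : ∀ p ∈ V.immersedPart M (r + 2), Function.Surjective (V.evalMap M p 3)) :
    ∃ U : Set (V.ProdPoint M), IsOpen U ∧ (V.R M (r + 2) m ∩ U).Nonempty ∧
      ∀ P ∈ U ∩ V.R M (r + 2) m, P ∈ V.RSmooth M (r + 2) m ∧ IsTypeA (r + 2) P ∧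
        IsTypeC (r + 2) P := by
  have : Module.Finite k M := Module.finite_of_finrank_pos (by omega)
  have : Infinite k := IsAlgClosed.instInfinite
  have hn : Even (r + 2) := hr.add even_two
  obtain ⟨q, hq⟩ := nonempty_immersedPart hdense
  obtain ⟨C, hqC⟩ := V.exists_chart hq.1.2.1
  let q' : C.Point := ⟨q, hqC, hq.1.1⟩
  obtain ⟨f, hf⟩ := C.exists_jet_sub_mem q' (hs q hq) (standardPoly k r)
  rw [coe_standardPoly] at hf
  have hquad : HasQuad (C.jet q' f) (standardQuad k r) := by
    have h1 := add_mem (Ideal.pow_le_pow_right (by norm_num : 3 ≤ 3 + 1) hf)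
      (hasQuad_standardForm (k := k) hr)
    rwa [sub_add_sub_cancel] at h1
  have hf0 : f ≠ 0 := by
    rintro rfl
    have h1 := quadValue_kernelVector_of_hasQuad_standardQuad hr hquad
    simp [quadValue, quadMatrix] at h1
  let b := Module.finBasis k M
  -- Applied to the universal Taylor expansion, whose coefficients are polynomial in the section and
  -- regular on the chart; its specialization at the model section has Jacobian algebra spanned by
  -- the four listed elements.
  obtain ⟨Δ, hΔ, hΔr⟩ := exists_open_rank_le_four (C.universalJet b) (C.evalAt b q' f)
    ![1, ξ₁ k r, ξ₂ k r, ξ₁ k r * ξ₂ k r] (by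
      rw [C.map_universalJet]; exact span_sup_partialIdeal hr hf)
  let Δ₁ := (blockB (hessianOver (C.universalJet b))).det
  let Δ₂ := quadValue (C.universalJet b) (kernelVector (C.universalJet b))
  have h₁ (p : C.Point) (g : M) : C.evalAt b p g Δ₁ = (blockB (hessian (C.jet p g))).det := by
    rw [hessian_eq_quadMatrix, ← hessianOver, ← C.map_universalJet b, hessianOver_map, blockB_map]
    exact RingHom.map_det _ _
  have h₂ (p : C.Point) (g : M) : C.evalAt b p g Δ₂ =
      quadValue (C.jet p g) (kernelVector (C.jet p g)) := by
    rw [← C.map_universalJet b]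
    exact (quadValue_kernelVector_map _ _).symm
  refine ⟨_, C.isOpen_evalAt_ne_zero b (Δ * Δ₁ * Δ₂), ⟨of q hq.1.1 f hf0,
    (of_mem_R_iff hn hM C q' hq hf0).2 (isDegenerate_of_hasQuad_standardQuad hr hquad), hqC, ?_⟩,
    ?_⟩
  · obtain ⟨c, hc, h⟩ := exists_f_of (hq := hq.1.1) (hf := hf0)
    -- The three functions are known to be nonzero at f itself, so the representative of [f] is
    -- scaled back.
    refine ⟨c⁻¹, inv_ne_zero hc, ?_⟩
    have h3 : c⁻¹ • (of q hq.1.1 f hf0).f = f := by rw [h, inv_smul_smul₀ hc]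
    rw [h3, map_mul, map_mul]
    refine mul_ne_zero (mul_ne_zero hΔ ?_) ?_
    · exact (h₁ q' f).trans_ne (det_blockB_of_hasQuad_standardQuad hr hquad)
    · exact (h₂ q' f).trans_ne (quadValue_kernelVector_of_hasQuad_standardQuad hr hquad)
  · rintro P ⟨⟨hP, c, hc, h⟩, hR⟩
    rw [map_mul, map_mul] at h
    have hB := right_ne_zero_of_mul (left_ne_zero_of_mul h)
    have hq := right_ne_zero_of_mul h
    have hrank := hΔr _ (left_ne_zero_of_mul (left_ne_zero_of_mul h))
    rw [h₁] at hB
    rw [h₂] at hq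
    rw [C.map_universalJet] at hrank
    have hdeg : IsDegenerate (C.jet (C.under P hP) (c • P.f : M)) := by
      rw [Submodule.coe_smul, map_smul]
      exact ((mem_R_iff hn hM C hP hR.1).1 hR).smul c
    refine ⟨mem_RSmooth C hr hM hP hR (evalMap_surjective_of_le (by norm_num) (hs _ hR.1)) ?_,
      isTypeA_of_jet C hr hP hc hdeg hB hq, isTypeC_of_jet C hP hc hdeg hB hrank⟩
    rw [Submodule.coe_smul, map_smul, hessian_smul] at hB
    intro h0
    apply hB
    have hcB (H : Matrix (Fin (r + 2)) (Fin (r + 2)) k) : blockB (c • H) = c • blockB H := rfl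
    rw [hcB, Matrix.det_smul, h0, mul_zero]

end PolarizedVariety

end DiscriminantVariety
end

theorem proposition5p8 {k : Type u} [Field k] [IsAlgClosed k] [CharP k 2]
    (V : DiscriminantVariety.PolarizedVariety k) (n m : ℕ)
    (hn : 0 < n) (hn2 : Even n) (hdim : topologicalKrullDim V.X = n)
    (M : Submodule k V.Sections) (hM : Module.finrank k M = m + 1) (hmn : n < m)
    (hdense : Dense (V.immersedPart M n)) :
    ((∀ p ∈ V.immersedPart M n, Function.Surjective (V.evalMap M p 2)) →
      IsIrreducible (V.R M n m)) ∧
    ((∀ p ∈ V.immersedPart M n, Function.Surjective (V.evalMap M p 3)) →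
      V.R M n m ⊆ closure (V.RSmooth M n m) ∧
      V.HoldsAtGeneralPoint M n m (fun P =>
        DiscriminantVariety.PolarizedVariety.IsTypeA n P ∧
        DiscriminantVariety.PolarizedVariety.IsTypeC n P)) ∧
    ((∀ p ∈ V.immersedPart M n, Function.Surjective (V.evalMap M p 4)) →
      V.HoldsAtGeneralPoint M n m (fun P =>
        DiscriminantVariety.PolarizedVariety.IsTypeR n P)) := by
  have hirr (h : ∀ p ∈ V.immersedPart M n, Function.Surjective (V.evalMap M p 2)) :=
    DiscriminantVariety.PolarizedVariety.isIrreducible_R hn hn2 hM hdense h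
  have hgood (h : ∀ p ∈ V.immersedPart M n, Function.Surjective (V.evalMap M p 3)) :
      ∃ U : Set (V.ProdPoint M), IsOpen U ∧ V.R M n m ⊆ closure (U ∩ V.R M n m) ∧
        ∀ P ∈ U ∩ V.R M n m, P ∈ V.RSmooth M n m ∧
          DiscriminantVariety.PolarizedVariety.IsTypeA n P ∧
          DiscriminantVariety.PolarizedVariety.IsTypeC n P := by
    obtain ⟨r, rfl⟩ : ∃ r, n = r + 2 := ⟨n - 2, by
      obtain ⟨t, rfl⟩ := hn2
      omega⟩
    have hr : Even r := (Nat.even_add.1 hn2).2 even_two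
    obtain ⟨U, hU, hne, hP⟩ :=
      DiscriminantVariety.PolarizedVariety.exists_open_good hr hM hdense h
    refine ⟨U, hU, ?_, hP⟩
    rw [Set.inter_comm]
    -- In the irreducible set R a nonempty open subset is dense, so one good open set settles the
    -- general point.
    exact subset_closure_inter_of_isPreirreducible_of_isOpen (hirr fun p hp =>
      DiscriminantVariety.PolarizedVariety.evalMap_surjective_of_le (by norm_num) (h p hp)).2 hU hne
  refine ⟨hirr, fun h => ?_, fun h => ?_⟩
  · obtain ⟨U, hU, hcl, hP⟩ := hgood h
    exact ⟨hcl.trans (closure_mono fun P hPU => (hP P hPU).1),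
      U, hU, hcl, fun P hPU => (hP P hPU).2⟩
  · obtain ⟨U, hU, hcl, hP⟩ := hgood fun p hp =>
      DiscriminantVariety.PolarizedVariety.evalMap_surjective_of_le (by norm_num) (h p hp)
    exact ⟨U, hU, hcl, fun P hPU => (hP P hPU).2.2.isTypeR⟩
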